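/- **Setting.** Let $\varepsilon_0,\mu_0,\alpha,\beta,\gamma,\eta>0$ and $k\in\mathbb R$ be fixed, and put $$p(\omega)=\beta-\omega^2+\eta k^2-i\gamma\omega,\qquad \varepsilon(\omega,k)=\varepsilon_0+\frac{\alpha}{p(\omega)},\qquad \xi(\omega,k)=\mu_0(\varepsilon(\omega,k)-\varepsilon_0),\qquad k_0=\mu_0\varepsilon_0\omega .$$ Let $P=\{\omega: p(\omega)=0\}$ be the set of poles of the permittivity. All frequencies are taken in $\mathbb C\setminus(-\infty,0]$, outside $P$. Let $N\ge 2$ and let $D_1,\dots,D_N\subset\mathbb R^2$ be open sets (the particles), with size parameter $\rho=\tfrac12\max_i\operatorname{diam}D_i$. Fix $c,d,R>0$ and assume that all $D_i$ lie in the ball of radius $R$ about $0$, that $|x-y|\ge d$ for $x\in D_i$, $y\in D_j$, $i\ne j$, and that $|D_i|\ge c\rho^2$ for all $i$. Let $G(x,\kappa)=-\frac i4H^{(1)}_0(\kappa|x|)$, $\hat\gamma=\frac12e^{\gamma_E-i\pi/2}$ ($\gamma_E$ is Euler's constant) and $\log(\kappa\hat\gamma):=\log\kappa+\log\hat\gamma$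 with principal logarithms. For $u\in L^2(D_i)$ and $\kappa=\delta k_0$ let $$(K^{\kappa}_{D_i}u)(x)=-\int_{D_i}G(x-y,\kappa)u(y)\,dy\quad (x\in D_i),$$ $$(M^{\kappa}_{D_i}u)(x)=\int_{D_i}\Big[-\frac1{2\pi}\log(\kappa\hat\gamma)-\frac1{2\pi}\log|x-y|+\kappa^2\log(\kappa\hat\gamma)\,\frac{|x-y|^2}{8\pi}\Big]u(y)\,dy\quad (x\in D_i),$$ and let $R^{\kappa}_{D_iD_j}u$, $N^{\kappa}_{D_iD_j}u$ ($i\neq j$) be given by the same two formulas for $x\in D_j$. A *resonant frequency* is an $\omega$ for which the system $$u_i-\delta^2\omega^2\xi\,K^{\delta k_0}_{D_i}u_i-\delta^2\omega^2\xi\sum_{j\ne i}R^{\delta k_0}_{D_jD_i}u_j=0\ \text{ in } L^2(D_i),\qquad i=1,\dots,N,$$ has a solution $(u_1,\dots,u_N)\neq0$ in $L^2(D_1)\times\dots\times L^2(D_N)$. An *expanded resonant frequency* is defined in the same way with $M,N$ in place of $K,R$. A *principal eigenpair* $(\nu_i,\phi_i)$ of $M^{\delta k_0}_{D_i}$ is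 an eigenvalue of largest modulus together with an eigenvector of norm $1$ in $L^2(D_i)$. With such pairs, with $i^+=i+1$ for $i<N$ and $N^+=1$, and with $L^2$ inner products, put $$\mathcal B_i=\frac{\delta^2\omega^2\xi}{1-\delta^2\omega^2\xi\,\nu_i},\qquad \mathcal L_{ii}=\langle N^{\delta k_0}_{D_iD_{i^+}}\phi_i,\phi_{i^+}\rangle,\qquad \mathcal L_{ij}=-\mathcal B_i\,\langle N^{\delta k_0}_{D_jD_i}\phi_j,\phi_i\rangle\,\langle N^{\delta k_0}_{D_iD_{i^+}}\phi_i,\phi_{i^+}\rangle\quad(i\ne j).$$ We write "$\det\mathcal L(\omega)=0$" to mean that, for some choice of principal eigenpairs at $\omega$, $\delta^2\omega^2\xi\,\nu_i\ne1$ for all $i$ and the determinant vanishes. **Theorem.** Let in addition $\kappa_0,C>0$ and a compact set $Z\subset\mathbb C\setminus(-\infty,0]$ be given. For every $\epsilon>0$ there is $\rho_0>0$, depending only on $N$, $k$, the material constants, $c,d,R,\kappa_0,C,Z$ and $\epsilon$, such that for all $D_1,\dots,D_N$ as above with $\rho<\rho_0$ and all $\delta>0$ with $\rho\le\kappa_0\delta$,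 $\delta\le\kappa_0\rho$: 1. For all $\omega\in Z$ and all $i$, a principal eigenpair of $M^{\delta k_0}_{D_i}$ exists, $\nu_i$ is unique, and $\phi_i$ is unique up to a factor of modulus $1$. 2. If $\omega\in Z$ is a resonant frequency or an expanded resonant frequency, and $|\delta^2\omega^2\xi\,\nu_i|\le C$ and $|1-\delta^2\omega^2\xi\,\nu_i|\ge 1/C$ for all $i$, then there is $\omega'$ with $\det\mathcal L(\omega')=0$ and $|\omega'-\omega|\le\epsilon\,\operatorname{dist}(\omega,P)$. 3. If $\omega\in Z$ and $\det\mathcal L(\omega)=0$, then there are a resonant frequency $\omega'$ and an expanded resonant frequency $\omega''$ with $|\omega'-\omega|\le\epsilon\,\operatorname{dist}(\omega,P)$ and $|\omega''-\omega|\le\epsilon\,\operatorname{dist}(\omega,P)$. -/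

import Mathlib

open MeasureTheory

noncomputable section

namespace HalideResonators

/-- The plane with its Euclidean norm and Lebesgue measure. -/
abbrev Plane := EuclideanSpace ℝ (Fin 2)

/-! ### Material parameters -/

/-- The positive material constants: background permittivity and permeability, and the four
constants of the dispersive permittivity. -/
structure Material where
  eps0 : ℝ
  mu0 : ℝ
  alpha : ℝ
  beta : ℝ
  gamma : ℝ
  eta : ℝ
  eps0_pos : 0 < eps0
  mu0_pos : 0 < mu0
  alpha_pos : 0 < alpha
  beta_pos : 0 < beta
  gamma_pos : 0 < gamma
  eta_pos : 0 < eta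

/-- The denominator `β - ω² + η k² - i γ ω` of the permittivity. -/
def dispersion (m : Material) (k : ℝ) (ω : ℂ) : ℂ :=
  m.beta - ω ^ 2 + m.eta * (k : ℂ) ^ 2 - Complex.I * m.gamma * ω

/-- The poles (in `ω`) of the permittivity. -/
def materialPoles (m : Material) (k : ℝ) : Set ℂ := {ω | dispersion m k ω = 0}

/-- `ε(ω,k) = ε₀ + α / (β - ω² + η k² - i γ ω)`. -/
def permittivity (m : Material) (k : ℝ) (ω : ℂ) : ℂ := m.eps0 + m.alpha / dispersion m k ω

/-- The contrast `ξ(ω,k) = μ₀ (ε(ω,k) - ε₀)`. -/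
def contrast (m : Material) (k : ℝ) (ω : ℂ) : ℂ := m.mu0 * (permittivity m k ω - m.eps0)

/-- The rescaled background wavenumber `δ k₀`, with `k₀ = μ₀ ε₀ ω`. -/
def scaledWavenumber (m : Material) (δ : ℝ) (ω : ℂ) : ℂ := δ * (m.mu0 * m.eps0 * ω)

/-- The factor `δ² ω² ξ(ω,k)`. -/
def strength (m : Material) (k δ : ℝ) (ω : ℂ) : ℂ := (δ : ℂ) ^ 2 * ω ^ 2 * contrast m k ω

/-! ### The outgoing Green's function in two dimensions -/

/-- Bessel function of the first kind of order zero. -/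
def besselJ0 (z : ℂ) : ℂ := ∑' n : ℕ, (-1) ^ n / ((n.factorial : ℂ) ^ 2) * (z / 2) ^ (2 * n)

/-- Bessel function of the second kind of order zero (principal branch, cut along `(-∞, 0]`). -/
def besselY0 (z : ℂ) : ℂ :=
  2 / Real.pi * (Complex.log (z / 2) + Real.eulerMascheroniConstant) * besselJ0 z +
    2 / Real.pi * ∑' n : ℕ, (-1) ^ n * ((harmonic (n + 1) : ℚ) : ℂ) /
      (((n + 1).factorial : ℂ) ^ 2) * (z / 2) ^ (2 * (n + 1))

/-- Hankel function of the first kind of order zero. -/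
def hankel0 (z : ℂ) : ℂ := besselJ0 z + Complex.I * besselY0 z

/-- `G(x,κ) = -(i/4) H₀⁽¹⁾(κ|x|)`. -/
def green (κ : ℂ) (x : Plane) : ℂ := -(Complex.I / 4) * hankel0 (κ * ‖x‖)

/-! ### The integral operators

An operator with source particle `S` sends a function `u` on `S` to a function on the plane; its
values on the target particle are the ones that are used (equations on a particle are read almost
everywhere there). -/

/-- `K_S^κ u = - ∫_S G(x-y,κ) u(y) dy`, on `S`. -/
def opK (κ : ℂ) (S : Set Plane) (u : Plane → ℂ) (x : Plane) : ℂ :=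
  -∫ y in S, green κ (x - y) * u y

/-- `R_{S S'}^κ u = - ∫_S G(x-y,κ) u(y) dy`, on the other particle `S'`. -/
def opR (κ : ℂ) (S : Set Plane) (u : Plane → ℂ) (x : Plane) : ℂ :=
  -∫ y in S, green κ (x - y) * u y

/-- The constant `exp(γ_E - iπ/2) / 2`, with `γ_E` the Euler constant. -/
def gammaHat : ℂ :=
  Complex.exp (Real.eulerMascheroniConstant - Complex.I * (Real.pi / 2)) / 2

/-- `log(κ γ̂)`, holomorphic for `κ` off `(-∞, 0]`. -/
def logGammaHat (κ : ℂ) : ℂ := Complex.log κ + Complex.log gammaHat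

/-- The term `-(1/2π) log(γ̂ κ) ∫_S u`, of order `log κ`. -/
def opHat (κ : ℂ) (S : Set Plane) (u : Plane → ℂ) (_x : Plane) : ℂ :=
  -(1 / (2 * Real.pi)) * logGammaHat κ * ∫ y in S, u y

/-- The term of order zero, with the static kernel `-(1/2π) log|x-y|`. -/
def opZero (S : Set Plane) (u : Plane → ℂ) (x : Plane) : ℂ :=
  ∫ y in S, ((-(1 / (2 * Real.pi)) * Real.log ‖x - y‖ : ℝ) : ℂ) * u y

/-- The operator whose kernel `|x-y|²/(8π)` is the coefficient of `κ² log(γ̂ κ)` in the expansion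
of `-G(x-y,κ)` as `κ → 0`. -/
def opOne (S : Set Plane) (u : Plane → ℂ) (x : Plane) : ℂ :=
  ∫ y in S, ((1 / (8 * Real.pi) * ‖x - y‖ ^ 2 : ℝ) : ℂ) * u y

/-- The single-particle operator `M_S^κ`, on `S`. -/
def opM (κ : ℂ) (S : Set Plane) (u : Plane → ℂ) (x : Plane) : ℂ :=
  opHat κ S u x + opZero S u x + κ ^ 2 * logGammaHat κ * opOne S u x

/-- The interaction operator `N_{S S'}^κ`, on the other particle `S'`. -/
def opN (κ : ℂ) (S : Set Plane) (u : Plane → ℂ) (x : Plane) : ℂ :=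
  opHat κ S u x + opZero S u x + κ ^ 2 * logGammaHat κ * opOne S u x

/-! ### The resonance problem -/

/-- The frequency `ω` is one at which the system
`u_i - δ²ω²ξ A_{D_i} u_i - δ²ω²ξ ∑_{j ≠ i} B_{D_j D_i} u_j = 0` on `D_i`, for all `i`,
has a solution `u ≠ 0` in `L²(D_1) × ... × L²(D_N)`; here `A`, `B` are the diagonal and the
off-diagonal operators, taken at the wavenumber `δ k₀`. -/
def IsSystemResonance (A B : ℂ → Set Plane → (Plane → ℂ) → Plane → ℂ)
    {N : ℕ} (m : Material) (k δ : ℝ) (D : Fin N → Set Plane) (ω : ℂ) : Prop :=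
  ω ∈ Complex.slitPlane ∧ ω ∉ materialPoles m k ∧
  ∃ u : Fin N → Plane → ℂ,
    (∀ i, MemLp (u i) 2 (volume.restrict (D i))) ∧
    (∃ i, ¬ u i =ᵐ[volume.restrict (D i)] 0) ∧
    ∀ i, ∀ᵐ x ∂(volume.restrict (D i)),
      u i x - strength m k δ ω * A (scaledWavenumber m δ ω) (D i) (u i) x
        - strength m k δ ω *
          ∑ j ∈ Finset.univ.erase i, B (scaledWavenumber m δ ω) (D j) (u j) x = 0

/-- Resonant frequencies: the integral formulation with the Green's function itself. -/
def IsResonance {N : ℕ} (m : Material) (k δ : ℝ) (D : Fin N → Set Plane) (ω : ℂ) : Prop :=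
  IsSystemResonance opK opR m k δ D ω

/-- Resonant frequencies of the system with the expanded operators `M` and `N`. -/
def IsExpandedResonance {N : ℕ} (m : Material) (k δ : ℝ) (D : Fin N → Set Plane) (ω : ℂ) : Prop :=
  IsSystemResonance opM opN m k δ D ω

/-! ### Single-particle eigenpairs and the matrix -/

/-- The inner product of `L²(S)`. -/
def pairing (S : Set Plane) (f g : Plane → ℂ) : ℂ := ∫ x in S, f x * starRingEnd ℂ (g x)

/-- `φ` is a normalised eigenvector of `M_S^κ` in `L²(S)` with eigenvalue `ν`, and `ν` has the
largest modulus among the eigenvalues. -/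
def IsPrincipalEigenpair (κ : ℂ) (S : Set Plane) (ν : ℂ) (φ : Plane → ℂ) : Prop :=
  MemLp φ 2 (volume.restrict S) ∧ pairing S φ φ = 1 ∧
  (∀ᵐ x ∂(volume.restrict S), opM κ S φ x = ν * φ x) ∧
  ∀ (ν' : ℂ) (ψ : Plane → ℂ), MemLp ψ 2 (volume.restrict S) →
    (¬ ψ =ᵐ[volume.restrict S] 0) →
    (∀ᵐ x ∂(volume.restrict S), opM κ S ψ x = ν' * ψ x) → ‖ν'‖ ≤ ‖ν‖

/-- `𝓑_i = δ²ω²ξ / (1 - δ²ω²ξ ν_i)`. -/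
def bFactor (m : Material) (k δ : ℝ) (ω ν : ℂ) : ℂ :=
  strength m k δ ω / (1 - strength m k δ ω * ν)

/-- The `N × N` matrix `𝓛`; `finRotate N i` is the cyclic successor of `i`. -/
def matL {N : ℕ} (m : Material) (k δ : ℝ) (D : Fin N → Set Plane) (ω : ℂ)
    (ν : Fin N → ℂ) (φ : Fin N → Plane → ℂ) : Matrix (Fin N) (Fin N) ℂ :=
  Matrix.of fun i j =>
    if i = j then
      pairing (D (finRotate N i)) (opN (scaledWavenumber m δ ω) (D i) (φ i)) (φ (finRotate N i))
    else
      -bFactor m k δ ω (ν i)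
        * pairing (D i) (opN (scaledWavenumber m δ ω) (D j) (φ j)) (φ i)
        * pairing (D (finRotate N i)) (opN (scaledWavenumber m δ ω) (D i) (φ i))
            (φ (finRotate N i))

/-- `det 𝓛(ω) = 0`, where `𝓛` is formed with principal eigenpairs and all `𝓑_i` are finite. -/
def IsDetZero {N : ℕ} (m : Material) (k δ : ℝ) (D : Fin N → Set Plane) (ω : ℂ) : Prop :=
  ω ∈ Complex.slitPlane ∧ ω ∉ materialPoles m k ∧
  ∃ (ν : Fin N → ℂ) (φ : Fin N → Plane → ℂ),
    (∀ i, IsPrincipalEigenpair (scaledWavenumber m δ ω) (D i) (ν i) (φ i)) ∧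
    (∀ i, 1 - strength m k δ ω * ν i ≠ 0) ∧
    (matL m k δ D ω ν φ).det = 0

/-! ### Geometry -/

/-- The particle size parameter `ρ = (1/2) max_i diam(D_i)`. -/
def sizeParam {N : ℕ} (D : Fin N → Set Plane) : ℝ := (⨆ i, Metric.diam (D i)) / 2

/-- Dilute configurations: open particles in a fixed bounded region, at mutual distance at least
`d`, each of area at least `c ρ²`. -/
structure IsDilute {N : ℕ} (c d R : ℝ) (D : Fin N → Set Plane) : Prop where
  isOpen : ∀ i, IsOpen (D i)
  bounded : ∀ i, D i ⊆ Metric.ball 0 R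
  separated : ∀ i j, i ≠ j → ∀ x ∈ D i, ∀ y ∈ D j, d ≤ dist x y
  area : ∀ i, c * sizeParam D ^ 2 ≤ (volume (D i)).toReal

/-- At the frequency `ω` the principal eigenvalues `ν_i` satisfy `|δ²ω²ξ ν_i| ≤ C` and
`|1 - δ²ω²ξ ν_i| ≥ 1/C` for all `i`. -/
def InPrincipalRegime {N : ℕ} (C : ℝ) (m : Material) (k δ : ℝ) (D : Fin N → Set Plane)
    (ω : ℂ) : Prop :=
  ∀ (i : Fin N) (ν : ℂ) (φ : Plane → ℂ),
    IsPrincipalEigenpair (scaledWavenumber m δ ω) (D i) ν φ →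
      ‖strength m k δ ω * ν‖ ≤ C ∧ C⁻¹ ≤ ‖1 - strength m k δ ω * ν‖

/-- `ω'` agrees with `ω` at leading order, up to the relative error `ε`: their difference is at most
`ε` times the distance of `ω` to the poles of the permittivity. -/
def CloseAtLeadingOrder (ε : ℝ) (m : Material) (k : ℝ) (ω ω' : ℂ) : Prop :=
  ‖ω' - ω‖ ≤ ε * Metric.infDist ω (materialPoles m k)

end HalideResonators

end

open HalideResonators

/-! Write `ρ` for the size parameter, `s = δ²ω²ξ`, and `h = ρ² |log ρ| / (2π)`. Both kernels, the
exact one and the expanded one, are `-(1/2π) (log |x-y| + log (κ γ̂))` plus a tail that is small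
with `κ = δ k₀`. Since `δ` and `ρ` are comparable, `log (κ γ̂) = log ρ + O(1)`. On a single particle
`log |x-y|` contributes another `log ρ`, up to a remainder controlled in `L²`; between two particles
it is `O(1)`. Hence every block is `h (A_ij e_i ⊗ e_j + S_ij)`, where `e_i` is the normalised
constant on `D_i`, `A = diag(a_i²) + a aᵀ` with `a_i = √|D_i| / ρ` bounded above and below, and
`‖S_ij‖ = O(1 / |log ρ|)` uniformly on compact sets of frequencies
(`IsDilute.norm_remainderOperator_le`).

With the spectral parameter `z(ω) = 1 / (s h) = p(ω) / (ω² δ² μ₀ α h)`, each of the three notions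
becomes `det (z(ω) - B(ω)) = 0` for an `N × N` matrix `B`, continuous in `ω` and uniformly close to
`A`. For the two integral systems, `B` comes from eliminating the complement of the `e_i` by a
Neumann series (`exists_blockMap_eigenvector_iff`). For `𝓛`, dividing out nonvanishing row and
column factors leaves the matrix of the operators `M`, `N` in the principal eigenvectors
(`isDetZero_iff`). Those eigenvectors are perturbations of the `e_i`, found by a contraction.

It remains to compare zeros for different `B`. Roots `z` are bounded while `δ² h → 0`, so `p(ω)` is
small and `ω` is near a pole `y`. Put `q = ω - y`: then `z(ω + q t)` is close to `z(ω) (1 + b t)`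
with `|b| ≥ 1/2` (`exists_local_model`). The determinant along `t` is therefore close to a product
of affine functions, one of which almost vanishes at `t = 0`. As `B` involves normalised vectors and
sesquilinear pairings it is used only as a continuous function, so a winding number argument takes
the place of Rouché's theorem (`exists_zero_of_near_prod`, `exists_frequency_transfer`). The zero
found has `|t| ≤ ε`, that is, displacement at most `ε dist(ω, P)`.

All this needs `|z|` bounded below. For zeros of `det 𝓛` this follows from `A ≥ min a_i²`; for
resonances it is what `|s ν_i| ≤ C` provides. The condition `|1 - s ν_i| ≥ 1/C` keeps `z` away from
the values `ν_i / h`, so that every `𝓑_i` is still finite at the new frequency. -/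

namespace HalideResonators

open Set Filter Topology

/-! ### Winding numbers through continuous logarithms -/

/-- The loop `φ`, parametrised by `[0, 2π]`, has a continuous logarithm of increment `2πin`. -/
def HasWinding (φ : ℝ → ℂ) (n : ℤ) : Prop :=
  ∃ h : ℝ → ℂ, Continuous h ∧ (∀ θ, Complex.exp (h θ) = φ θ) ∧
    h (2 * Real.pi) = h 0 + n * (2 * Real.pi * Complex.I)

/-- The exponential is a covering of `ℂ \ {0}`, and maps from a simply connected, locally path
connected space lift through coverings. -/
theorem exists_continuous_log {X : Type*} [TopologicalSpace X] [LocallyPathConnectedSpace X]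
    [SimplyConnectedSpace X] {g : X → ℂ} (hg : Continuous g) (h0 : ∀ x, g x ≠ 0) :
    ∃ h : X → ℂ, Continuous h ∧ ∀ x, Complex.exp (h x) = g x := by
  obtain ⟨x₀⟩ : Nonempty X := inferInstance
  obtain ⟨h, ⟨-, hh⟩, -⟩ := Complex.isCoveringMapOn_exp.existsUnique_continuousMap_lifts
    ⟨g, hg⟩ (Complex.exp_log (h0 x₀)) (fun x => by simpa using h0 x)
  exact ⟨h, h.continuous, fun x => by simpa using congrFun hh x⟩

/-- Two logarithms of the same function differ by a continuous function with values in the discrete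
set `2πiℤ`, which is constant on a connected space. -/
theorem int_eq_of_continuous_exp_eq {X : Type*} [TopologicalSpace X] [PreconnectedSpace X]
    {h₁ h₂ : X → ℂ} (c₁ : Continuous h₁) (c₂ : Continuous h₂)
    (he : ∀ x, Complex.exp (h₁ x) = Complex.exp (h₂ x)) (x y : X) :
    h₁ x - h₂ x = h₁ y - h₂ y := by
  choose n hn using fun x => Complex.exp_eq_exp_iff_exists_int.1 (he x)
  have hpi : (2 * Real.pi * Complex.I : ℂ) ≠ 0 := Complex.two_pi_I_ne_zero
  have hd : ∀ x, ((n x : ℝ) : ℂ) = (h₁ x - h₂ x) / (2 * Real.pi * Complex.I) := by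
    intro x
    rw [hn x]
    field_simp
    simp
  have hc : Continuous fun x => (n x : ℝ) := by
    have : Continuous fun x => (((n x : ℝ) : ℂ)).re := by
      simp_rw [hd]
      fun_prop
    simpa using this
  have hc' : Continuous n := by
    rw [Int.isClosedEmbedding_coe_real.isEmbedding.continuous_iff]
    exact hc
  have hxy : n x = n y := PreconnectedSpace.constant inferInstance hc'
  rw [hn x, hn y, hxy]
  ring

theorem HasWinding.unique {φ : ℝ → ℂ} {n n' : ℤ} (h : HasWinding φ n) (h' : HasWinding φ n') :
    n = n' := by
  obtain ⟨f, hf, hfe, hfp⟩ := h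
  obtain ⟨g, hg, hge, hgp⟩ := h'
  have := int_eq_of_continuous_exp_eq hf hg (fun x => by rw [hfe, hge]) (2 * Real.pi) 0
  rw [hfp, hgp] at this
  have h2 : (n : ℂ) * (2 * Real.pi * Complex.I) = n' * (2 * Real.pi * Complex.I) := by
    linear_combination this
  exact_mod_cast mul_right_cancel₀ Complex.two_pi_I_ne_zero h2

theorem HasWinding.mul {φ ψ : ℝ → ℂ} {n n' : ℤ} (h : HasWinding φ n) (h' : HasWinding ψ n') :
    HasWinding (fun θ => φ θ * ψ θ) (n + n') := by
  obtain ⟨f, hf, hfe, hfp⟩ := h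
  obtain ⟨g, hg, hge, hgp⟩ := h'
  refine ⟨fun θ => f θ + g θ, hf.add hg, fun θ => by rw [Complex.exp_add, hfe, hge], ?_⟩
  simp only [hfp, hgp]
  push_cast
  ring

theorem HasWinding.prod {ι : Type*} (s : Finset ι) {φ : ι → ℝ → ℂ} {n : ι → ℤ}
    (h : ∀ i ∈ s, HasWinding (φ i) (n i)) :
    HasWinding (fun θ => ∏ i ∈ s, φ i θ) (∑ i ∈ s, n i) := by
  classical
  induction s using Finset.induction_on with
  | empty => exact ⟨fun _ => 0, continuous_const, by simp, by simp⟩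
  | insert a s ha ih =>
    simp only [Finset.prod_insert ha, Finset.sum_insert ha]
    exact (h a (by simp)).mul (ih fun i hi => h i (by simp [hi]))

theorem HasWinding.const {c : ℂ} (hc : c ≠ 0) : HasWinding (fun _ => c) 0 :=
  ⟨fun _ => Complex.log c, continuous_const, fun _ => Complex.exp_log hc, by simp⟩

/-- The principal logarithm is continuous on the unit disc about `1`. Combined with
`HasWinding.mul`, this shows that a perturbation smaller than the modulus of a loop does not change
its winding number. -/
theorem HasWinding.of_norm_sub_one_lt {φ : ℝ → ℂ} (hφ : Continuous φ)
    (hp : φ (2 * Real.pi) = φ 0) (h1 : ∀ θ, ‖φ θ - 1‖ < 1) : HasWinding φ 0 := by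
  have hs : ∀ θ, φ θ ∈ Complex.slitPlane := fun θ =>
    Complex.ball_one_subset_slitPlane (by simpa [dist_eq_norm] using h1 θ)
  refine ⟨fun θ => Complex.log (φ θ), hφ.clog hs,
    fun θ => Complex.exp_log (Complex.slitPlane_ne_zero (hs θ)), by simp [hp]⟩

theorem hasWinding_circleMap {s : ℝ} (hs : s ≠ 0) : HasWinding (circleMap 0 s) 1 := by
  have hs' : (s : ℂ) ≠ 0 := by exact_mod_cast hs
  refine ⟨fun θ => Complex.log s + θ * Complex.I, by fun_prop, fun θ => ?_, by simp⟩
  rw [Complex.exp_add, Complex.exp_log hs']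
  simp [circleMap]

theorem circleMap_two_pi (c : ℂ) (s : ℝ) : circleMap c s (2 * Real.pi) = circleMap c s 0 := by
  simpa using periodic_circleMap c s 0

/-- On the circle the dominant term is factored out: `t - w = t (1 - w/t)` when `w` is inside, and
`t - w = -w (1 - t/w)` when it is outside. -/
theorem hasWinding_circleMap_sub_of_lt {s : ℝ} {w : ℂ} (hw : ‖w‖ < s) :
    HasWinding (fun θ => circleMap 0 s θ - w) 1 := by
  have hs : 0 < s := (norm_nonneg _).trans_lt hw
  have hne : ∀ θ, circleMap 0 s θ ≠ 0 := fun θ => circleMap_ne_center hs.ne'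
  have h := (hasWinding_circleMap hs.ne').mul (HasWinding.of_norm_sub_one_lt
    (φ := fun θ => 1 - w / circleMap 0 s θ)
    (continuous_const.sub (continuous_const.div (continuous_circleMap 0 s) hne))
    (by simp [circleMap_two_pi]) (fun θ => by
      simpa [abs_of_pos hs, div_lt_one hs] using hw))
  rw [add_zero] at h
  convert h using 2 with θ
  have := hne θ
  field_simp

theorem hasWinding_circleMap_sub_of_gt {s : ℝ} (hs : 0 ≤ s) {w : ℂ} (hw : s < ‖w‖) :
    HasWinding (fun θ => circleMap 0 s θ - w) 0 := by
  have hw0 : w ≠ 0 := by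
    rintro rfl
    simp at hw
    linarith
  have h := (HasWinding.const (neg_ne_zero.2 hw0)).mul (HasWinding.of_norm_sub_one_lt
    (φ := fun θ => 1 - circleMap 0 s θ / w) (by fun_prop)
    (by simp [circleMap_two_pi]) (fun θ => by
      simpa [abs_of_nonneg hs, div_lt_one (norm_pos_iff.2 hw0)] using hw))
  rw [add_zero] at h
  convert h using 2 with θ
  field_simp
  ring

/-- A loop which bounds a disc in `ℂ \ {0}` does not wind around the origin. -/
theorem HasWinding.of_disc {f : ℂ → ℂ} {s : ℝ} (hs : 0 ≤ s)
    (hf : ContinuousOn f (Metric.closedBall 0 s)) (h0 : ∀ t ∈ Metric.closedBall (0 : ℂ) s, f t ≠ 0) :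
    HasWinding (fun θ => f (circleMap 0 s θ)) 0 := by
  -- Polar coordinates with the radius clamped to `[0, s]`, so that the map is defined on all of `ℝ
  -- × ℝ`, which is simply connected.
  have hmem : ∀ p : ℝ × ℝ, circleMap 0 (projIcc 0 s hs p.1 : ℝ) p.2 ∈ Metric.closedBall (0 : ℂ) s := by
    intro p
    have := (projIcc 0 s hs p.1).2
    simp [abs_of_nonneg this.1, this.2]
  have hc : Continuous fun p : ℝ × ℝ => circleMap 0 (projIcc 0 s hs p.1 : ℝ) p.2 := by
    have : Continuous fun p : ℝ × ℝ => (projIcc 0 s hs p.1 : ℝ) :=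
      continuous_subtype_val.comp (continuous_projIcc.comp continuous_fst)
    unfold circleMap
    fun_prop
  obtain ⟨h, hh, hhe⟩ := exists_continuous_log
    (g := fun p : ℝ × ℝ => f (circleMap 0 (projIcc 0 s hs p.1 : ℝ) p.2))
    (hf.comp_continuous hc hmem) (fun p => h0 _ (hmem p))
  -- The increment of the logarithm over one turn does not depend on the radius, and at radius `0`
  -- the loop is constant.
  have e1 := int_eq_of_continuous_exp_eq (X := ℝ) (h₁ := fun r => h (r, 2 * Real.pi))
    (h₂ := fun r => h (r, 0)) (by fun_prop) (by fun_prop)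
    (fun r => by rw [hhe, hhe, circleMap_two_pi]) s 0
  have e2 := int_eq_of_continuous_exp_eq (X := ℝ) (h₁ := fun θ => h (0, θ))
    (h₂ := fun _ => h (0, 0)) (by fun_prop) (by fun_prop)
    (fun θ => by rw [hhe, hhe]; simp) (2 * Real.pi) 0
  refine ⟨fun θ => h (s, θ), by fun_prop, fun θ => by rw [hhe]; simp, ?_⟩
  have e3 : h (s, 2 * Real.pi) - h (s, 0) = 0 := by
    rw [e1, e2]; simp
  simpa [sub_eq_zero] using e3

/-! ### Zeros of continuous perturbations of products of affine functions -/

theorem exists_radius_avoiding {N : ℕ} (x : Fin N → ℝ) {ε : ℝ} (hε : 0 < ε) :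
    ∃ s, ε / 2 ≤ s ∧ s ≤ ε ∧ ∀ j, ε / (8 * (N + 1)) ≤ |s - x j| := by
  by_contra! H
  have hN : (0 : ℝ) < N + 1 := by positivity
  -- Pigeonhole: the `N + 1` radii are spaced by `ε / (2 (N + 1))`, so no point lies within `ε / (8
  -- (N + 1))` of two of them, and `N` points cannot spoil them all.
  have hs : ∀ i : Fin (N + 1), ∃ j, |ε / 2 + ε / (2 * (N + 1)) * i - x j| < ε / (8 * (N + 1)) := by
    intro i
    refine H _ ?_ ?_
    · have : 0 ≤ ε / (2 * (N + 1)) * (i : ℝ) := by positivity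
      linarith
    · have hi : (i : ℝ) ≤ N + 1 := by
        have := i.2
        exact_mod_cast this.le
      have : ε / (2 * (N + 1)) * (i : ℝ) ≤ ε / (2 * (N + 1)) * (N + 1) := by gcongr
      have h2 : ε / (2 * (N + 1)) * ((N : ℝ) + 1) = ε / 2 := by field_simp
      linarith
  choose j hj using hs
  obtain ⟨a, b, hab, hjab⟩ := Fintype.exists_ne_map_eq_of_card_lt j (by simp)
  have h1 := hj a
  have h2 := hj b
  rw [hjab] at h1
  have h3 : |ε / (2 * (N + 1)) * ((a : ℝ) - b)| < ε / (4 * (N + 1)) := by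
    have e : ε / (2 * (N + 1)) * ((a : ℝ) - b) =
      (ε / 2 + ε / (2 * (N + 1)) * (a : ℝ) - x (j b)) -
        (ε / 2 + ε / (2 * (N + 1)) * (b : ℝ) - x (j b)) := by ring
    rw [e]
    refine (abs_sub _ _).trans_lt ((add_lt_add h1 h2).trans_eq ?_)
    field_simp
    norm_num
  have h4 : (1 : ℝ) ≤ |(a : ℝ) - b| := by
    have : (a : ℤ) - b ≠ 0 := by
      intro h
      exact hab (Fin.ext (by omega))
    exact_mod_cast Int.one_le_abs this
  rw [abs_mul, abs_of_pos (by positivity)] at h3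
  have h5 : ε / (2 * (N + 1)) * 1 < ε / (4 * (N + 1)) := by
    refine lt_of_le_of_lt ?_ h3
    gcongr
  rw [mul_one, div_lt_div_iff₀ (by positivity) (by positivity)] at h5
  nlinarith

/-- A continuous function close to a product of nearly affine functions, one of which nearly
vanishes at the centre of a disc, has a zero in the disc. -/
theorem exists_zero_of_near_prod {N : ℕ} {ε η : ℝ} (hε : 0 < ε) {z₀ b : ℂ} (hb : b ≠ 0)
    {l : Fin N → ℂ} {g f : ℂ → ℂ}
    (hg : ContinuousOn g (Metric.closedBall 0 ε)) (hf : ContinuousOn f (Metric.closedBall 0 ε))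
    (hga : ∀ t ∈ Metric.closedBall (0 : ℂ) ε, ‖g t - (z₀ + b * t)‖ ≤ ‖b‖ * ε / (16 * (N + 1)))
    (hl : ∃ j, ‖l j - z₀‖ ≤ ‖b‖ * ε / 4)
    (hη : η < (‖b‖ * ε / (16 * (N + 1))) ^ N)
    (hfg : ∀ t ∈ Metric.closedBall (0 : ℂ) ε, ‖f t - ∏ j, (g t - l j)‖ ≤ η) :
    ∃ t ∈ Metric.closedBall (0 : ℂ) ε, f t = 0 := by
  by_contra! h0
  have hb' : 0 < ‖b‖ := norm_pos_iff.2 hb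
  -- The zeros of the affine models `z₀ + b t - l j`; the radius `s` stays away from all their
  -- moduli.
  set w : Fin N → ℂ := fun j => (l j - z₀) / b with hw
  obtain ⟨s, hs1, hs2, hs3⟩ := exists_radius_avoiding (fun j => ‖w j‖) hε
  have hs0 : 0 < s := by linarith
  have hsub : Metric.closedBall (0 : ℂ) s ⊆ Metric.closedBall 0 ε := Metric.closedBall_subset_closedBall hs2
  have hcm : ∀ θ, circleMap 0 s θ ∈ Metric.closedBall (0 : ℂ) ε := fun θ =>
    hsub (by simp [abs_of_pos hs0])
  -- On the circle each affine factor has modulus at least `2 m` and `g` deviates from its model by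
  -- at most `m`. So each true factor has modulus at least `m` and the winding number of its model,
  -- and the product is at least `m ^ N > η`.
  set m : ℝ := ‖b‖ * ε / (16 * (N + 1)) with hm
  have hm0 : 0 < m := by positivity
  have hlow : ∀ j θ, 2 * m ≤ ‖b * (circleMap 0 s θ - w j)‖ := by
    intro j θ
    rw [norm_mul]
    have h1 : |s - ‖w j‖| ≤ ‖circleMap 0 s θ - w j‖ := by
      have := abs_norm_sub_norm_le (circleMap 0 s θ) (w j)
      simpa [abs_of_pos hs0] using this
    have h2 := (hs3 j).trans h1
    calc 2 * m = ‖b‖ * (ε / (8 * (N + 1))) := by rw [hm]; field_simp; norm_num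
      _ ≤ _ := by gcongr
  have hsplit : ∀ j θ, g (circleMap 0 s θ) - l j =
      b * (circleMap 0 s θ - w j) + (g (circleMap 0 s θ) - (z₀ + b * circleMap 0 s θ)) := by
    intro j θ
    simp only [hw]
    field_simp
    ring
  have hlow' : ∀ j θ, m ≤ ‖g (circleMap 0 s θ) - l j‖ := by
    intro j θ
    rw [hsplit]
    have h1 := hlow j θ
    have h2 := hga _ (hcm θ)
    have h3 := norm_sub_le_norm_add (b * (circleMap 0 s θ - w j))
      (g (circleMap 0 s θ) - (z₀ + b * circleMap 0 s θ))
    linarith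
  have hgc : Continuous fun θ => g (circleMap 0 s θ) := hg.comp_continuous (by fun_prop) hcm
  have hfc : Continuous fun θ => f (circleMap 0 s θ) := hf.comp_continuous (by fun_prop) hcm
  have hfac : ∀ j, HasWinding (fun θ => g (circleMap 0 s θ) - l j) (if ‖w j‖ < s then 1 else 0) := by
    intro j
    have hne : ∀ θ, b * (circleMap 0 s θ - w j) ≠ 0 := fun θ => norm_pos_iff.1 (by linarith [hlow j θ])
    have h1 : HasWinding (fun θ => circleMap 0 s θ - w j) (if ‖w j‖ < s then 1 else 0) := by
      split_ifs with hlt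
      · exact hasWinding_circleMap_sub_of_lt hlt
      · refine hasWinding_circleMap_sub_of_gt hs0.le (lt_of_le_of_ne (not_lt.1 hlt) fun h => ?_)
        have := hs3 j
        rw [h] at this
        simp only [sub_self, abs_zero] at this
        have : 0 < ε / (8 * ((N : ℝ) + 1)) := by positivity
        linarith
    have h2 := ((HasWinding.const hb).mul h1).mul (HasWinding.of_norm_sub_one_lt
      (φ := fun θ => (g (circleMap 0 s θ) - l j) / (b * (circleMap 0 s θ - w j)))
      (by exact (hgc.sub continuous_const).div (by fun_prop) hne)
      (by simp [circleMap_two_pi]) (fun θ => by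
        have hne' := hne θ
        have e : (g (circleMap 0 s θ) - l j) / (b * (circleMap 0 s θ - w j)) - 1 =
          (g (circleMap 0 s θ) - (z₀ + b * circleMap 0 s θ)) / (b * (circleMap 0 s θ - w j)) := by
          rw [hsplit, add_div, div_self hne']
          ring
        rw [e, norm_div, div_lt_one (norm_pos_iff.2 hne')]
        linarith [hlow j θ, hga _ (hcm θ)]))
    simp only [zero_add, add_zero] at h2
    convert h2 using 2 with θ
    rw [mul_div_cancel₀ _ (hne θ)]
  have hprod := HasWinding.prod Finset.univ (fun j _ => hfac j)
  have hplow : ∀ θ, m ^ N ≤ ‖∏ j, (g (circleMap 0 s θ) - l j)‖ := by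
    intro θ
    rw [norm_prod]
    calc m ^ N = ∏ _j : Fin N, m := by simp
      _ ≤ _ := Finset.prod_le_prod (fun _ _ => hm0.le) fun j _ => hlow' j θ
  have hpne : ∀ θ, ∏ j, (g (circleMap 0 s θ) - l j) ≠ 0 := fun θ =>
    norm_pos_iff.1 (lt_of_lt_of_le (by positivity) (hplow θ))
  have hfw := hprod.mul (HasWinding.of_norm_sub_one_lt
      (φ := fun θ => f (circleMap 0 s θ) / ∏ j, (g (circleMap 0 s θ) - l j))
      (by
        exact hfc.div (continuous_finsetProd _ fun j _ => hgc.sub continuous_const) hpne) (by simp [circleMap_two_pi]) (fun θ => by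
        have hne' := hpne θ
        rw [div_sub_one hne', norm_div, div_lt_one (norm_pos_iff.2 hne')]
        linarith [hplow θ, hfg _ (hcm θ)]))
  have hf0 := HasWinding.of_disc hs0.le (hf.mono hsub) (fun t ht => h0 t (hsub ht))
  have hfw' : HasWinding (fun θ => f (circleMap 0 s θ)) (∑ j, (if ‖w j‖ < s then 1 else 0) + 0) := by
    convert hfw using 2 with θ
    rw [mul_div_cancel₀ _ (hpne θ)]
  have h := hfw'.unique hf0
  obtain ⟨j, hj⟩ := hl
  -- The root near the centre has `‖w j‖ ≤ ε / 4 < s`, so the winding number of `f` is positive,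
  -- whereas a zero-free `f` on the disc has winding number `0`.
  have hjs : ‖w j‖ < s := by
    simp only [hw, norm_div]
    rw [div_lt_iff₀ hb']
    nlinarith
  have hpos : 0 < ∑ j, (if ‖w j‖ < s then (1 : ℤ) else 0) :=
    Finset.sum_pos' (fun i _ => by split_ifs <;> simp) ⟨j, by simp, by simp [hjs]⟩
  omega

/-! ### Dominant eigenpair of a small perturbation of a rank one projection -/

section DominantVector

variable {E : Type*} [NormedAddCommGroup E] [InnerProductSpace ℂ E]

/-- The map whose fixed points `φ` are the eigenvectors of `e ⊗ e + s` with `⟪e, φ⟫ = 1`. -/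
noncomputable def eigenvectorMap (e : E) (s : E →L[ℂ] E) (φ : E) : E := e + s φ - inner ℂ e (s φ) • φ

theorem norm_inner_apply_le {e : E} (he : ‖e‖ = 1) (s : E →L[ℂ] E) (φ : E) :
    ‖inner ℂ e (s φ)‖ ≤ ‖s‖ * ‖φ‖ := by
  calc _ ≤ ‖e‖ * ‖s φ‖ := norm_inner_le_norm _ _
    _ ≤ _ := by rw [he, one_mul]; exact s.le_opNorm φ

/-- One estimate serves three purposes: `s' = 0`, whose map is constantly `e`, gives invariance of
the ball and closeness to `e`; `s' = s` gives the contraction and uniqueness; general `s'` gives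
Lipschitz dependence on `s`. -/
theorem norm_eigenvectorMap_sub_le {e : E} (he : ‖e‖ = 1) (s s' : E →L[ℂ] E) {φ φ' : E}
    (hφ : ‖φ‖ ≤ 2) (hφ' : ‖φ'‖ ≤ 2) :
    ‖eigenvectorMap e s φ - eigenvectorMap e s' φ'‖ ≤ 5 * ‖s‖ * ‖φ - φ'‖ + 6 * ‖s - s'‖ := by
  have e1 : eigenvectorMap e s φ - eigenvectorMap e s' φ' =
      (s (φ - φ') - inner ℂ e (s (φ - φ')) • φ - inner ℂ e (s φ') • (φ - φ')) +
        ((s - s') φ' - inner ℂ e ((s - s') φ') • φ') := by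
    simp only [eigenvectorMap, map_sub, inner_sub_right, sub_apply, sub_smul,
      smul_sub]
    abel
  have h1 := s.le_opNorm (φ - φ')
  have h2 : ‖inner ℂ e (s (φ - φ')) • φ‖ ≤ ‖s‖ * ‖φ - φ'‖ * 2 := by
    rw [norm_smul]
    gcongr
    exact norm_inner_apply_le he s _
  have h3 : ‖inner ℂ e (s φ') • (φ - φ')‖ ≤ ‖s‖ * 2 * ‖φ - φ'‖ := by
    rw [norm_smul]
    gcongr
    exact (norm_inner_apply_le he s _).trans (by gcongr)
  have h4 : ‖(s - s') φ'‖ ≤ ‖s - s'‖ * 2 := ((s - s').le_opNorm φ').trans (by gcongr)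
  have h5 : ‖inner ℂ e ((s - s') φ') • φ'‖ ≤ ‖s - s'‖ * 2 * 2 := by
    rw [norm_smul]
    gcongr
    exact (norm_inner_apply_le he _ _).trans (by gcongr)
  rw [e1]
  refine (norm_add_le _ _).trans ?_
  have h6 := norm_sub_le (s (φ - φ') - inner ℂ e (s (φ - φ')) • φ) (inner ℂ e (s φ') • (φ - φ'))
  have h7 := norm_sub_le (s (φ - φ')) (inner ℂ e (s (φ - φ')) • φ)
  have h8 := norm_sub_le ((s - s') φ') (inner ℂ e ((s - s') φ') • φ')
  linarith

theorem norm_le_two_of_norm_sub_le {E : Type*} [NormedAddCommGroup E] {e φ : E} (he : ‖e‖ = 1) (h : ‖φ - e‖ ≤ 1) : ‖φ‖ ≤ 2 := by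
  have := norm_add_le (φ - e) e
  rw [sub_add_cancel] at this
  linarith

theorem exists_eigenvectorMap_fixed [CompleteSpace E] {e : E} (he : ‖e‖ = 1) {s : E →L[ℂ] E}
    (hs : ‖s‖ ≤ 1 / 16) : ∃ φ, ‖φ - e‖ ≤ 1 ∧ eigenvectorMap e s φ = φ := by
  have hmaps : MapsTo (eigenvectorMap e s) (Metric.closedBall e 1) (Metric.closedBall e 1) := by
    intro φ hφ
    rw [mem_closedBall_iff_norm] at hφ ⊢
    have h2 := norm_le_two_of_norm_sub_le he hφ
    have := norm_eigenvectorMap_sub_le he s 0 h2 h2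
    simp only [eigenvectorMap, zero_apply, inner_zero_right, zero_smul,
      add_zero, sub_zero, sub_self, norm_zero, mul_zero, zero_add] at this
    simp only [eigenvectorMap]
    linarith
  have hc : ContractingWith (1 / 2) hmaps.restrict := by
    refine ⟨by norm_num [← NNReal.coe_lt_coe], LipschitzWith.of_dist_le_mul fun x y => ?_⟩
    have hx := norm_le_two_of_norm_sub_le he (mem_closedBall_iff_norm.1 x.2)
    have hy := norm_le_two_of_norm_sub_le he (mem_closedBall_iff_norm.1 y.2)
    have := norm_eigenvectorMap_sub_le he s s hx hy
    simp only [sub_self, norm_zero, mul_zero, add_zero] at this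
    rw [Subtype.dist_eq, Subtype.dist_eq, dist_eq_norm, dist_eq_norm]
    refine this.trans ?_
    push_cast
    gcongr
    linarith
  obtain ⟨φ, h1, h2, -⟩ := hc.exists_fixedPoint' Metric.isClosed_closedBall.isComplete hmaps
    (x := e) (by simp) (edist_ne_top _ _)
  exact ⟨φ, mem_closedBall_iff_norm.1 h1, h2⟩

/-- The eigenvector `φ` of `e ⊗ e + s` near `e`, normalised by `⟪e, φ⟫ = 1`. -/
noncomputable def dominantVector (e : E) (s : E →L[ℂ] E) : E :=
  Classical.epsilon fun φ => ‖φ - e‖ ≤ 1 ∧ eigenvectorMap e s φ = φ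

/-- The eigenvalue of `e ⊗ e + s` near `1`. -/
noncomputable def dominantValue (e : E) (s : E →L[ℂ] E) : ℂ := 1 + inner ℂ e (s (dominantVector e s))

variable [CompleteSpace E] {e : E} (he : ‖e‖ = 1) {s : E →L[ℂ] E} (hs : ‖s‖ ≤ 1 / 16)
include he hs

theorem dominantVector_spec :
    ‖dominantVector e s - e‖ ≤ 1 ∧ eigenvectorMap e s (dominantVector e s) = dominantVector e s :=
  Classical.epsilon_spec (exists_eigenvectorMap_fixed he hs)

theorem norm_dominantVector_le_two : ‖dominantVector e s‖ ≤ 2 :=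
  norm_le_two_of_norm_sub_le he (dominantVector_spec he hs).1

theorem norm_dominantValue_sub_one_le : ‖dominantValue e s - 1‖ ≤ 2 * ‖s‖ := by
  have := norm_inner_apply_le he s (dominantVector e s)
  have h2 := norm_dominantVector_le_two he hs
  rw [dominantValue, add_sub_cancel_left]
  nlinarith [norm_nonneg s]

/-- Pairing the fixed point equation with `e` gives `(⟪e, φ⟫ - 1) (1 + ⟪e, s φ⟫) = 0`, and the
second factor is the eigenvalue, which is near `1`. -/
theorem inner_dominantVector : inner ℂ e (dominantVector e s) = 1 := by
  set φ := dominantVector e s with hφ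
  have h := congrArg (fun x => inner ℂ e x) (dominantVector_spec he hs).2
  simp only [eigenvectorMap, inner_sub_right, inner_add_right, inner_smul_right,
    inner_self_eq_norm_sq_to_K, he, ← hφ] at h
  have h1 : (inner ℂ e φ - 1) * (1 + inner ℂ e (s φ)) = 0 := by
    push_cast at h
    linear_combination -h
  rcases mul_eq_zero.1 h1 with h2 | h2
  · exact sub_eq_zero.1 h2
  · exfalso
    have h3 := norm_dominantValue_sub_one_le he hs
    rw [dominantValue, ← hφ, h2] at h3
    norm_num at h3
    linarith

theorem dominantVector_eq :
    dominantValue e s • dominantVector e s = e + s (dominantVector e s) := by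
  have h := (dominantVector_spec he hs).2
  rw [eigenvectorMap, sub_eq_iff_eq_add] at h
  rw [h, dominantValue, add_smul, one_smul]

theorem norm_dominantVector_sub_le : ‖dominantVector e s - e‖ ≤ 6 * ‖s‖ := by
  have h2 := norm_dominantVector_le_two he hs
  have h := norm_eigenvectorMap_sub_le he s 0 h2 h2
  rw [(dominantVector_spec he hs).2] at h
  simpa [eigenvectorMap] using h

theorem one_le_norm_dominantVector : 1 ≤ ‖dominantVector e s‖ := by
  have h := norm_inner_le_norm (𝕜 := ℂ) e (dominantVector e s)
  rw [inner_dominantVector he hs, he] at h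
  simpa using h

theorem norm_dominantVector_sub_dominantVector_le {s' : E →L[ℂ] E} (hs' : ‖s'‖ ≤ 1 / 16) :
    ‖dominantVector e s - dominantVector e s'‖ ≤ 12 * ‖s - s'‖ := by
  have h := norm_eigenvectorMap_sub_le he s s' (norm_dominantVector_le_two he hs)
    (norm_dominantVector_le_two he hs')
  rw [(dominantVector_spec he hs).2, (dominantVector_spec he hs').2] at h
  have : 5 * ‖s‖ * ‖dominantVector e s - dominantVector e s'‖ ≤
    1 / 2 * ‖dominantVector e s - dominantVector e s'‖ := by gcongr; linarith
  linarith

/-- An eigenvalue of `e ⊗ e + s` which is not small is the dominant one, and it is simple. -/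
theorem eq_dominant_of_eigenvector {μ : ℂ} (hμ : 1 / 2 ≤ ‖μ‖) {ψ : E} (hψ : ψ ≠ 0)
    (h : μ • ψ = inner ℂ e ψ • e + s ψ) :
    μ = dominantValue e s ∧ ψ = inner ℂ e ψ • dominantVector e s := by
  -- A vector orthogonal to `e` would be an eigenvector of `s`, whose norm is below `‖μ‖`.
  have hc : inner ℂ e ψ ≠ 0 := by
    intro h0
    rw [h0, zero_smul, zero_add] at h
    have h1 : ‖μ‖ * ‖ψ‖ ≤ ‖s‖ * ‖ψ‖ := by
      rw [← norm_smul, h]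
      exact s.le_opNorm ψ
    have := le_of_mul_le_mul_right h1 (norm_pos_iff.2 hψ)
    linarith
  set χ : E := (inner ℂ e ψ)⁻¹ • ψ with hχ
  have hψχ : ψ = inner ℂ e ψ • χ := by rw [hχ, smul_smul, mul_inv_cancel₀ hc, one_smul]
  have heχ : inner ℂ e χ = 1 := by rw [hχ, inner_smul_right, inv_mul_cancel₀ hc]
  have hχe : μ • χ = e + s χ := by
    rw [hχ, smul_comm, h, smul_add, smul_smul, inv_mul_cancel₀ hc, one_smul, map_smul]
  have hμe : μ = 1 + inner ℂ e (s χ) := by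
    have := congrArg (fun x => inner ℂ e x) hχe
    simp only [inner_smul_right, inner_add_right, heχ, inner_self_eq_norm_sq_to_K, he] at this
    simpa using this
  -- From `‖χ‖ / 2 ≤ 1 + ‖χ‖ / 16`. This puts the normalised eigenvector into the unit ball about
  -- `e`, where the fixed point is unique.
  have hn : ‖χ‖ ≤ 16 / 7 := by
    have h1 : ‖μ‖ * ‖χ‖ ≤ 1 + ‖s‖ * ‖χ‖ := by
      rw [← norm_smul, hχe]
      exact (norm_add_le _ _).trans (by rw [he]; gcongr; exact s.le_opNorm χ)
    nlinarith [norm_nonneg χ]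
  have hfix : eigenvectorMap e s χ = χ := by
    rw [eigenvectorMap, ← hχe, hμe, add_smul, one_smul, add_sub_cancel_right]
  have hball : ‖χ - e‖ ≤ 1 := by
    have e1 : χ - e = s χ - inner ℂ e (s χ) • χ := by
      conv_lhs => rw [← hfix]
      rw [eigenvectorMap]
      abel
    rw [e1]
    refine (norm_sub_le _ _).trans ?_
    rw [norm_smul]
    have h1 : ‖s χ‖ ≤ 1 / 16 * (16 / 7) := (s.le_opNorm χ).trans (by gcongr)
    have h2 : ‖inner ℂ e (s χ)‖ ≤ 1 / 16 * (16 / 7) :=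
      (norm_inner_apply_le he s χ).trans (by gcongr)
    nlinarith [norm_nonneg χ, norm_nonneg (inner ℂ e (s χ))]
  have hχd : χ = dominantVector e s := by
    have h1 := norm_eigenvectorMap_sub_le he s s (norm_le_two_of_norm_sub_le he hball)
      (norm_dominantVector_le_two he hs)
    rw [hfix, (dominantVector_spec he hs).2] at h1
    simp only [sub_self, norm_zero, mul_zero, add_zero] at h1
    rw [← sub_eq_zero, ← norm_le_zero_iff]
    nlinarith [norm_nonneg (χ - dominantVector e s)]
  exact ⟨by rw [dominantValue, ← hχd, hμe], by rw [← hχd, ← hψχ]⟩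

end DominantVector

/-! ### Determinants near the leading-order matrix -/

section Determinants

variable {N : ℕ}

/-- Uniform continuity of the determinant on a compact set of matrices. The modulus depends only on
`N`, `M` and `e`, which keeps the later smallness conditions independent of the particles. -/
theorem exists_det_sub_det_le (N : ℕ) (M : ℝ) {e : ℝ} (he : 0 < e) :
    ∃ η > 0, ∀ X Y : Matrix (Fin N) (Fin N) ℂ, (∀ i j, ‖X i j‖ ≤ M) → (∀ i j, ‖Y i j‖ ≤ M) →
      (∀ i j, ‖X i j - Y i j‖ ≤ η) → ‖X.det - Y.det‖ ≤ e := by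
  rcases lt_or_ge M 0 with hM | hM
  · refine ⟨1, one_pos, fun X Y hX _ _ => ?_⟩
    rcases isEmpty_or_nonempty (Fin N) with hN | ⟨⟨i⟩⟩
    · simp [he.le]
    · exact absurd ((norm_nonneg _).trans (hX i i)) (not_le.2 hM)
  have hc : ContinuousOn (fun X : Fin N → Fin N → ℂ => (Matrix.of X).det)
      (Metric.closedBall 0 M) := by
    apply Continuous.continuousOn
    exact Continuous.matrix_det continuous_id
  have hu := (isCompact_closedBall (0 : Fin N → Fin N → ℂ) M).uniformContinuousOn_of_continuous hc
  rw [Metric.uniformContinuousOn_iff_le] at hu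
  obtain ⟨η, hη, h⟩ := hu e he
  refine ⟨η, hη, fun X Y hX hY hXY => ?_⟩
  have hmem : ∀ X : Matrix (Fin N) (Fin N) ℂ, (∀ i j, ‖X i j‖ ≤ M) →
      (fun i j => X i j) ∈ Metric.closedBall (0 : Fin N → Fin N → ℂ) M := by
    intro X hX
    rw [mem_closedBall_zero_iff, pi_norm_le_iff_of_nonneg hM]
    intro i
    rw [pi_norm_le_iff_of_nonneg hM]
    exact hX i
  have := h _ (hmem X hX) _ (hmem Y hY) (by
    rw [dist_pi_le_iff hη.le]
    intro i
    rw [dist_pi_le_iff hη.le]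
    intro j
    rw [dist_eq_norm]
    exact hXY i j)
  rwa [dist_eq_norm] at this

/-- The leading-order interaction matrix. -/
def leadingMatrix (a : Fin N → ℝ) : Matrix (Fin N) (Fin N) ℂ :=
  Matrix.of fun i j => (((if i = j then 2 else 1) * (a i * a j) : ℝ) : ℂ)

theorem leadingMatrix_isHermitian (a : Fin N → ℝ) : (leadingMatrix a).IsHermitian := by
  ext i j
  simp only [leadingMatrix, Matrix.conjTranspose_apply, Matrix.of_apply, RCLike.star_def,
    Complex.conj_ofReal, eq_comm (a := j), mul_comm (a j)]

theorem norm_leadingMatrix_le {a : Fin N → ℝ} {a₁ : ℝ} (h0 : ∀ i, 0 ≤ a i) (h1 : ∀ i, a i ≤ a₁)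
    (i j : Fin N) : ‖leadingMatrix a i j‖ ≤ 2 * a₁ ^ 2 := by
  have ha := (h0 i).trans (h1 i)
  have hi := h0 i
  have hj := h0 j
  simp only [leadingMatrix, Matrix.of_apply, Complex.norm_real, Real.norm_eq_abs]
  rw [abs_of_nonneg (by split_ifs <;> positivity), sq]
  gcongr
  · split_ifs <;> norm_num
  · exact h1 i
  · exact h1 j

theorem exists_det_eq_prod (a : Fin N → ℝ) :
    ∃ l : Fin N → ℂ, ∀ z : ℂ, (z • (1 : Matrix (Fin N) (Fin N) ℂ) - leadingMatrix a).det =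
      ∏ j, (z - l j) := by
  refine ⟨fun j => ((leadingMatrix_isHermitian a).eigenvalues j : ℂ), fun z => ?_⟩
  have h := congrArg (Polynomial.eval z) (leadingMatrix_isHermitian a).charpoly_eq
  rw [Matrix.eval_charpoly, Polynomial.eval_prod] at h
  simpa [Matrix.smul_one_eq_diagonal] using h

/-- A root is an eigenvalue, hence at most the operator norm for the supremum norm. -/
theorem norm_le_of_det_eq_zero {B : Matrix (Fin N) (Fin N) ℂ} {M : ℝ} (hB : ∀ i j, ‖B i j‖ ≤ M)
    {z : ℂ} (h : (z • (1 : Matrix (Fin N) (Fin N) ℂ) - B).det = 0) : ‖z‖ ≤ N * M := by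
  obtain ⟨v, hv, hz⟩ := Matrix.exists_mulVec_eq_zero_iff.2 h
  have hv' : 0 < ‖v‖ := norm_pos_iff.2 hv
  obtain ⟨i0, -⟩ := Function.ne_iff.1 hv
  have hM : 0 ≤ M := (norm_nonneg _).trans (hB i0 i0)
  have e1 : z • v = B.mulVec v := by
    rw [Matrix.sub_mulVec, Matrix.smul_mulVec, Matrix.one_mulVec, sub_eq_zero] at hz
    exact hz
  have h1 : ‖B.mulVec v‖ ≤ N * M * ‖v‖ := by
    rw [pi_norm_le_iff_of_nonneg (by positivity)]
    intro i
    simp only [Matrix.mulVec, dotProduct]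
    calc _ ≤ ∑ j, ‖B i j * v j‖ := norm_sum_le _ _
      _ ≤ ∑ _j : Fin N, M * ‖v‖ := by
        gcongr with j
        rw [norm_mul]
        gcongr
        · exact hB i j
        · exact norm_le_pi_norm v j
      _ = _ := by simp; ring
  rw [← e1, norm_smul] at h1
  exact le_of_mul_le_mul_right h1 hv'

/-- Stability of the zeros of `det (z - leadingMatrix a)` under continuous perturbation. -/
theorem exists_det_eq_zero_of_near (N : ℕ) {a₁ β ε : ℝ} (hβ : 0 < β) (hε : 0 < ε)
    (hε1 : ε ≤ 1) :
    ∃ η > 0, η ≤ 1 ∧ ∀ (a : Fin N → ℝ), (∀ i, 0 ≤ a i) → (∀ i, a i ≤ a₁) →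
      ∀ (z₀ b : ℂ) (z : ℂ → ℂ) (B₀ : Matrix (Fin N) (Fin N) ℂ)
        (B : ℂ → Matrix (Fin N) (Fin N) ℂ),
      β ≤ ‖b‖ → ‖b‖ ≤ 2 * ‖z₀‖ →
      ContinuousOn z (Metric.closedBall 0 ε) → ContinuousOn B (Metric.closedBall 0 ε) →
      (∀ t ∈ Metric.closedBall (0 : ℂ) ε, ‖z t - (z₀ + b * t)‖ ≤ ‖b‖ * ε / (16 * (N + 1))) →
      (∀ t ∈ Metric.closedBall (0 : ℂ) ε, ∀ i j, ‖B t i j - leadingMatrix a i j‖ ≤ η) →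
      (∀ i j, ‖B₀ i j - leadingMatrix a i j‖ ≤ η) →
      (z₀ • (1 : Matrix (Fin N) (Fin N) ℂ) - B₀).det = 0 →
      ∃ t ∈ Metric.closedBall (0 : ℂ) ε, (z t • (1 : Matrix (Fin N) (Fin N) ℂ) - B t).det = 0 := by
  set Q : ℝ := 2 * a₁ ^ 2 + 1 with hQ
  have hQ0 : 0 < Q := by positivity
  -- Entry bound for `w - B` with `‖w‖ ≤ 4 N Q`. Here `‖z₀‖ ≤ N Q` because `z₀` is an eigenvalue of
  -- `B₀`, and `‖b‖ ≤ 2 ‖z₀‖` gives `‖z t‖ ≤ 4 ‖z₀‖` on the disc.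
  set M : ℝ := 4 * (N * Q) + Q with hM
  have hm : 0 < β * ε / (16 * (N + 1)) := by positivity
  obtain ⟨η, hη, hdet⟩ := exists_det_sub_det_le N M
    (e := (β * ε / (16 * (N + 1))) ^ N / 2) (by positivity)
  refine ⟨min η 1, by positivity, min_le_right _ _, ?_⟩
  intro a ha0 ha1 z₀ b z B₀ B hb hb2 hz hB hzt hBt hB₀ h0
  have hQB : ∀ X : Matrix (Fin N) (Fin N) ℂ, (∀ i j, ‖X i j - leadingMatrix a i j‖ ≤ min η 1) →
      ∀ i j, ‖X i j‖ ≤ Q := by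
    intro X hX i j
    have h1 := norm_leadingMatrix_le ha0 ha1 i j
    have h2 := (hX i j).trans (min_le_right _ _)
    have h3 := norm_add_le (X i j - leadingMatrix a i j) (leadingMatrix a i j)
    rw [sub_add_cancel] at h3
    rw [hQ]
    linarith
  have hA : ∀ i j, ‖leadingMatrix a i j‖ ≤ Q := hQB _ (by simp [hη.le])
  have hz0 := norm_le_of_det_eq_zero (hQB _ hB₀) h0
  have hclose : ∀ (w : ℂ) (X : Matrix (Fin N) (Fin N) ℂ), ‖w‖ ≤ 4 * (N * Q) →
      (∀ i j, ‖X i j - leadingMatrix a i j‖ ≤ min η 1) →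
      ‖(w • (1 : Matrix (Fin N) (Fin N) ℂ) - X).det -
        (w • (1 : Matrix (Fin N) (Fin N) ℂ) - leadingMatrix a).det‖ ≤
        (β * ε / (16 * (N + 1))) ^ N / 2 := by
    intro w X hw hX
    have hs : ∀ Y : Matrix (Fin N) (Fin N) ℂ, (∀ i j, ‖Y i j‖ ≤ Q) → ∀ i j,
        ‖(w • (1 : Matrix (Fin N) (Fin N) ℂ) - Y) i j‖ ≤ M := by
      intro Y hY i j
      rw [Matrix.sub_apply, Matrix.smul_apply, Matrix.one_apply]
      refine (norm_sub_le _ _).trans ?_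
      have : ‖w • (if i = j then (1 : ℂ) else 0)‖ ≤ 4 * (N * Q) := by
        split_ifs
        · simpa using hw
        · simpa using (by positivity : 0 ≤ 4 * (N * Q))
      have := hY i j
      linarith
    refine hdet _ _ (hs _ (hQB _ hX)) (hs _ hA) fun i j => ?_
    rw [Matrix.sub_apply, Matrix.sub_apply, sub_sub_sub_cancel_left, norm_sub_rev]
    exact (hX i j).trans (min_le_left _ _)
  obtain ⟨l, hl⟩ := exists_det_eq_prod a
  have hpow : (β * ε / (16 * (N + 1))) ^ N ≤ (‖b‖ * ε / (16 * (N + 1))) ^ N := by gcongr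
  refine exists_zero_of_near_prod (η := (β * ε / (16 * (N + 1))) ^ N / 2) (l := l) hε
    (norm_pos_iff.1 (hβ.trans_le hb)) hz ?_ hzt ?_ ?_ ?_
  · have hc : ContinuousOn (fun t => z t • (1 : Matrix (Fin N) (Fin N) ℂ) - B t)
        (Metric.closedBall 0 ε) := (hz.smul continuousOn_const).sub hB
    exact (Continuous.matrix_det continuous_id).comp_continuousOn hc
  -- The determinant at `z₀` with the leading matrix is tiny, being close to the vanishing one with
  -- `B₀`; if all eigenvalues `l j` were far from `z₀`, the product of the distances would be too
  -- large.
  · by_contra! hcon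
    have h1 := hclose z₀ B₀ (by nlinarith [norm_nonneg z₀]) hB₀
    rw [h0, hl, zero_sub, norm_neg, norm_prod] at h1
    have h2 : (‖b‖ * ε / 4) ^ N ≤ ∏ j, ‖z₀ - l j‖ := by
      calc _ = ∏ _j : Fin N, (‖b‖ * ε / 4) := by
            rw [Finset.prod_const, Finset.card_univ, Fintype.card_fin]
        _ ≤ _ := Finset.prod_le_prod (fun _ _ => by positivity) fun j _ => by
          rw [norm_sub_rev]; exact (hcon j).le
    have h3 : (‖b‖ * ε / (16 * (N + 1))) ^ N ≤ (‖b‖ * ε / 4) ^ N := by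
      have : (0 : ℝ) ≤ N := Nat.cast_nonneg N
      gcongr
      linarith
    have h4 : 0 < (β * ε / (16 * (N + 1))) ^ N := by positivity
    linarith
  · have h4 : 0 < (β * ε / (16 * (N + 1))) ^ N := by positivity
    linarith
  · intro t ht
    rw [← hl]
    refine hclose _ _ ?_ (hBt t ht)
    have h1 := hzt t ht
    have h2 : ‖b * t‖ ≤ ‖b‖ * 1 := by
      rw [norm_mul]
      gcongr
      exact (mem_closedBall_zero_iff.1 ht).trans hε1
    have h3 : ‖b‖ * ε / (16 * (N + 1)) ≤ ‖b‖ * 1 / 16 := by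
      have : (0 : ℝ) ≤ N := Nat.cast_nonneg N
      gcongr
      linarith
    have h4 : ‖z t‖ ≤ ‖z t - (z₀ + b * t)‖ + (‖z₀‖ + ‖b * t‖) := by
      have h5 := norm_add_le (z t - (z₀ + b * t)) (z₀ + b * t)
      rw [sub_add_cancel] at h5
      have := norm_add_le z₀ (b * t)
      linarith
    nlinarith [norm_nonneg z₀]

/-- The eigenvalues of matrices close to the leading-order one are bounded below. -/
theorem norm_ge_of_det_eq_zero {a : Fin N → ℝ} {a₀ η : ℝ} (h0 : 0 ≤ a₀) (ha : ∀ i, a₀ ≤ a i)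
    {B : Matrix (Fin N) (Fin N) ℂ} (hB : ∀ i j, ‖B i j - leadingMatrix a i j‖ ≤ η)
    (hη : N * η ≤ a₀ ^ 2 / 2)
    {z : ℂ} (h : (z • (1 : Matrix (Fin N) (Fin N) ℂ) - B).det = 0) : a₀ ^ 2 / 2 ≤ ‖z‖ := by
  obtain ⟨v, hv, hz⟩ := Matrix.exists_mulVec_eq_zero_iff.2 h
  have e1 : z • v = B.mulVec v := by
    rw [Matrix.sub_mulVec, Matrix.smul_mulVec, Matrix.one_mulVec, sub_eq_zero] at hz
    exact hz
  obtain ⟨i0, hi0⟩ := Function.ne_iff.1 hv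
  set q : ℝ := ∑ i, ‖v i‖ ^ 2 with hq
  have hq0 : 0 < q := Finset.sum_pos' (fun i _ => by positivity)
    ⟨i0, by simp, by have := norm_pos_iff.2 hi0; positivity⟩
  set G : ℂ := ∑ i, starRingEnd ℂ (v i) * ∑ j, (B i j - leadingMatrix a i j) * v j with hG
  have hGq : ‖G‖ ≤ N * η * q := by
    have hη0 : 0 ≤ η := (norm_nonneg _).trans (hB i0 i0)
    have h1 : ‖G‖ ≤ ∑ i, ‖v i‖ * ∑ j, η * ‖v j‖ := by
      refine (norm_sum_le _ _).trans (Finset.sum_le_sum fun i _ => ?_)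
      rw [norm_mul, RCLike.norm_conj]
      gcongr
      refine (norm_sum_le _ _).trans (Finset.sum_le_sum fun j _ => ?_)
      rw [norm_mul]
      gcongr
      exact hB i j
    have h2 : ∑ i, ‖v i‖ * ∑ j, η * ‖v j‖ = η * (∑ i, ‖v i‖) ^ 2 := by
      rw [← Finset.sum_mul, ← Finset.mul_sum]
      ring
    have h3 : (∑ i, ‖v i‖) ^ 2 ≤ N * q := by
      have := sq_sum_le_card_mul_sum_sq (s := Finset.univ) (f := fun i => ‖v i‖)
      simpa using this
    rw [h2] at h1
    nlinarith
  -- The quadratic form of `diag(a_i²) + a aᵀ` is `∑ a_i² |v_i|² + |∑ a_i v_i|²`, so it is at least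
  -- `a₀² q`; the perturbation costs at most `N η q`.
  have hmain : z * q = (∑ i, (a i : ℂ) ^ 2 * (‖v i‖ : ℂ) ^ 2) +
      ((‖∑ i, (a i : ℂ) * v i‖ ^ 2 : ℝ) : ℂ) + G := by
    have h1 : z * q = ∑ i, starRingEnd ℂ (v i) * (z • v) i := by
      rw [hq]
      push_cast
      rw [Finset.mul_sum]
      refine Finset.sum_congr rfl fun i _ => ?_
      rw [← Complex.conj_mul', Pi.smul_apply, smul_eq_mul]
      ring
    have h2 : ((‖∑ i, (a i : ℂ) * v i‖ ^ 2 : ℝ) : ℂ) =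
        ∑ i, starRingEnd ℂ (v i) * ∑ j, (a i * a j : ℂ) * v j := by
      push_cast
      rw [← Complex.conj_mul', map_sum, Finset.sum_mul]
      refine Finset.sum_congr rfl fun i _ => ?_
      rw [map_mul, Complex.conj_ofReal, Finset.mul_sum, Finset.mul_sum]
      refine Finset.sum_congr rfl fun j _ => ?_
      ring
    rw [h1, e1, h2, hG, ← Finset.sum_add_distrib, ← Finset.sum_add_distrib]
    refine Finset.sum_congr rfl fun i _ => ?_
    have h3 : (a i : ℂ) ^ 2 * (‖v i‖ : ℂ) ^ 2 =
        starRingEnd ℂ (v i) * ∑ j, (if i = j then (a i * a j : ℂ) else 0) * v j := by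
      rw [← Complex.conj_mul']
      simp
      ring
    rw [h3, ← mul_add, ← mul_add, ← Finset.sum_add_distrib, ← Finset.sum_add_distrib]
    congr 1
    simp only [Matrix.mulVec, dotProduct]
    refine Finset.sum_congr rfl fun j _ => ?_
    simp only [leadingMatrix, Matrix.of_apply]
    split_ifs <;> push_cast <;> ring
  have hre : a₀ ^ 2 * q ≤ ((∑ i, (a i : ℂ) ^ 2 * (‖v i‖ : ℂ) ^ 2) +
      ((‖∑ i, (a i : ℂ) * v i‖ ^ 2 : ℝ) : ℂ)).re := by
    have h1 : (∑ i, (a i : ℂ) ^ 2 * (‖v i‖ : ℂ) ^ 2) = ((∑ i, a i ^ 2 * ‖v i‖ ^ 2 : ℝ) : ℂ) := by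
      push_cast; rfl
    rw [h1, Complex.add_re, Complex.ofReal_re, Complex.ofReal_re, hq, Finset.mul_sum]
    have h2 : ∑ i, a₀ ^ 2 * ‖v i‖ ^ 2 ≤ ∑ i, a i ^ 2 * ‖v i‖ ^ 2 := by
      gcongr with i
      exact ha i
    have : 0 ≤ ‖∑ i, (a i : ℂ) * v i‖ ^ 2 := by positivity
    linarith
  have hle : a₀ ^ 2 * q ≤ ‖z‖ * q + N * η * q := by
    have h1 : (∑ i, (a i : ℂ) ^ 2 * (‖v i‖ : ℂ) ^ 2) +
      ((‖∑ i, (a i : ℂ) * v i‖ ^ 2 : ℝ) : ℂ) = z * q - G := by rw [hmain]; ring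
    rw [h1] at hre
    refine hre.trans ((Complex.re_le_norm _).trans ((norm_sub_le _ _).trans ?_))
    rw [norm_mul, Complex.norm_real, Real.norm_of_nonneg hq0.le]
    gcongr
  have : (a₀ ^ 2) * q ≤ (‖z‖ + N * η) * q := by linarith
  have := le_of_mul_le_mul_right this hq0
  linarith

end Determinants

/-! ### Block operators: diagonal eigenpairs and the interaction matrix -/

section Blocks

variable {N : ℕ} {H : Fin N → Type*} [∀ i, NormedAddCommGroup (H i)]
  [∀ i, InnerProductSpace ℂ (H i)]

/-- The block operators `A_ij e_i ⊗ e_j + S_ij`, with `A` the leading-order matrix. -/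
noncomputable def blockMap (e : ∀ i, H i) (a : Fin N → ℝ) (S : ∀ i j, H j →L[ℂ] H i)
    (i j : Fin N) (u : H j) : H i :=
  (leadingMatrix a i j * inner ℂ (e j) u) • e i + S i j u

/-- The remainder of the `i`-th diagonal block, scaled so that the leading part is `e_i ⊗ e_i`. -/
noncomputable def scaledRemainder (a : Fin N → ℝ) (S : ∀ i j, H j →L[ℂ] H i) (i : Fin N) :
    H i →L[ℂ] H i :=
  (((2 * a i ^ 2)⁻¹ : ℝ) : ℂ) • S i i

/-- The normalised dominant eigenvector of the `i`-th diagonal block. -/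
noncomputable def unitVector (e : ∀ i, H i) (a : Fin N → ℝ) (S : ∀ i j, H j →L[ℂ] H i)
    (i : Fin N) : H i :=
  (((‖dominantVector (e i) (scaledRemainder a S i)‖)⁻¹ : ℝ) : ℂ) •
    dominantVector (e i) (scaledRemainder a S i)

/-- The dominant eigenvalue of the `i`-th diagonal block. -/
noncomputable def blockValue (e : ∀ i, H i) (a : Fin N → ℝ) (S : ∀ i j, H j →L[ℂ] H i)
    (i : Fin N) : ℂ :=
  ((2 * a i ^ 2 : ℝ) : ℂ) * dominantValue (e i) (scaledRemainder a S i)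

/-- The matrix of the blocks in the dominant eigenvectors. -/
noncomputable def interactionMatrix (e : ∀ i, H i) (a : Fin N → ℝ) (S : ∀ i j, H j →L[ℂ] H i) :
    Matrix (Fin N) (Fin N) ℂ :=
  Matrix.of fun i j => if i = j then blockValue e a S i else
    inner ℂ (unitVector e a S i) (blockMap e a S i j (unitVector e a S j))

theorem leadingMatrix_self (a : Fin N → ℝ) (i : Fin N) :
    leadingMatrix a i i = ((2 * a i ^ 2 : ℝ) : ℂ) := by
  simp [leadingMatrix, sq]

theorem leadingMatrix_of_ne (a : Fin N → ℝ) {i j : Fin N} (h : i ≠ j) :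
    leadingMatrix a i j = ((a i * a j : ℝ) : ℂ) := by
  simp [leadingMatrix, h]

section Eigen

variable {e : ∀ i, H i} {a : Fin N → ℝ} {S : ∀ i j, H j →L[ℂ] H i} {a₀ a₁ η : ℝ}

theorem norm_scaledRemainder_le (ha₀ : 0 < a₀) (ha : ∀ i, a₀ ≤ a i) (hS : ∀ i j, ‖S i j‖ ≤ η)
    (i : Fin N) : ‖scaledRemainder a S i‖ ≤ (2 * a₀ ^ 2)⁻¹ * η := by
  have hi := ha₀.trans_le (ha i)
  rw [scaledRemainder, norm_smul, Complex.norm_real, Real.norm_of_nonneg (by positivity)]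
  have := ha i
  gcongr
  exact hS i i

variable [∀ i, CompleteSpace (H i)] (he : ∀ i, ‖e i‖ = 1) (ha : ∀ i, 0 < a i)
  (hs : ∀ i, ‖scaledRemainder a S i‖ ≤ 1 / 16)
include he ha hs

omit [∀ i, CompleteSpace (H i)] he hs in
theorem blockMap_self (i : Fin N) (u : H i) :
    blockMap e a S i i u = ((2 * a i ^ 2 : ℝ) : ℂ) •
      (inner ℂ (e i) u • e i + scaledRemainder a S i u) := by
  have : ((2 * a i ^ 2 : ℝ) : ℂ) ≠ 0 := by
    have := ha i
    exact_mod_cast (by positivity : (2 * a i ^ 2 : ℝ) ≠ 0)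
  rw [blockMap, leadingMatrix_self, smul_add, smul_smul, scaledRemainder, smul_apply, smul_smul,
    Complex.ofReal_inv, mul_inv_cancel₀ this, one_smul]

theorem blockMap_dominantVector (i : Fin N) :
    blockMap e a S i i (dominantVector (e i) (scaledRemainder a S i)) =
      blockValue e a S i • dominantVector (e i) (scaledRemainder a S i) := by
  rw [blockMap_self ha, inner_dominantVector (he i) (hs i), one_smul,
    ← dominantVector_eq (he i) (hs i), smul_smul, blockValue]

omit ha in
theorem norm_unitVector (i : Fin N) : ‖unitVector e a S i‖ = 1 := by
  have h := one_le_norm_dominantVector (he i) (hs i)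
  rw [unitVector, norm_smul, Complex.norm_real, Real.norm_of_nonneg (by positivity),
    inv_mul_cancel₀ (by positivity)]

theorem blockMap_unitVector (i : Fin N) :
    blockMap e a S i i (unitVector e a S i) = blockValue e a S i • unitVector e a S i := by
  have h : ∀ (c : ℂ) (u : H i), blockMap e a S i i (c • u) = c • blockMap e a S i i u := by
    intro c u
    simp only [blockMap, inner_smul_right, map_smul, smul_add, smul_smul]
    ring_nf
  rw [unitVector, h, blockMap_dominantVector he ha hs, smul_comm]

theorem norm_blockValue_sub_le (i : Fin N) (hS : ∀ i j, ‖S i j‖ ≤ η) :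
    ‖blockValue e a S i - leadingMatrix a i i‖ ≤ 2 * η := by
  have hi := ha i
  have h := norm_dominantValue_sub_one_le (he i) (hs i)
  rw [blockValue, leadingMatrix_self, ← mul_sub_one, norm_mul, Complex.norm_real,
    Real.norm_of_nonneg (by positivity)]
  have h2 : ‖scaledRemainder a S i‖ ≤ (2 * a i ^ 2)⁻¹ * η := by
    rw [scaledRemainder, norm_smul, Complex.norm_real, Real.norm_of_nonneg (by positivity)]
    gcongr
    exact hS i i
  calc _ ≤ 2 * a i ^ 2 * (2 * ((2 * a i ^ 2)⁻¹ * η)) := by gcongr; linarith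
    _ = 2 * η := by field_simp

/-- The leading value is `2 a_i²`, and the perturbation loses at most half of it. The same threshold
`a_i²` singles out the dominant eigenvalue in `eq_blockValue_of_eigenvector`. -/
theorem le_norm_blockValue (i : Fin N) : a i ^ 2 ≤ ‖blockValue e a S i‖ := by
  have hi := ha i
  have h := norm_dominantValue_sub_one_le (he i) (hs i)
  have h1 : 1 / 2 ≤ ‖dominantValue (e i) (scaledRemainder a S i)‖ := by
    have := norm_sub_norm_le (1 : ℂ) (dominantValue (e i) (scaledRemainder a S i))
    rw [norm_sub_rev, norm_one] at this
    linarith [hs i]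
  rw [blockValue, norm_mul, Complex.norm_real, Real.norm_of_nonneg (by positivity)]
  calc a i ^ 2 = 2 * a i ^ 2 * (1 / 2) := by ring
    _ ≤ _ := by gcongr

/-- Eigenvalues of a diagonal block which are not small are the dominant one. -/
theorem eq_blockValue_of_eigenvector {i : Fin N} {μ : ℂ} (hμ : a i ^ 2 ≤ ‖μ‖) {ψ : H i}
    (hψ : ψ ≠ 0) (h : blockMap e a S i i ψ = μ • ψ) :
    μ = blockValue e a S i ∧ ∃ c : ℂ, ψ = c • unitVector e a S i := by
  have hi := ha i
  have hq : ((2 * a i ^ 2 : ℝ) : ℂ) ≠ 0 := by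
    exact_mod_cast (by positivity : (2 * a i ^ 2 : ℝ) ≠ 0)
  rw [blockMap_self ha] at h
  obtain ⟨h1, h2⟩ := eq_dominant_of_eigenvector (he i) (hs i)
    (μ := ((2 * a i ^ 2 : ℝ) : ℂ)⁻¹ * μ) (by
      rw [norm_mul, norm_inv, Complex.norm_real, Real.norm_of_nonneg (by positivity),
        ← div_eq_inv_mul, le_div_iff₀ (by positivity)]
      linarith) hψ (by
      rw [mul_smul, ← h, smul_smul, inv_mul_cancel₀ hq, one_smul])
  refine ⟨by rw [blockValue, ← h1, mul_inv_cancel_left₀ hq],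
    inner ℂ (e i) ψ * ‖dominantVector (e i) (scaledRemainder a S i)‖, ?_⟩
  have hn : ((‖dominantVector (e i) (scaledRemainder a S i)‖ : ℝ) : ℂ) ≠ 0 := by
    have := one_le_norm_dominantVector (he i) (hs i)
    exact_mod_cast (by positivity)
  rw [unitVector, smul_smul, Complex.ofReal_inv, mul_assoc, mul_inv_cancel₀ hn, mul_one, ← h2]

/-- Since `⟪e_i, φ_i⟫ = 1`, an off-diagonal entry is `(A_ij + ⟪φ_i, S_ij φ_j⟫) / (‖φ_i‖ ‖φ_j‖)`. The
norms are at most `1 + 6 σ` with `σ ≤ 1/16`, which accounts for the `15`; the bound `2` on both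
norms accounts for the `4`. -/
theorem norm_interactionMatrix_sub_le (ha₀ : 0 < a₀) (ha0 : ∀ i, a₀ ≤ a i) (ha1 : ∀ i, a i ≤ a₁)
    (hS : ∀ i j, ‖S i j‖ ≤ η) (i j : Fin N) :
    ‖interactionMatrix e a S i j - leadingMatrix a i j‖ ≤ (15 * a₁ ^ 2 * (2 * a₀ ^ 2)⁻¹ + 4) * η := by
  have hη : 0 ≤ η := (norm_nonneg _).trans (hS i j)
  rw [interactionMatrix, Matrix.of_apply]
  split_ifs with hij
  · subst hij
    refine (norm_blockValue_sub_le he ha hs i hS).trans ?_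
    have : 0 ≤ 15 * a₁ ^ 2 * (2 * a₀ ^ 2)⁻¹ * η := by positivity
    linarith
  · set φi := dominantVector (e i) (scaledRemainder a S i) with hφi
    set φj := dominantVector (e j) (scaledRemainder a S j) with hφj
    have hi1 := one_le_norm_dominantVector (he i) (hs i)
    have hj1 := one_le_norm_dominantVector (he j) (hs j)
    have hi2 := norm_dominantVector_le_two (he i) (hs i)
    have hj2 := norm_dominantVector_le_two (he j) (hs j)
    have hi3 := norm_dominantVector_sub_le (he i) (hs i)
    have hj3 := norm_dominantVector_sub_le (he j) (hs j)
    have hi4 : inner ℂ φi (e i) = 1 := by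
      rw [← inner_conj_symm, inner_dominantVector (he i) (hs i), map_one]
    have hj4 : inner ℂ (e j) φj = 1 := inner_dominantVector (he j) (hs j)
    rw [← hφi] at hi1 hi2 hi3
    rw [← hφj] at hj1 hj2 hj3
    set σ := (2 * a₀ ^ 2)⁻¹ * η with hσ
    have hσi := norm_scaledRemainder_le ha₀ ha0 hS i
    have hσj := norm_scaledRemainder_le ha₀ ha0 hS j
    have hni : ‖φi‖ ≤ 1 + 6 * ‖scaledRemainder a S i‖ := by
      have := norm_add_le (φi - e i) (e i)
      rw [sub_add_cancel, he i] at this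
      linarith
    have hnj : ‖φj‖ ≤ 1 + 6 * ‖scaledRemainder a S j‖ := by
      have := norm_add_le (φj - e j) (e j)
      rw [sub_add_cancel, he j] at this
      linarith
    set P := ‖φi‖ * ‖φj‖ with hP
    have hP1 : 1 ≤ P := one_le_mul_of_one_le_of_one_le hi1 hj1
    have hP2 : P - 1 ≤ 15 * σ := by
      have h1 : P ≤ (1 + 6 * ‖scaledRemainder a S i‖) * (1 + 6 * ‖scaledRemainder a S j‖) := by
        rw [hP]; gcongr
      have h2 : ‖scaledRemainder a S i‖ * ‖scaledRemainder a S j‖ ≤ 1 / 16 * σ := by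
        gcongr
        exact hs i
      nlinarith
    have key : inner ℂ (unitVector e a S i) (blockMap e a S i j (unitVector e a S j)) -
        leadingMatrix a i j = ((P⁻¹ - 1 : ℝ) : ℂ) * leadingMatrix a i j +
          (P⁻¹ : ℝ) * inner ℂ φi (S i j φj) := by
      rw [unitVector, unitVector, blockMap, ← hφi, ← hφj]
      simp only [inner_smul_left, inner_add_right, inner_smul_right, hi4, hj4, map_smul,
        Complex.conj_ofReal]
      rw [hP]
      push_cast
      rw [mul_inv]
      ring
    rw [key]
    refine (norm_add_le _ _).trans ?_
    rw [norm_mul, norm_mul, Complex.norm_real, Complex.norm_real]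
    have hPi : P⁻¹ ≤ 1 := inv_le_one_of_one_le₀ hP1
    have h1 : ‖P⁻¹ - 1‖ ≤ 15 * σ := by
      rw [Real.norm_of_nonpos (by linarith)]
      have : P⁻¹ * P = 1 := inv_mul_cancel₀ (by positivity)
      have : 0 < P⁻¹ := by positivity
      nlinarith
    have h2 : ‖leadingMatrix a i j‖ ≤ a₁ ^ 2 := by
      have hi := ha i
      have hj := ha j
      rw [leadingMatrix_of_ne a hij, Complex.norm_real, Real.norm_of_nonneg (by positivity), sq]
      exact mul_le_mul (ha1 i) (ha1 j) hj.le (hi.le.trans (ha1 i))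
    have h3 : ‖inner ℂ φi (S i j φj)‖ ≤ 2 * (η * 2) := by
      refine (norm_inner_le_norm _ _).trans ?_
      gcongr
      exact ((S i j).le_opNorm _).trans (by gcongr; exact hS i j)
    rw [Real.norm_of_nonneg (by positivity : 0 ≤ P⁻¹)]
    calc _ ≤ 15 * σ * a₁ ^ 2 + 1 * (2 * (η * 2)) := by gcongr
      _ = _ := by rw [hσ]; ring

end Eigen

/-! ### Continuous dependence of the interaction matrix -/

section Continuity

variable {T : Type*} [TopologicalSpace T] {U : Set T} {e : ∀ i, H i} {a : Fin N → ℝ}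
  {S : T → ∀ i j, H j →L[ℂ] H i} [∀ i, CompleteSpace (H i)]

theorem continuousOn_dominantVector {E : Type*} [NormedAddCommGroup E] [InnerProductSpace ℂ E]
    [CompleteSpace E] {e : E} (he : ‖e‖ = 1) {s : T → E →L[ℂ] E} (hs : ∀ t ∈ U, ‖s t‖ ≤ 1 / 16)
    (hc : ContinuousOn s U) : ContinuousOn (fun t => dominantVector e (s t)) U := by
  intro t ht
  rw [ContinuousWithinAt, tendsto_iff_norm_sub_tendsto_zero]
  refine squeeze_zero' (Eventually.of_forall fun _ => norm_nonneg _)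
    (g := fun t' => 12 * ‖s t' - s t‖) ?_ ?_
  · filter_upwards [self_mem_nhdsWithin] with t' ht'
    exact norm_dominantVector_sub_dominantVector_le he (hs t' ht') (hs t ht)
  · have := (tendsto_iff_norm_sub_tendsto_zero.1 (hc t ht)).const_mul 12
    simpa using this

theorem continuousOn_interactionMatrix (he : ∀ i, ‖e i‖ = 1)
    (hs : ∀ t ∈ U, ∀ i, ‖scaledRemainder a (S t) i‖ ≤ 1 / 16)
    (hc : ∀ i j, ContinuousOn (fun t => S t i j) U) :
    ContinuousOn (fun t => interactionMatrix e a (S t)) U := by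
  have hsc : ∀ i, ContinuousOn (fun t => scaledRemainder a (S t) i) U := fun i =>
    (continuous_const_smul _).comp_continuousOn (hc i i)
  have hd : ∀ i, ContinuousOn (fun t => dominantVector (e i) (scaledRemainder a (S t) i)) U :=
    fun i => continuousOn_dominantVector (he i) (fun t ht => hs t ht i) (hsc i)
  have hu : ∀ i, ContinuousOn (fun t => unitVector e a (S t) i) U := by
    intro i
    refine ContinuousOn.smul ?_ (hd i)
    refine Complex.continuous_ofReal.comp_continuousOn ((hd i).norm.inv₀ fun t ht => ?_)
    exact (zero_lt_one.trans_le (one_le_norm_dominantVector (he i) (hs t ht i))).ne'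
  refine continuousOn_pi.2 fun i => continuousOn_pi.2 fun j => ?_
  simp only [interactionMatrix, Matrix.of_apply]
  split_ifs with hij
  · simp only [blockValue, dominantValue]
    exact continuousOn_const.mul (continuousOn_const.add
      (continuousOn_const.inner ((hsc i).clm_apply (hd i))))
  · refine (hu i).inner ?_
    simp only [blockMap]
    exact ((continuousOn_const.mul (continuousOn_const.inner (hu j))).smul
      continuousOn_const).add ((hc i j).clm_apply (hu j))

end Continuity

/-! ### Neumann series -/

section Inverse

variable {E : Type*} [NormedAddCommGroup E] [NormedSpace ℂ E] [CompleteSpace E]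

theorem isUnit_one_sub_of_norm_le {x : E →L[ℂ] E} (hx : ‖x‖ ≤ 1 / 2) : IsUnit (1 - x) :=
  (Units.oneSub x (by linarith)).isUnit

theorem norm_inverse_one_sub_sub_one_le {x : E →L[ℂ] E} (hx : ‖x‖ ≤ 1 / 2) :
    ‖Ring.inverse (1 - x) - 1‖ ≤ 2 * ‖x‖ := by
  set R := Ring.inverse (1 - x) with hR
  have h1 : (1 - x) * R = 1 := Ring.mul_inverse_cancel _ (isUnit_one_sub_of_norm_le hx)
  have h3 : R - x * R = 1 := by rw [← h1]; noncomm_ring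
  have h2 : R - 1 = x + x * (R - 1) := by
    rw [mul_sub, mul_one]
    nth_rewrite 1 [← h3]
    abel_nf
  have h4 : ‖R - 1‖ ≤ ‖x‖ + ‖x‖ * ‖R - 1‖ := by
    conv_lhs => rw [h2]
    exact (norm_add_le _ _).trans (by gcongr; exact norm_mul_le _ _)
  nlinarith [norm_nonneg (R - 1)]

theorem continuousOn_inverse_one_sub {T : Type*} [TopologicalSpace T] {U : Set T}
    {x : T → E →L[ℂ] E} (hc : ContinuousOn x U) (hx : ∀ t ∈ U, ‖x t‖ ≤ 1 / 2) :
    ContinuousOn (fun t => Ring.inverse (1 - x t)) U := by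
  intro t ht
  have h1 : ContinuousWithinAt (fun t => 1 - x t) U t := (continuousOn_const.sub hc) t ht
  obtain ⟨y, hy⟩ := isUnit_one_sub_of_norm_le (hx t ht)
  have h2 : ContinuousAt Ring.inverse ((fun t => 1 - x t) t) := by
    simp only [← hy]
    exact NormedRing.inverse_continuousAt y
  exact ContinuousAt.comp_continuousWithinAt (f := fun t => 1 - x t) h2 h1

omit [CompleteSpace E] in
theorem norm_inv_smul_le {x : E →L[ℂ] E} {z : ℂ} {ζ M : ℝ} (hζ : 0 < ζ) (hz : ζ ≤ ‖z‖)
    (hx : ‖x‖ ≤ M) : ‖z⁻¹ • x‖ ≤ M / ζ := by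
  have hM := (norm_nonneg _).trans hx
  rw [norm_smul, norm_inv, ← div_eq_inv_mul]
  gcongr

end Inverse

/-! ### Reduction of the block system to a finite matrix -/

section Feshbach

/-- The operator on the product space with blocks `S_ij`. -/
noncomputable def blockOperator (S : ∀ i j, H j →L[ℂ] H i) : (∀ i, H i) →L[ℂ] (∀ i, H i) :=
  ∑ i, ∑ j, ContinuousLinearMap.single ℂ H i ∘L S i j ∘L ContinuousLinearMap.proj j

theorem blockOperator_apply (S : ∀ i j, H j →L[ℂ] H i) (u : ∀ i, H i) (i : Fin N) :
    blockOperator S u i = ∑ j, S i j (u j) := by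
  simp only [blockOperator, sum_apply, Finset.sum_apply,
    ContinuousLinearMap.comp_apply, ContinuousLinearMap.proj_apply,
    ContinuousLinearMap.single_apply]
  rw [Finset.sum_eq_single i]
  · simp
  · intro k _ hk
    refine Finset.sum_eq_zero fun j _ => ?_
    simp [hk.symm]
  · simp

theorem norm_blockOperator_le {S : ∀ i j, H j →L[ℂ] H i} {η : ℝ} (hη : 0 ≤ η)
    (hS : ∀ i j, ‖S i j‖ ≤ η) : ‖blockOperator S‖ ≤ N * η := by
  refine ContinuousLinearMap.opNorm_le_bound _ (by positivity) fun u => ?_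
  rw [pi_norm_le_iff_of_nonneg (by positivity)]
  intro i
  rw [blockOperator_apply]
  calc _ ≤ ∑ j, ‖S i j (u j)‖ := norm_sum_le _ _
    _ ≤ ∑ _j : Fin N, η * ‖u‖ := by
      gcongr with j
      exact ((S i j).le_opNorm _).trans (by gcongr; exacts [hS i j, norm_le_pi_norm u j])
    _ = _ := by simp; ring

/-- The resolvent factor `(1 - S/z)⁻¹`. -/
noncomputable def resolventFactor (S : ∀ i j, H j →L[ℂ] H i) (z : ℂ) :
    (∀ i, H i) →L[ℂ] (∀ i, H i) :=
  Ring.inverse (1 - z⁻¹ • blockOperator S)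

/-- The finite matrix to which the block system is reduced by eliminating the complement of
the vectors `e_i`. -/
noncomputable def feshbachMatrix (e : ∀ i, H i) (a : Fin N → ℝ) (S : ∀ i j, H j →L[ℂ] H i)
    (z : ℂ) : Matrix (Fin N) (Fin N) ℂ :=
  (Matrix.of fun i l => inner ℂ (e i) (resolventFactor S z (Pi.single l (e l)) i)) *
    leadingMatrix a

variable {e : ∀ i, H i} {a : Fin N → ℝ} {S : ∀ i j, H j →L[ℂ] H i} {a₁ η : ℝ}
  [∀ i, CompleteSpace (H i)]

/-- The block system `z u_i = ∑_j (A_ij e_i ⊗ e_j + S_ij) u_j` reduces to a determinant. -/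
theorem exists_blockMap_eigenvector_iff (he : ∀ i, ‖e i‖ = 1) {z : ℂ} (hz0 : z ≠ 0)
    (hz : ‖z⁻¹ • blockOperator S‖ ≤ 1 / 2) :
    (∃ u : ∀ i, H i, u ≠ 0 ∧ ∀ i, z • u i = ∑ j, blockMap e a S i j (u j)) ↔
      (z • (1 : Matrix (Fin N) (Fin N) ℂ) - feshbachMatrix e a S z).det = 0 := by
  have hu := isUnit_one_sub_of_norm_le hz
  set R := resolventFactor S z with hR
  have hR1 : (1 - z⁻¹ • blockOperator S) * R = 1 := Ring.mul_inverse_cancel _ hu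
  have hR2 : R * (1 - z⁻¹ • blockOperator S) = 1 := Ring.inverse_mul_cancel _ hu
  have hee : ∀ i, inner ℂ (e i) (e i) = 1 := fun i => by simp [inner_self_eq_norm_sq_to_K, he i]
  -- the vector in the span of the `e_i` with coefficients `w`
  set J : (Fin N → ℂ) → ∀ i, H i := fun w => ∑ l, w l • Pi.single l (e l) with hJ
  have hJi : ∀ w i, J w i = w i • e i := by
    intro w i
    simp only [hJ, Finset.sum_apply, Pi.smul_apply]
    rw [Finset.sum_eq_single i]
    · simp
    · intro l _ hl
      simp [hl.symm]
    · simp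
  -- The rank one parts see `u` only through `c_j = ⟪e_j, u_j⟫`, and the system reads `(1 - S/z) u =
  -- z⁻¹ J (A c)`. Inverting and pairing with the `e_i` leaves `z c = W A c`; conversely `c`
  -- determines `u`, so `u ≠ 0` exactly when `c ≠ 0`.
  have hsys : ∀ u : ∀ i, H i, (∀ i, z • u i = ∑ j, blockMap e a S i j (u j)) ↔
      (1 - z⁻¹ • blockOperator S) u =
        z⁻¹ • J ((leadingMatrix a).mulVec fun j => inner ℂ (e j) (u j)) := by
    intro u
    rw [funext_iff]
    refine forall_congr' fun i => ?_
    have h1 : ∑ j, blockMap e a S i j (u j) =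
        J ((leadingMatrix a).mulVec fun j => inner ℂ (e j) (u j)) i + blockOperator S u i := by
      rw [hJi, blockOperator_apply, Matrix.mulVec, dotProduct, Finset.sum_smul,
        ← Finset.sum_add_distrib]
      rfl
    rw [h1, ← sub_eq_iff_eq_add, Pi.smul_apply, eq_inv_smul_iff₀ hz0]
    simp only [sub_apply, smul_apply, one_apply_eq_self, Pi.sub_apply,
      Pi.smul_apply, smul_sub, smul_smul, mul_inv_cancel₀ hz0, one_smul]
  have hW : ∀ w i, inner ℂ (e i) (R (J w) i) =
      ((Matrix.of fun i l => inner ℂ (e i) (R (Pi.single l (e l)) i)).mulVec w) i := by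
    intro w i
    simp only [hJ, map_sum, map_smul, Finset.sum_apply, Pi.smul_apply, inner_sum,
      inner_smul_right, Matrix.mulVec, dotProduct, Matrix.of_apply]
    exact Finset.sum_congr rfl fun l _ => mul_comm _ _
  constructor
  · rintro ⟨u, hu0, hus⟩
    rw [hsys] at hus
    have huR : u = z⁻¹ • R (J ((leadingMatrix a).mulVec fun j => inner ℂ (e j) (u j))) := by
      rw [← map_smul, ← hus, ← mul_apply_eq_comp, hR2]
      rfl
    refine Matrix.exists_mulVec_eq_zero_iff.1 ⟨fun j => inner ℂ (e j) (u j), ?_, ?_⟩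
    · intro h0
      rw [h0, Matrix.mulVec_zero] at huR
      apply hu0
      rw [huR]
      simp [hJ]
    · rw [Matrix.sub_mulVec, Matrix.smul_mulVec, Matrix.one_mulVec, sub_eq_zero]
      ext i
      rw [feshbachMatrix, ← Matrix.mulVec_mulVec, ← hW, Pi.smul_apply]
      conv_lhs => rw [huR]
      rw [Pi.smul_apply, inner_smul_right, smul_eq_mul, mul_inv_cancel_left₀ hz0]
  · intro h
    obtain ⟨v, hv, hvz⟩ := Matrix.exists_mulVec_eq_zero_iff.2 h
    rw [Matrix.sub_mulVec, Matrix.smul_mulVec, Matrix.one_mulVec, sub_eq_zero] at hvz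
    set u := z⁻¹ • R (J ((leadingMatrix a).mulVec v)) with hudef
    have hcoef : (fun j => inner ℂ (e j) (u j)) = v := by
      ext i
      rw [hudef, Pi.smul_apply, inner_smul_right, hW, Matrix.mulVec_mulVec]
      have := congrFun hvz i
      rw [feshbachMatrix, Pi.smul_apply, smul_eq_mul] at this
      rw [← this, inv_mul_cancel_left₀ hz0]
    refine ⟨u, ?_, ?_⟩
    · rintro h0
      apply hv
      rw [← hcoef, h0]
      ext i
      simp
    · rw [hsys, hcoef, hudef, map_smul, ← mul_apply_eq_comp, hR1]
      rfl

/-- The resolvent factor is within `2 N η / ζ` of the identity, hence so are the entries of its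
compression to the `e_i`. Multiplication by the leading matrix sums `N` terms with entries at most
`2 a₁²`. -/
theorem norm_feshbachMatrix_sub_le (he : ∀ i, ‖e i‖ = 1) (ha0 : ∀ i, 0 ≤ a i)
    (ha1 : ∀ i, a i ≤ a₁) (hS : ∀ i j, ‖S i j‖ ≤ η) {z : ℂ} {ζ : ℝ} (hζ : 0 < ζ) (hz : ζ ≤ ‖z‖)
    (hη : N * η ≤ ζ / 2) (i j : Fin N) :
    ‖feshbachMatrix e a S z i j - leadingMatrix a i j‖ ≤ 4 * N ^ 2 * a₁ ^ 2 / ζ * η := by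
  have hη0 : 0 ≤ η := (norm_nonneg _).trans (hS i j)
  have hz' : 0 < ‖z‖ := hζ.trans_le hz
  have hx : ‖z⁻¹ • blockOperator S‖ ≤ N * η / ζ := by
    exact norm_inv_smul_le hζ hz (norm_blockOperator_le hη0 hS)
  have hx2 : ‖z⁻¹ • blockOperator S‖ ≤ 1 / 2 := hx.trans (by rw [div_le_iff₀ hζ]; linarith)
  have hR := (norm_inverse_one_sub_sub_one_le hx2).trans (mul_le_mul_of_nonneg_left hx zero_le_two)
  have hW : ∀ l, ‖inner ℂ (e i) (resolventFactor S z (Pi.single l (e l)) i) -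
      (1 : Matrix (Fin N) (Fin N) ℂ) i l‖ ≤ 2 * (N * η / ζ) := by
    intro l
    have h1 : (1 : Matrix (Fin N) (Fin N) ℂ) i l =
        inner ℂ (e i) ((Pi.single l (e l) : ∀ i, H i) i) := by
      rw [Matrix.one_apply]
      split_ifs with h
      · subst h
        simp [inner_self_eq_norm_sq_to_K, he i]
      · simp [h]
    have h2 : ‖(resolventFactor S z - 1) (Pi.single l (e l))‖ ≤ 2 * (N * η / ζ) * 1 := by
      refine (ContinuousLinearMap.le_opNorm _ _).trans ?_
      rw [Pi.norm_single, he l]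
      gcongr
      exact hR
    rw [h1, ← inner_sub_right]
    refine (norm_inner_le_norm _ _).trans ?_
    rw [he i, one_mul]
    refine le_trans ?_ (h2.trans_eq (mul_one _))
    exact norm_le_pi_norm ((resolventFactor S z - 1) (Pi.single l (e l))) i
  have h3 : feshbachMatrix e a S z i j - leadingMatrix a i j =
      ∑ l, (inner ℂ (e i) (resolventFactor S z (Pi.single l (e l)) i) -
        (1 : Matrix (Fin N) (Fin N) ℂ) i l) * leadingMatrix a l j := by
    conv_lhs => rw [← Matrix.one_mul (leadingMatrix a), feshbachMatrix, ← Matrix.sub_apply,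
      Matrix.one_mul]
    nth_rewrite 2 [← Matrix.one_mul (leadingMatrix a)]
    rw [← Matrix.sub_mul, Matrix.mul_apply]
    rfl
  rw [h3]
  calc _ ≤ ∑ l, ‖_‖ := norm_sum_le _ _
    _ ≤ ∑ _l : Fin N, 2 * (N * η / ζ) * (2 * a₁ ^ 2) := by
      gcongr with l
      rw [norm_mul]
      gcongr
      · exact hW l
      · exact norm_leadingMatrix_le ha0 ha1 l j
    _ = _ := by
      rw [Finset.sum_const, Finset.card_univ, Fintype.card_fin, nsmul_eq_mul]
      ring

theorem continuousOn_feshbachMatrix {T : Type*} [TopologicalSpace T] {U : Set T}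
    {S : T → ∀ i j, H j →L[ℂ] H i} {z : T → ℂ} (hz : ContinuousOn z U) (hz0 : ∀ t ∈ U, z t ≠ 0)
    (hc : ∀ i j, ContinuousOn (fun t => S t i j) U)
    (hsm : ∀ t ∈ U, ‖(z t)⁻¹ • blockOperator (S t)‖ ≤ 1 / 2) :
    ContinuousOn (fun t => feshbachMatrix e a (S t) (z t)) U := by
  have hb : ContinuousOn (fun t => blockOperator (S t)) U := by
    unfold blockOperator
    refine continuousOn_finsetSum _ fun i _ => continuousOn_finsetSum _ fun j _ => ?_
    exact continuousOn_const.clm_comp ((hc i j).clm_comp continuousOn_const)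
  have hR : ContinuousOn (fun t => resolventFactor (S t) (z t)) U :=
    continuousOn_inverse_one_sub ((hz.inv₀ hz0).smul hb) hsm
  unfold feshbachMatrix
  refine (continuous_id.matrix_mul continuous_const).comp_continuousOn ?_
  refine continuousOn_pi.2 fun i => continuousOn_pi.2 fun l => ?_
  simp only [Matrix.of_apply]
  exact ContinuousOn.inner continuousOn_const
    ((continuous_apply i).comp_continuousOn (hR.clm_apply continuousOn_const))

end Feshbach

end Blocks

/-! ### Integral operators on `L²` with square integrable slices -/

section KernelOperators

variable {X : Type*} [MeasurableSpace X] {μ ν : Measure X}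

/-- The slices `k x` of the kernel are bounded by `m` in `L²(μ)`, for almost every `x`. -/
def SliceBound (k : X → X → ℂ) (μ ν : Measure X) (m : ℝ) : Prop :=
  ∀ᵐ x ∂ν, AEStronglyMeasurable (k x) μ ∧ eLpNorm (k x) 2 μ ≤ ENNReal.ofReal m

theorem integrable_mul_of_eLpNorm_le {f : X → ℂ} {m : ℝ} (hf : AEStronglyMeasurable f μ)
    (hm : eLpNorm f 2 μ ≤ ENNReal.ofReal m) {u : X → ℂ} (hu : MemLp u 2 μ) :
    Integrable (fun y => f y * u y) μ :=
  MemLp.integrable_mul ⟨hf, hm.trans_lt ENNReal.ofReal_lt_top⟩ hu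

theorem norm_integral_mul_le {f : X → ℂ} {m : ℝ} (hf : AEStronglyMeasurable f μ) (hm0 : 0 ≤ m)
    (hm : eLpNorm f 2 μ ≤ ENNReal.ofReal m) (u : Lp ℂ 2 μ) :
    ‖∫ y, f y * u y ∂μ‖ ≤ m * ‖u‖ := by
  have h1 : ‖∫ y, f y * u y ∂μ‖ₑ ≤ ENNReal.ofReal m * eLpNorm u 2 μ := by
    refine (enorm_integral_le_lintegral_enorm _).trans ?_
    rw [← eLpNorm_one_eq_lintegral_enorm]
    exact (eLpNorm_smul_le_mul_eLpNorm (p := 2) (q := 2) (r := 1)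
      (Lp.memLp u).1 hf).trans (by gcongr)
  have h2 := ENNReal.toReal_mono (ENNReal.mul_ne_top ENNReal.ofReal_ne_top (Lp.eLpNorm_ne_top u)) h1
  rwa [toReal_enorm, ENNReal.toReal_mul, ENNReal.toReal_ofReal hm0, ← Lp.norm_def] at h2

theorem norm_Lp_two_le_of_ae_bound [IsFiniteMeasure ν] {f : Lp ℂ 2 ν} {C : ℝ} (hC : 0 ≤ C)
    (h : ∀ᵐ x ∂ν, ‖f x‖ ≤ C) : ‖f‖ ≤ √(ν.real univ) * C := by
  refine (Lp.norm_le_of_ae_bound hC h).trans_eq ?_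
  rw [Real.sqrt_eq_rpow]
  congr 2
  norm_num

/-- `T` is the integral operator with kernel `k`. -/
def IsKernelOperator (k : X → X → ℂ) (T : Lp ℂ 2 μ →L[ℂ] Lp ℂ 2 ν) : Prop :=
  ∀ u : Lp ℂ 2 μ, T u =ᵐ[ν] fun x => ∫ y, k x y * u y ∂μ

/-- Cauchy–Schwarz in `y` bounds the image uniformly in `x`, and the `L²` norm of a bounded function
costs the square root of the mass. -/
theorem IsKernelOperator.norm_le [IsFiniteMeasure ν] {k : X → X → ℂ}
    {T : Lp ℂ 2 μ →L[ℂ] Lp ℂ 2 ν} (hT : IsKernelOperator k T) {m : ℝ} (hm0 : 0 ≤ m)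
    (hm : SliceBound k μ ν m) : ‖T‖ ≤ √(ν.real univ) * m := by
  refine ContinuousLinearMap.opNorm_le_bound _ (by positivity) fun u => ?_
  rw [mul_assoc]
  refine norm_Lp_two_le_of_ae_bound (by positivity) ?_
  filter_upwards [hT u, hm] with x hx hmx
  rw [hx]
  exact norm_integral_mul_le hmx.1 hm0 hmx.2 u

theorem exists_kernelOperator [IsFiniteMeasure μ] [IsFiniteMeasure ν] {k : X → X → ℂ}
    (hk : StronglyMeasurable (Function.uncurry k)) {m : ℝ} (hm0 : 0 ≤ m)
    (hm : SliceBound k μ ν m) : ∃ T : Lp ℂ 2 μ →L[ℂ] Lp ℂ 2 ν, IsKernelOperator k T := by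
  have hmeas : ∀ u : Lp ℂ 2 μ, AEStronglyMeasurable (fun x => ∫ y, k x y * u y ∂μ) ν := by
    intro u
    have h : StronglyMeasurable (Function.uncurry fun x y => k x y * u y) :=
      hk.mul ((Lp.stronglyMeasurable u).comp_measurable measurable_snd)
    exact h.integral_prod_right.aestronglyMeasurable
  have hmem : ∀ u : Lp ℂ 2 μ, MemLp (fun x => ∫ y, k x y * u y ∂μ) 2 ν := by
    intro u
    refine MemLp.of_bound (hmeas u) (m * ‖u‖) ?_
    filter_upwards [hm] with x hx
    exact norm_integral_mul_le hx.1 hm0 hx.2 u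
  let L : Lp ℂ 2 μ →ₗ[ℂ] Lp ℂ 2 ν :=
    { toFun := fun u => (hmem u).toLp _
      map_add' := by
        intro u v
        rw [← MemLp.toLp_add, MemLp.toLp_eq_toLp_iff]
        filter_upwards [hm] with x hx
        rw [Pi.add_apply, ← integral_add (integrable_mul_of_eLpNorm_le hx.1 hx.2 (Lp.memLp u))
          (integrable_mul_of_eLpNorm_le hx.1 hx.2 (Lp.memLp v))]
        refine integral_congr_ae ?_
        filter_upwards [Lp.coeFn_add u v] with y hy
        rw [hy, Pi.add_apply, mul_add]
      map_smul' := by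
        intro c u
        rw [RingHom.id_apply, ← MemLp.toLp_const_smul, MemLp.toLp_eq_toLp_iff]
        filter_upwards with x
        rw [Pi.smul_apply, ← integral_smul]
        refine integral_congr_ae ?_
        filter_upwards [Lp.coeFn_smul c u] with y hy
        rw [hy, Pi.smul_apply, smul_eq_mul, smul_eq_mul]
        ring }
  refine ⟨L.mkContinuous (√(ν.real univ) * m) fun u => ?_, fun u => ?_⟩
  · rw [mul_assoc]
    refine norm_Lp_two_le_of_ae_bound (by positivity) ?_
    filter_upwards [(hmem u).coeFn_toLp, hm] with x hx hmx
    change ‖((hmem u).toLp _ : X → ℂ) x‖ ≤ _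
    rw [hx]
    exact norm_integral_mul_le hmx.1 hm0 hmx.2 u
  · exact (hmem u).coeFn_toLp

/-- The normalised constant function in `L²(μ)`. -/
noncomputable def constVector (μ : Measure X) [IsFiniteMeasure μ] : Lp ℂ 2 μ :=
  Lp.const 2 μ (((√(μ.real univ))⁻¹ : ℝ) : ℂ)

theorem coeFn_constVector [IsFiniteMeasure μ] :
    constVector μ =ᵐ[μ] fun _ => (((√(μ.real univ))⁻¹ : ℝ) : ℂ) :=
  Lp.coeFn_const _ _ _

theorem norm_constVector [IsFiniteMeasure μ] (hμ : 0 < μ.real univ) : ‖constVector μ‖ = 1 := by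
  have hμ0 : μ ≠ 0 := by
    rintro rfl
    simp at hμ
  have h := Lp.norm_const' (p := 2) (μ := μ) (c := (((√(μ.real univ))⁻¹ : ℝ) : ℂ)) (by norm_num)
    (by norm_num)
  rw [constVector]
  refine h.trans ?_
  rw [Complex.norm_real,
    Real.norm_of_nonneg (by positivity), ENNReal.toReal_ofNat, ← Real.sqrt_eq_rpow]
  exact inv_mul_cancel₀ (by positivity)

theorem integral_eq_inner_constVector [IsFiniteMeasure μ] (hμ : 0 < μ.real univ) (u : Lp ℂ 2 μ) :
    ∫ y, u y ∂μ = (√(μ.real univ) : ℂ) * inner ℂ (constVector μ) u := by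
  have h1 : inner ℂ (constVector μ) u = (((√(μ.real univ))⁻¹ : ℝ) : ℂ) * ∫ y, u y ∂μ := by
    rw [L2.inner_def, ← integral_const_mul]
    refine integral_congr_ae ?_
    filter_upwards [coeFn_constVector (μ := μ)] with y hy
    rw [hy]
    simp [mul_comm]
  have h2 : (√(μ.real univ) : ℂ) ≠ 0 := by
    exact_mod_cast (Real.sqrt_pos.2 hμ).ne'
  rw [h1, Complex.ofReal_inv, mul_inv_cancel_left₀ h2]

/-- Subtracting a constant from the kernel subtracts a rank one operator. -/
theorem IsKernelOperator.sub_const [IsFiniteMeasure μ] [IsFiniteMeasure ν] (hμ : 0 < μ.real univ)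
    (hν : 0 < ν.real univ) {k : X → X → ℂ} {m : ℝ} (hm : SliceBound k μ ν m)
    {T S : Lp ℂ 2 μ →L[ℂ] Lp ℂ 2 ν} (hT : IsKernelOperator k T) (c : ℂ)
    (hS : ∀ u, S u = T u - (c * (√(ν.real univ) * √(μ.real univ)) *
      inner ℂ (constVector μ) u) • constVector ν) :
    IsKernelOperator (fun x y => k x y - c) S := by
  intro u
  rw [hS]
  have hint : Integrable u μ := (Lp.memLp u).integrable (by norm_num)
  filter_upwards [Lp.coeFn_sub (T u) ((c * (√(ν.real univ) * √(μ.real univ)) *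
      inner ℂ (constVector μ) u) • constVector ν), hT u, hm, Lp.coeFn_smul
      (c * (√(ν.real univ) * √(μ.real univ)) * inner ℂ (constVector μ) u) (constVector ν),
      coeFn_constVector (μ := ν)] with x h1 h2 h3 h4 h5
  rw [h1, Pi.sub_apply, h2, h4, Pi.smul_apply, h5]
  simp_rw [sub_mul]
  rw [integral_sub (integrable_mul_of_eLpNorm_le h3.1 h3.2 (Lp.memLp u)) (hint.const_mul c),
    integral_const_mul, integral_eq_inner_constVector hμ]
  have h6 : (√(ν.real univ) : ℂ) ≠ 0 := by
    exact_mod_cast (Real.sqrt_pos.2 hν).ne'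
  rw [smul_eq_mul, Complex.ofReal_inv]
  field_simp

theorem IsKernelOperator.sub {k k' : X → X → ℂ} {m m' : ℝ} (hm : SliceBound k μ ν m)
    (hm' : SliceBound k' μ ν m') {T T' : Lp ℂ 2 μ →L[ℂ] Lp ℂ 2 ν} (hT : IsKernelOperator k T)
    (hT' : IsKernelOperator k' T') : IsKernelOperator (fun x y => k x y - k' x y) (T - T') := by
  intro u
  filter_upwards [Lp.coeFn_sub (T u) (T' u), hT u, hT' u, hm, hm'] with x h1 h2 h3 h4 h5
  rw [sub_apply, h1, Pi.sub_apply, h2, h3]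
  simp_rw [sub_mul]
  rw [integral_sub (integrable_mul_of_eLpNorm_le h4.1 h4.2 (Lp.memLp u))
    (integrable_mul_of_eLpNorm_le h5.1 h5.2 (Lp.memLp u))]

theorem SliceBound.of_bound [IsFiniteMeasure μ] {k : X → X → ℂ}
    (hk : ∀ x, AEStronglyMeasurable (k x) μ) {C : ℝ}
    (h : ∀ᵐ x ∂ν, ∀ᵐ y ∂μ, ‖k x y‖ ≤ C) : SliceBound k μ ν (√(μ.real univ) * C) := by
  filter_upwards [h] with x hx
  refine ⟨hk x, (eLpNorm_le_of_ae_bound hx).trans_eq ?_⟩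
  rw [ENNReal.ofReal_mul (by positivity), Real.sqrt_eq_rpow,
    ← ENNReal.ofReal_rpow_of_nonneg (by positivity) (by positivity)]
  congr 2
  · rw [ofReal_measureReal]
  · norm_num

theorem SliceBound.add {k k' : X → X → ℂ} {m m' : ℝ} (h0 : 0 ≤ m) (h0' : 0 ≤ m')
    (hm : SliceBound k μ ν m) (hm' : SliceBound k' μ ν m') :
    SliceBound (fun x y => k x y + k' x y) μ ν (m + m') := by
  filter_upwards [hm, hm'] with x h1 h2
  refine ⟨h1.1.add h2.1, (eLpNorm_add_le h1.1 h2.1 (by norm_num)).trans ?_⟩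
  rw [ENNReal.ofReal_add h0 h0']
  exact add_le_add h1.2 h2.2

end KernelOperators

/-! ### Power series with factorially decaying coefficients -/

section PowerSeries

variable {a : ℕ → ℂ}

theorem summable_mul_pow_of_le_inv_factorial (ha : ∀ n, ‖a n‖ ≤ (n.factorial : ℝ)⁻¹) (w : ℂ) :
    Summable fun n => a n * w ^ n := by
  refine Summable.of_norm_bounded (Real.summable_pow_div_factorial ‖w‖) fun n => ?_
  rw [norm_mul, norm_pow, div_eq_inv_mul]
  gcongr
  exact ha n

theorem continuous_tsum_mul_pow (ha : ∀ n, ‖a n‖ ≤ (n.factorial : ℝ)⁻¹) :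
    Continuous fun w => ∑' n, a n * w ^ n := by
  rw [continuous_iff_continuousAt]
  intro w
  have h : ContinuousOn (fun w => ∑' n, a n * w ^ n) (Metric.ball 0 (‖w‖ + 1)) := by
    refine continuousOn_tsum (fun n => by fun_prop)
      (Real.summable_pow_div_factorial (‖w‖ + 1)) fun n x hx => ?_
    rw [norm_mul, norm_pow, div_eq_inv_mul]
    have := (mem_ball_zero_iff.1 hx).le
    gcongr
    exact ha n
  exact h.continuousAt (Metric.isOpen_ball.mem_nhds (by simp))

theorem norm_succ_le_inv_factorial (ha : ∀ n, ‖a n‖ ≤ (n.factorial : ℝ)⁻¹) (n : ℕ) :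
    ‖a (n + 1)‖ ≤ (n.factorial : ℝ)⁻¹ := by
  refine (ha (n + 1)).trans ?_
  gcongr
  omega

theorem tsum_mul_pow_eq (ha : ∀ n, ‖a n‖ ≤ (n.factorial : ℝ)⁻¹) (w : ℂ) :
    ∑' n, a n * w ^ n = a 0 + w * ∑' n, a (n + 1) * w ^ n := by
  rw [(summable_mul_pow_of_le_inv_factorial ha w).tsum_eq_zero_add, ← tsum_mul_left]
  simp only [pow_zero, mul_one]
  congr 2
  ext n
  ring

end PowerSeries

/-! ### Regular parts of the Bessel functions -/

section Bessel

/-- The coefficients of `J₀` as a series in `(z / 2) ^ 2`. -/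
noncomputable def besselJCoeff (n : ℕ) : ℂ := (-1) ^ n / ((n.factorial : ℂ) ^ 2)

/-- The coefficients of the regular part of `Y₀` as a series in `(z / 2) ^ 2`. -/
noncomputable def besselYCoeff (n : ℕ) : ℂ :=
  (-1) ^ n * ((harmonic (n + 1) : ℚ) : ℂ) / (((n + 1).factorial : ℂ) ^ 2)

theorem norm_besselJCoeff_le (n : ℕ) : ‖besselJCoeff n‖ ≤ (n.factorial : ℝ)⁻¹ := by
  have h : (1 : ℝ) ≤ n.factorial := by exact_mod_cast Nat.one_le_iff_ne_zero.2 n.factorial_ne_zero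
  rw [besselJCoeff, norm_div, norm_pow, norm_pow, norm_neg, norm_one, one_pow, Complex.norm_natCast,
    one_div]
  gcongr
  nlinarith

theorem harmonic_le_self (n : ℕ) : harmonic n ≤ n := by
  rw [harmonic]
  calc _ ≤ ∑ _i ∈ Finset.range n, (1 : ℚ) := by
        refine Finset.sum_le_sum fun i _ => inv_le_one_of_one_le₀ ?_
        exact_mod_cast Nat.succ_le_succ (Nat.zero_le i)
    _ = n := by simp

theorem norm_besselYCoeff_le (n : ℕ) : ‖besselYCoeff n‖ ≤ (n.factorial : ℝ)⁻¹ := by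
  have h : (1 : ℝ) ≤ n.factorial := by exact_mod_cast Nat.one_le_iff_ne_zero.2 n.factorial_ne_zero
  have hh : ‖((harmonic (n + 1) : ℚ) : ℂ)‖ ≤ n + 1 := by
    have h0 : (0 : ℚ) ≤ harmonic (n + 1) := (harmonic_pos (Nat.succ_ne_zero n)).le
    have h1 := harmonic_le_self (n + 1)
    have h2 : ((harmonic (n + 1) : ℚ) : ℂ) = (((harmonic (n + 1) : ℚ) : ℝ) : ℂ) := by push_cast; rfl
    rw [h2, Complex.norm_real, Real.norm_of_nonneg (by exact_mod_cast h0)]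
    exact_mod_cast h1
  rw [besselYCoeff, norm_div, norm_mul, norm_pow, norm_pow, norm_neg, norm_one, one_pow, one_mul,
    Complex.norm_natCast, Nat.factorial_succ]
  push_cast
  rw [div_le_iff₀ (by positivity)]
  refine hh.trans ?_
  have : ((n.factorial : ℝ))⁻¹ * (((n : ℝ) + 1) * n.factorial) ^ 2 =
      (n + 1) * ((n + 1) * n.factorial) := by field_simp
  rw [this]
  have hn : (0 : ℝ) ≤ n := Nat.cast_nonneg n
  exact le_mul_of_one_le_right (by positivity)
    (one_le_mul_of_one_le_of_one_le (by linarith) h)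

/-- `J₀(z) = 1 + (z / 2) ^ 2 besselJTail ((z / 2) ^ 2)`. -/
noncomputable def besselJTail (w : ℂ) : ℂ := ∑' n, besselJCoeff (n + 1) * w ^ n

/-- The regular part of `Y₀`, divided by `(z / 2) ^ 2`, as a function of `(z / 2) ^ 2`. -/
noncomputable def besselYTail (w : ℂ) : ℂ := ∑' n, besselYCoeff n * w ^ n

theorem continuous_besselJTail : Continuous besselJTail :=
  continuous_tsum_mul_pow (norm_succ_le_inv_factorial norm_besselJCoeff_le)

theorem continuous_besselYTail : Continuous besselYTail :=
  continuous_tsum_mul_pow norm_besselYCoeff_le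

theorem besselJ0_eq (z : ℂ) : besselJ0 z = 1 + (z / 2) ^ 2 * besselJTail ((z / 2) ^ 2) := by
  have h := tsum_mul_pow_eq norm_besselJCoeff_le ((z / 2) ^ 2)
  simp only [← pow_mul] at h
  rw [besselJTail, besselJ0]
  simp only [← pow_mul]
  refine Eq.trans ?_ (h.trans ?_)
  · rfl
  · simp [besselJCoeff]

theorem besselY0_eq (z : ℂ) : besselY0 z =
    2 / Real.pi * (Complex.log (z / 2) + Real.eulerMascheroniConstant) * besselJ0 z +
      2 / Real.pi * ((z / 2) ^ 2 * besselYTail ((z / 2) ^ 2)) := by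
  rw [besselY0, besselYTail, ← tsum_mul_left (a := (z / 2) ^ 2)]
  congr 3
  ext n
  rw [besselYCoeff]
  generalize z / 2 = w
  ring

/-- The imaginary part `-π/2` lies in the principal strip, so the principal logarithm is the
exponent itself; the factor `1/2` is real and positive. -/
theorem log_gammaHat : Complex.log gammaHat =
    Real.eulerMascheroniConstant - Complex.I * (Real.pi / 2) - Real.log 2 := by
  have h1 : gammaHat = Complex.exp (Real.eulerMascheroniConstant - Complex.I * (Real.pi / 2)) *
      (((2 : ℝ)⁻¹ : ℝ) : ℂ) := by
    rw [gammaHat]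
    push_cast
    ring
  have him : (Real.eulerMascheroniConstant - Complex.I * (Real.pi / 2) : ℂ).im = -(Real.pi / 2) := by
    have : (Complex.I * (Real.pi / 2) : ℂ) = ((Real.pi / 2 : ℝ) : ℂ) * Complex.I := by
      push_cast; ring
    rw [this]
    simp
  rw [h1, Complex.log_mul_ofReal _ (by norm_num) _ (Complex.exp_ne_zero _),
    Complex.log_exp (by rw [him]; linarith [Real.pi_pos]) (by rw [him]; linarith [Real.pi_pos]),
    Real.log_inv]
  push_cast
  ring

end Bessel

/-! ### Splitting of the kernels into logarithm, constant and tail -/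

section Kernels

/-- The two coefficient functions of the part of the kernels that is small for small `κ`. -/
structure KernelTail where
  logPart : ℂ × Plane → ℂ
  plainPart : ℂ × Plane → ℂ
  continuous_logPart : Continuous logPart
  continuous_plainPart : Continuous plainPart

/-- The part of the kernels that is small for small `κ`. -/
noncomputable def KernelTail.tail (p : KernelTail) (κ : ℂ) (w : Plane) : ℂ :=
  κ ^ 2 * logGammaHat κ * p.logPart (κ, w) + κ ^ 2 * p.plainPart (κ, w)

/-- The regular part of the kernel: everything but `-(1/2π) log |w|`. -/
noncomputable def KernelTail.regular (p : KernelTail) (κ : ℂ) (w : Plane) : ℂ :=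
  -(1 / (2 * Real.pi)) * logGammaHat κ + p.tail κ w

/-- The convolution kernel `-(1/2π) (log |w| + log (κ γ̂))` plus a tail. -/
noncomputable def KernelTail.kernel (p : KernelTail) (κ : ℂ) (w : Plane) : ℂ :=
  ((-(1 / (2 * Real.pi)) * Real.log ‖w‖ : ℝ) : ℂ) + p.regular κ w

/-- The kernel of the expanded operators. -/
noncomputable def expandedTail : KernelTail where
  logPart q := ((1 / (8 * Real.pi) * ‖q.2‖ ^ 2 : ℝ) : ℂ)
  plainPart _ := 0
  continuous_logPart := by fun_prop
  continuous_plainPart := continuous_const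

/-- The kernel `-G`. -/
noncomputable def greenTail : KernelTail where
  logPart q := -((1 / (8 * Real.pi) * ‖q.2‖ ^ 2 : ℝ) : ℂ) * besselJTail ((q.1 * ‖q.2‖ / 2) ^ 2)
  plainPart q := -((1 / (8 * Real.pi) * (‖q.2‖ * (‖q.2‖ * Real.log ‖q.2‖)) : ℝ) : ℂ) *
      besselJTail ((q.1 * ‖q.2‖ / 2) ^ 2) -
    ((1 / (8 * Real.pi) * ‖q.2‖ ^ 2 : ℝ) : ℂ) * besselYTail ((q.1 * ‖q.2‖ / 2) ^ 2)
  continuous_logPart := by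
    have := continuous_besselJTail
    fun_prop
  continuous_plainPart := by
    have h1 := continuous_besselJTail
    have h2 := continuous_besselYTail
    have h3 : Continuous fun q : ℂ × Plane => ‖q.2‖ * Real.log ‖q.2‖ :=
      Real.continuous_mul_log.comp (continuous_norm.comp continuous_snd)
    fun_prop

/-- The logarithm of `κ |w| / 2` splits because `|w| / 2 > 0`. The summand `J₀` of the Hankel
function becomes the `-iπ/2` inside `log γ̂`, and Euler's constant and `log 2` are absorbed there
too. What multiplies `κ²` is continuous in `w` because `|w|² log |w|` is. -/
theorem neg_green_eq {κ : ℂ} (hκ : κ ∈ Complex.slitPlane) {w : Plane} (hw : w ≠ 0) :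
    -green κ w = greenTail.kernel κ w := by
  have hr : 0 < ‖w‖ := norm_pos_iff.2 hw
  have hpi : (Real.pi : ℂ) ≠ 0 := by exact_mod_cast Real.pi_ne_zero
  have hlog : Complex.log (κ * ‖w‖ / 2) = Complex.log κ + Real.log ‖w‖ - Real.log 2 := by
    have : κ * ‖w‖ / 2 = κ * ((‖w‖ / 2 : ℝ) : ℂ) := by push_cast; ring
    rw [this, Complex.log_mul_ofReal _ (by positivity) _ (Complex.slitPlane_ne_zero hκ),
      Real.log_div hr.ne' (by norm_num)]
    push_cast
    ring
  rw [green, hankel0, besselY0_eq, hlog, besselJ0_eq, KernelTail.kernel, KernelTail.regular,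
    KernelTail.tail, logGammaHat, log_gammaHat]
  simp only [greenTail]
  push_cast
  set j := besselJTail ((κ * ‖w‖ / 2) ^ 2)
  set y := besselYTail ((κ * ‖w‖ / 2) ^ 2)
  field_simp
  ring_nf
  simp only [Complex.I_sq]
  ring

theorem KernelTail.stronglyMeasurable_kernel (p : KernelTail) (κ : ℂ) :
    StronglyMeasurable (Function.uncurry fun x y : Plane => p.kernel κ (x - y)) := by
  have h : Measurable fun w : Plane => p.kernel κ w := by
    have h1 := p.continuous_logPart
    have h2 := p.continuous_plainPart
    have h3 : Continuous fun w : Plane => p.regular κ w := by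
      unfold KernelTail.regular KernelTail.tail
      fun_prop
    have h4 := h3.measurable
    unfold KernelTail.kernel
    have h5 : Measurable fun w : Plane => -(1 / (2 * Real.pi)) * Real.log ‖w‖ :=
      measurable_const.mul (Real.measurable_log.comp measurable_norm)
    exact (Complex.measurable_ofReal.comp h5).add h4
  exact (h.comp (measurable_fst.sub measurable_snd)).stronglyMeasurable

theorem KernelTail.continuous_regular (p : KernelTail) (κ : ℂ) : Continuous (p.regular κ) := by
  have h1 := p.continuous_logPart
  have h2 := p.continuous_plainPart
  unfold KernelTail.regular KernelTail.tail
  fun_prop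

theorem KernelTail.continuousOn_regular (p : KernelTail) :
    ContinuousOn (fun q : ℂ × Plane => p.regular q.1 q.2) (Complex.slitPlane ×ˢ univ) := by
  have h1 := p.continuous_logPart
  have h2 := p.continuous_plainPart
  have h3 : ContinuousOn (fun q : ℂ × Plane => logGammaHat q.1) (Complex.slitPlane ×ˢ univ) := by
    unfold logGammaHat
    exact (continuousOn_fst.clog fun q hq => hq.1).add continuousOn_const
  unfold KernelTail.regular KernelTail.tail
  fun_prop

/-- The tails of the kernels are bounded for small wavenumbers. -/
theorem KernelTail.exists_norm_tail_le (p : KernelTail) (R : ℝ) :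
    ∃ κ₁ > 0, ∀ κ : ℂ, κ ∈ Complex.slitPlane → ‖κ‖ ≤ κ₁ → ∀ w : Plane, ‖w‖ ≤ R →
      ‖p.tail κ w‖ ≤ 1 := by
  have hK : IsCompact (Metric.closedBall (0 : ℂ) 1 ×ˢ Metric.closedBall (0 : Plane) R) :=
    (isCompact_closedBall _ _).prod (isCompact_closedBall _ _)
  obtain ⟨M₁, hM₁⟩ := hK.exists_bound_of_continuousOn p.continuous_logPart.continuousOn
  obtain ⟨M₂, hM₂⟩ := hK.exists_bound_of_continuousOn p.continuous_plainPart.continuousOn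
  set g : ℝ := 1 + Real.pi + ‖Complex.log gammaHat‖ with hg
  have hg0 : 0 < g := by positivity
  set M : ℝ := |M₁| * g + |M₂| + 1 with hM
  have hM0 : 0 < M := by positivity
  refine ⟨min 1 M⁻¹, by positivity, fun κ hκ hκ1 w hw => ?_⟩
  have hκle : ‖κ‖ ≤ 1 := hκ1.trans (min_le_left _ _)
  have hκM : ‖κ‖ ≤ M⁻¹ := hκ1.trans (min_le_right _ _)
  have hκ0 : 0 < ‖κ‖ := norm_pos_iff.2 (Complex.slitPlane_ne_zero hκ)
  have hmem : (κ, w) ∈ Metric.closedBall (0 : ℂ) 1 ×ˢ Metric.closedBall (0 : Plane) R :=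
    ⟨by simpa using hκle, by simpa using hw⟩
  have h1 := (hM₁ _ hmem).trans (le_abs_self _)
  have h2 := (hM₂ _ hmem).trans (le_abs_self _)
  -- Since `|κ| |log κ|` stays bounded, one factor `|κ|` absorbs the logarithm and the other makes
  -- the tail small.
  have hlog : ‖κ‖ * ‖logGammaHat κ‖ ≤ g := by
    have h3 : ‖Complex.log κ‖ ≤ |Real.log ‖κ‖| + Real.pi := by
      refine (Complex.norm_le_abs_re_add_abs_im _).trans ?_
      rw [Complex.log_re, Complex.log_im]
      gcongr
      exact Complex.abs_arg_le_pi κ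
    have h4 : ‖κ‖ * |Real.log ‖κ‖| ≤ 1 := by
      have := (Real.abs_log_mul_self_lt ‖κ‖ hκ0 hκle).le
      rwa [abs_mul, abs_of_pos hκ0, mul_comm] at this
    have h5 : ‖logGammaHat κ‖ ≤ |Real.log ‖κ‖| + Real.pi + ‖Complex.log gammaHat‖ :=
      (norm_add_le _ _).trans (by gcongr)
    calc ‖κ‖ * ‖logGammaHat κ‖ ≤ ‖κ‖ * (|Real.log ‖κ‖| + Real.pi + ‖Complex.log gammaHat‖) := by
          gcongr
      _ = ‖κ‖ * |Real.log ‖κ‖| + ‖κ‖ * (Real.pi + ‖Complex.log gammaHat‖) := by ring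
      _ ≤ 1 + 1 * (Real.pi + ‖Complex.log gammaHat‖) := by gcongr
      _ = g := by rw [hg]; ring
  have e1 : ‖κ ^ 2 * logGammaHat κ * p.logPart (κ, w)‖ ≤ ‖κ‖ * (g * |M₁|) := by
    rw [norm_mul, norm_mul, norm_pow]
    calc ‖κ‖ ^ 2 * ‖logGammaHat κ‖ * ‖p.logPart (κ, w)‖ =
          ‖κ‖ * ((‖κ‖ * ‖logGammaHat κ‖) * ‖p.logPart (κ, w)‖) := by ring
      _ ≤ _ := by gcongr
  have e2 : ‖κ ^ 2 * p.plainPart (κ, w)‖ ≤ ‖κ‖ * (1 * |M₂|) := by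
    rw [norm_mul, norm_pow, sq, mul_assoc]
    gcongr
  rw [KernelTail.tail]
  calc _ ≤ ‖κ‖ * (g * |M₁|) + ‖κ‖ * (1 * |M₂|) := (norm_add_le _ _).trans (add_le_add e1 e2)
    _ ≤ ‖κ‖ * M := by rw [hM]; nlinarith
    _ ≤ M⁻¹ * M := by gcongr
    _ = 1 := inv_mul_cancel₀ hM0.ne'

end Kernels

/-! ### Square integrals of the logarithmic singularity -/

section LogIntegrals

/-- In polar coordinates the integrand is `r (log r)² = 4 (√r log √r)²`, which extends continuously
to `r = 0`. -/
theorem integrableOn_log_norm_sq (r : ℝ) :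
    IntegrableOn (fun x : Plane => Real.log ‖x‖ ^ 2) (Metric.ball 0 r) := by
  rw [integrableOn_fun_norm_addHaar volume (f := fun y => Real.log y ^ 2)]
  have h1 : Continuous fun y : ℝ => 4 * (√y * Real.log √y) ^ 2 := by
    have := Real.continuous_mul_log.comp Real.continuous_sqrt
    exact continuous_const.mul (this.pow 2)
  refine ((h1.integrableOn_Icc (a := 0) (b := r)).mono_set Ioo_subset_Icc_self).congr_fun ?_
    measurableSet_Ioo
  intro y hy
  have hy0 : 0 < y := hy.1
  simp only [finrank_euclideanSpace, Fintype.card_fin, smul_eq_mul]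
  rw [Real.log_sqrt hy0.le, mul_pow, Real.sq_sqrt hy0.le]
  ring

theorem eLpNorm_two_le_of_integral_le {X : Type*} [MeasurableSpace X] {μ : Measure X} {f : X → ℂ}
    {m : ℝ} (hf : AEStronglyMeasurable f μ) (hm0 : 0 ≤ m) (hi : Integrable (fun x => ‖f x‖ ^ 2) μ)
    (hm : ∫ x, ‖f x‖ ^ 2 ∂μ ≤ m ^ 2) : eLpNorm f 2 μ ≤ ENNReal.ofReal m := by
  have h := (memLp_two_iff_integrable_sq_norm hf).2 hi
  rw [h.eLpNorm_eq_integral_rpow_norm (by norm_num) (by norm_num)]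
  refine ENNReal.ofReal_le_ofReal ?_
  simp only [ENNReal.toReal_ofNat, Real.rpow_ofNat]
  rw [← one_div, ← Real.sqrt_eq_rpow]
  exact Real.sqrt_le_iff.2 ⟨hm0, hm⟩

/-- The `L²` norm of `log |z|` on the ball of radius `3`. -/
noncomputable def logConst : ℝ := √(∫ z in Metric.ball (0 : Plane) 3, Real.log ‖z‖ ^ 2)

/-- The substitution `y = x - ρ z` turns the integrand into `(log |z|)²` with Jacobian `ρ²`.
Dividing by `ρ` inside the logarithm removes the large constant `log ρ`. -/
theorem eLpNorm_log_dist_le {ρ : ℝ} (hρ : 0 < ρ) {D : Set Plane} {x : Plane}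
    (hD : D ⊆ Metric.ball x (3 * ρ)) :
    eLpNorm (fun y => ((Real.log (‖x - y‖ / ρ) : ℝ) : ℂ)) 2 (volume.restrict D) ≤
      ENNReal.ofReal (ρ * logConst) := by
  refine (eLpNorm_mono_measure _ (Measure.restrict_mono hD le_rfl)).trans ?_
  have hmeas : Measurable fun y : Plane => ((Real.log (‖x - y‖ / ρ) : ℝ) : ℂ) := by
    fun_prop
  have hind : ∀ z : Plane, (Metric.ball x (3 * ρ)).indicator
      (fun y => ‖((Real.log (‖x - y‖ / ρ) : ℝ) : ℂ)‖ ^ 2) (x - ρ • z) =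
        (Metric.ball (0 : Plane) 3).indicator (fun z => Real.log ‖z‖ ^ 2) z := by
    intro z
    have hz : ‖x - (x - ρ • z)‖ = ρ * ‖z‖ := by
      rw [sub_sub_cancel, norm_smul, Real.norm_of_nonneg hρ.le]
    have hmem : x - ρ • z ∈ Metric.ball x (3 * ρ) ↔ z ∈ Metric.ball (0 : Plane) 3 := by
      rw [mem_ball_iff_norm', hz, mem_ball_zero_iff, mul_comm, mul_lt_mul_iff_left₀ hρ]
    by_cases h : z ∈ Metric.ball (0 : Plane) 3
    · rw [indicator_of_mem h, indicator_of_mem (hmem.2 h), hz, mul_div_cancel_left₀ _ hρ.ne',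
        Complex.norm_real, Real.norm_eq_abs, sq_abs]
    · rw [indicator_of_notMem h, indicator_of_notMem (fun h' => h (hmem.1 h'))]
  have hint0 : Integrable ((Metric.ball (0 : Plane) 3).indicator fun z => Real.log ‖z‖ ^ 2) :=
    (integrable_indicator_iff measurableSet_ball).2 (integrableOn_log_norm_sq 3)
  have hcomp : (fun z : Plane => (Metric.ball x (3 * ρ)).indicator
      (fun y => ‖((Real.log (‖x - y‖ / ρ) : ℝ) : ℂ)‖ ^ 2) (x - ρ • z)) =
        (Metric.ball (0 : Plane) 3).indicator fun z => Real.log ‖z‖ ^ 2 := funext hind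
  set F : Plane → ℝ := (Metric.ball x (3 * ρ)).indicator
      (fun y => ‖((Real.log (‖x - y‖ / ρ) : ℝ) : ℂ)‖ ^ 2) with hF
  have hintF : Integrable F := by
    have h1 : Integrable fun z => F (x - ρ • z) := by rw [hcomp]; exact hint0
    have h2 : Integrable fun z => F (x - z) :=
      (integrable_comp_smul_iff volume (fun z => F (x - z)) hρ.ne').1 h1
    exact (integrable_comp_sub_left F x).1 h2
  have hval : ∫ y, F y = ρ ^ 2 * logConst ^ 2 := by
    have h1 : ∫ z, F (x - ρ • z) = (ρ ^ 2)⁻¹ * ∫ z, F (x - z) := by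
      rw [Measure.integral_comp_smul volume (fun z => F (x - z)) ρ]
      simp [abs_of_pos hρ]
    rw [integral_sub_left_eq_self, hcomp, integral_indicator measurableSet_ball] at h1
    rw [logConst, Real.sq_sqrt (integral_nonneg fun _ => by positivity), h1,
      mul_inv_cancel_left₀ (by positivity)]
  refine eLpNorm_two_le_of_integral_le hmeas.aestronglyMeasurable
    (mul_nonneg hρ.le (Real.sqrt_nonneg _)) ?_ ?_
  · exact (integrable_indicator_iff measurableSet_ball).1 hintF
  · rw [← integral_indicator measurableSet_ball, ← hF, hval, mul_pow]

theorem memLp_log_dist {S : Set Plane} (hS : Bornology.IsBounded S) (x : Plane) :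
    MemLp (fun y => ((Real.log ‖x - y‖ : ℝ) : ℂ)) 2 (volume.restrict S) := by
  obtain ⟨r, hr, hSr⟩ := hS.subset_ball_lt 0 x
  have h3 : S ⊆ Metric.ball x (3 * r) := hSr.trans (Metric.ball_subset_ball (by linarith))
  have h1 := eLpNorm_log_dist_le hr h3
  have hmeas : Measurable fun y : Plane => ((Real.log (‖x - y‖ / r) : ℝ) : ℂ) := by
    fun_prop
  have h2 : MemLp (fun y => ((Real.log (‖x - y‖ / r) : ℝ) : ℂ)) 2 (volume.restrict S) :=
    ⟨hmeas.aestronglyMeasurable, h1.trans_lt ENNReal.ofReal_lt_top⟩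
  have : IsFiniteMeasure (volume.restrict S) := ⟨by simpa using hS.measure_lt_top⟩
  have h4 := h2.add (memLp_const ((Real.log r : ℝ) : ℂ))
  refine h4.ae_eq ?_
  have : ∀ᵐ y ∂(volume.restrict S), y ≠ x := by
    refine ae_restrict_of_ae ?_
    simp [ae_iff]
  filter_upwards [this] with y hy
  rw [Pi.add_apply, Real.log_div (norm_ne_zero_iff.2 (sub_ne_zero.2 hy.symm)) hr.ne']
  push_cast
  ring

end LogIntegrals

/-! ### The given operators as convolution operators -/

section Realization

/-- The family `Op` of operators has the convolution kernels `p.kernel`. -/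
def Realizes (p : KernelTail) (Op : ℂ → Set Plane → (Plane → ℂ) → Plane → ℂ) : Prop :=
  ∀ κ ∈ Complex.slitPlane, ∀ S : Set Plane, Bornology.IsBounded S → MeasurableSet S → ∀ u : Plane → ℂ,
    MemLp u 2 (volume.restrict S) → ∀ x, Op κ S u x = ∫ y in S, p.kernel κ (x - y) * u y

/-- The kernel identity fails only at `y = x`, a null set. As `opK` and `opR` are given by the same
formula, and so are `opM` and `opN`, one realization serves both the diagonal and the off-diagonal
blocks. -/
theorem realizes_opK : Realizes greenTail opK := by
  intro κ hκ S _ _ u _ x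
  rw [opK, ← integral_neg]
  refine integral_congr_ae ?_
  have : ∀ᵐ y ∂(volume.restrict S), y ≠ x := by
    refine ae_restrict_of_ae ?_
    simp [ae_iff]
  filter_upwards [this] with y hy
  rw [← neg_mul, neg_green_eq hκ (sub_ne_zero.2 hy.symm)]

theorem realizes_opM : Realizes expandedTail opM := by
  intro κ _ S hS hSm u hu x
  have : IsFiniteMeasure (volume.restrict S) := ⟨by simpa using hS.measure_lt_top⟩
  have h0 : Integrable u (volume.restrict S) := hu.integrable (by norm_num)
  have h1 : Integrable (fun y => ((-(1 / (2 * Real.pi)) * Real.log ‖x - y‖ : ℝ) : ℂ) * u y)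
      (volume.restrict S) := by
    have := ((memLp_log_dist hS x).integrable_mul hu).const_mul ((-(1 / (2 * Real.pi)) : ℝ) : ℂ)
    refine this.congr (Eventually.of_forall fun y => ?_)
    simp only [Pi.mul_apply]
    push_cast
    ring
  have h2 : Integrable (fun y => ((1 / (8 * Real.pi) * ‖x - y‖ ^ 2 : ℝ) : ℂ) * u y)
      (volume.restrict S) := by
    obtain ⟨r, hr⟩ := hS.subset_ball x
    refine Integrable.bdd_mul (c := ‖1 / (8 * Real.pi)‖ * r ^ 2) h0 ?_ ?_
    · exact (by fun_prop : Continuous fun y : Plane =>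
        ((1 / (8 * Real.pi) * ‖x - y‖ ^ 2 : ℝ) : ℂ)).aestronglyMeasurable
    · filter_upwards [ae_restrict_mem hSm] with y hy
      have h3 := Metric.mem_ball'.1 (hr hy)
      rw [dist_eq_norm] at h3
      rw [Complex.norm_real, norm_mul, norm_pow, norm_norm]
      gcongr
  simp only [opM, opHat, opZero, opOne, KernelTail.kernel, KernelTail.regular, KernelTail.tail,
    expandedTail, mul_zero, add_zero]
  have h4 : Integrable (fun y => -(1 / (2 * Real.pi)) * logGammaHat κ * u y +
      ((-(1 / (2 * Real.pi)) * Real.log ‖x - y‖ : ℝ) : ℂ) * u y) (volume.restrict S) :=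
    (h0.const_mul _).add h1
  rw [← integral_const_mul, ← integral_const_mul, ← integral_add (h0.const_mul _) h1,
    ← integral_add h4 (h2.const_mul _)]
  refine integral_congr_ae (Eventually.of_forall fun y => ?_)
  simp only
  ring

end Realization

/-! ### Size estimates for dilute configurations -/

section Geometry

variable {N : ℕ} {c d R : ℝ} {D : Fin N → Set Plane}

theorem IsDilute.isBounded (hD : IsDilute c d R D) (i : Fin N) : Bornology.IsBounded (D i) :=
  Metric.isBounded_ball.subset (hD.bounded i)

theorem IsDilute.isFiniteMeasure (hD : IsDilute c d R D) (i : Fin N) :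
    IsFiniteMeasure (volume.restrict (D i)) :=
  ⟨by simpa using (hD.isBounded i).measure_lt_top⟩

theorem diam_le_two_mul_sizeParam (D : Fin N → Set Plane) (i : Fin N) :
    Metric.diam (D i) ≤ 2 * sizeParam D := by
  have := le_ciSup (Finite.bddAbove_range fun i => Metric.diam (D i)) i
  rw [sizeParam]
  linarith

/-- The diameter is at most `2 ρ`; the radius `3 ρ` leaves room for an open ball. -/
theorem IsDilute.subset_ball (hD : IsDilute c d R D) (hρ : 0 < sizeParam D) {i : Fin N}
    {x : Plane} (hx : x ∈ D i) : D i ⊆ Metric.ball x (3 * sizeParam D) := by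
  intro y hy
  have h1 := Metric.dist_le_diam_of_mem (hD.isBounded i) hy hx
  have h2 := diam_le_two_mul_sizeParam D i
  rw [Metric.mem_ball]
  linarith

/-- The area of the unit disc. -/
noncomputable def discArea : ℝ := volume.real (Metric.ball (0 : Plane) 1)

theorem IsDilute.le_area (hD : IsDilute c d R D) (i : Fin N) :
    c * sizeParam D ^ 2 ≤ (volume.restrict (D i)).real univ := by
  simpa [measureReal_def] using hD.area i

theorem IsDilute.area_pos (hD : IsDilute c d R D) (hc : 0 < c) (hρ : 0 < sizeParam D) (i : Fin N) :
    0 < (volume.restrict (D i)).real univ :=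
  (by positivity : 0 < c * sizeParam D ^ 2).trans_le (hD.le_area i)

theorem IsDilute.area_le (hD : IsDilute c d R D) (hρ : 0 < sizeParam D) (i : Fin N) :
    (volume.restrict (D i)).real univ ≤ (3 * sizeParam D) ^ 2 * discArea := by
  have h0 : (volume.restrict (D i)).real univ = volume.real (D i) := by simp [measureReal_def]
  rw [h0]
  rcases (D i).eq_empty_or_nonempty with h | ⟨x, hx⟩
  · rw [h, measureReal_empty]
    exact mul_nonneg (by positivity) measureReal_nonneg
  · refine (measureReal_mono (hD.subset_ball hρ hx) measure_ball_lt_top.ne).trans_eq ?_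
    rw [measureReal_def, Measure.addHaar_ball _ _ (by positivity), ENNReal.toReal_mul,
      ENNReal.toReal_ofReal (by positivity), discArea, measureReal_def]
    simp

theorem sqrt_area_le (hD : IsDilute c d R D) (hρ : 0 < sizeParam D) (i : Fin N) :
    √((volume.restrict (D i)).real univ) ≤ sizeParam D * (3 * √discArea) := by
  have h0 : 0 ≤ discArea := measureReal_nonneg
  rw [Real.sqrt_le_left (by positivity)]
  refine (hD.area_le hρ i).trans_eq ?_
  rw [mul_pow, mul_pow, mul_pow, Real.sq_sqrt h0]
  ring

/-- The square root of the area of the `i`-th particle, relative to the size parameter. -/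
noncomputable def relSize (D : Fin N → Set Plane) (i : Fin N) : ℝ :=
  √((volume.restrict (D i)).real univ) / sizeParam D

theorem relSize_le (hD : IsDilute c d R D) (hρ : 0 < sizeParam D) (i : Fin N) :
    relSize D i ≤ 3 * √discArea := by
  rw [relSize, div_le_iff₀ hρ, mul_comm]
  exact sqrt_area_le hD hρ i

theorem le_relSize (hD : IsDilute c d R D) (hρ : 0 < sizeParam D) (i : Fin N) :
    √c ≤ relSize D i := by
  rw [relSize, le_div_iff₀ hρ]
  refine Real.le_sqrt_of_sq_le ?_
  rcases le_or_gt 0 c with hc | hc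
  · rw [mul_pow, Real.sq_sqrt hc]
    exact hD.le_area i
  · rw [Real.sqrt_eq_zero_of_nonpos hc.le]
    simp

end Geometry

/-! ### Leading part and remainder of the particle operators -/

section Operators

variable {N : ℕ} {D : Fin N → Set Plane}

/-- The integral operator with kernel `k`, if there is one. -/
noncomputable def kernelOperator (k : Plane → Plane → ℂ) (μ ν : Measure Plane) :
    Lp ℂ 2 μ →L[ℂ] Lp ℂ 2 ν :=
  Classical.epsilon (IsKernelOperator k)

/-- The operator from the `j`-th to the `i`-th particle. -/
noncomputable def pairOperator (p : KernelTail) (D : Fin N → Set Plane) (κ : ℂ) (i j : Fin N) :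
    Lp ℂ 2 (volume.restrict (D j)) →L[ℂ] Lp ℂ 2 (volume.restrict (D i)) :=
  kernelOperator (fun x y => p.kernel κ (x - y)) (volume.restrict (D j)) (volume.restrict (D i))

/-- The order of magnitude of the operators. -/
noncomputable def operatorScale (D : Fin N → Set Plane) : ℝ :=
  -Real.log (sizeParam D) * sizeParam D ^ 2 / (2 * Real.pi)

/-- The leading-order value of the kernel. -/
noncomputable def leadingKernel (D : Fin N → Set Plane) (i j : Fin N) : ℝ :=
  (if i = j then 2 else 1) * (-Real.log (sizeParam D) / (2 * Real.pi))

/-- The scaled remainder of the operator from the `j`-th to the `i`-th particle. -/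
noncomputable def remainderOperator (p : KernelTail) (D : Fin N → Set Plane)
    [∀ i, IsFiniteMeasure (volume.restrict (D i))] (κ : ℂ) (i j : Fin N) :
    Lp ℂ 2 (volume.restrict (D j)) →L[ℂ] Lp ℂ 2 (volume.restrict (D i)) :=
  ((operatorScale D : ℂ)⁻¹) • (pairOperator p D κ i j -
    ((leadingKernel D i j : ℂ) * (√((volume.restrict (D i)).real univ) *
      √((volume.restrict (D j)).real univ))) •
      (innerSL ℂ (constVector (volume.restrict (D j)))).smulRight
        (constVector (volume.restrict (D i))))

/-- The normalised constants on the particles. -/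
noncomputable def constVectors (D : Fin N → Set Plane)
    [∀ i, IsFiniteMeasure (volume.restrict (D i))] (i : Fin N) : Lp ℂ 2 (volume.restrict (D i)) :=
  constVector (volume.restrict (D i))

variable {c d R : ℝ}

theorem scale_mul_leadingMatrix (hρ : 0 < sizeParam D) (i j : Fin N) :
    (operatorScale D : ℂ) * leadingMatrix (relSize D) i j =
      (leadingKernel D i j : ℂ) * (√((volume.restrict (D i)).real univ) *
      √((volume.restrict (D j)).real univ)) := by
  have hρ' : (sizeParam D : ℂ) ≠ 0 := by exact_mod_cast hρ.ne'
  simp only [leadingMatrix, Matrix.of_apply, relSize, operatorScale, leadingKernel]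
  push_cast
  field_simp

theorem scale_smul_blockMap [∀ i, IsFiniteMeasure (volume.restrict (D i))] (hρ : 0 < sizeParam D)
    (hs : operatorScale D ≠ 0) (p : KernelTail) (κ : ℂ) (i j : Fin N)
    (u : Lp ℂ 2 (volume.restrict (D j))) :
    (operatorScale D : ℂ) • blockMap (constVectors D) (relSize D) (remainderOperator p D κ) i j u =
      pairOperator p D κ i j u := by
  have hs' : (operatorScale D : ℂ) ≠ 0 := by exact_mod_cast hs
  rw [blockMap, smul_add, smul_smul, ← mul_assoc, scale_mul_leadingMatrix hρ, remainderOperator,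
    smul_apply, smul_smul, mul_inv_cancel₀ hs', one_smul]
  simp only [sub_apply, smul_apply, ContinuousLinearMap.smulRight_apply, innerSL_apply_apply,
    constVectors, smul_smul]
  abel

theorem exists_bound_regular (p : KernelTail) (κ : ℂ) (r : ℝ) :
    ∃ M, 0 ≤ M ∧ ∀ w : Plane, ‖w‖ ≤ r → ‖p.regular κ w‖ ≤ M := by
  obtain ⟨M, hM⟩ := (isCompact_closedBall (0 : Plane) r).exists_bound_of_continuousOn
    (p.continuous_regular κ).continuousOn
  exact ⟨|M|, abs_nonneg _, fun w hw => (hM w (by simpa using hw)).trans (le_abs_self _)⟩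

theorem IsDilute.norm_sub_le_two_mul (hD : IsDilute c d R D) {i j : Fin N} {x y : Plane} (hx : x ∈ D i)
    (hy : y ∈ D j) : ‖x - y‖ ≤ 2 * R := by
  have h1 := mem_ball_zero_iff.1 (hD.bounded i hx)
  have h2 := mem_ball_zero_iff.1 (hD.bounded j hy)
  have := norm_sub_le x y
  linarith

theorem ae_ae_of_forall_mem {P : Plane → Plane → Prop} (hD : IsDilute c d R D) {i j : Fin N}
    (h : ∀ x ∈ D i, ∀ y ∈ D j, P x y) :
    ∀ᵐ x ∂(volume.restrict (D i)), ∀ᵐ y ∂(volume.restrict (D j)), P x y := by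
  filter_upwards [ae_restrict_mem (hD.isOpen i).measurableSet] with x hx
  filter_upwards [ae_restrict_mem (hD.isOpen j).measurableSet] with y hy
  exact h x hx y hy

theorem aestronglyMeasurable_regular_sub (p : KernelTail) (κ : ℂ) (μ : Measure Plane) (x : Plane) :
    AEStronglyMeasurable (fun y => p.regular κ (x - y)) μ :=
  ((p.continuous_regular κ).comp (by fun_prop)).aestronglyMeasurable

theorem SliceBound.congr {k k' : Plane → Plane → ℂ} {μ ν : Measure Plane} {m : ℝ}
    (h : SliceBound k μ ν m) (hk : ∀ x, k x =ᵐ[μ] k' x) : SliceBound k' μ ν m := by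
  filter_upwards [h] with x hx
  exact ⟨hx.1.congr (hk x), (eLpNorm_congr_ae (hk x)).symm.trans_le hx.2⟩

theorem logConst_nonneg : 0 ≤ logConst := Real.sqrt_nonneg _

theorem one_div_two_pi_le_one : 1 / (2 * Real.pi) ≤ 1 := by
  rw [div_le_one (by positivity)]
  linarith [Real.pi_gt_three]

theorem norm_neg_one_div_two_pi_mul_le (z : ℂ) :
    ‖((-(1 / (2 * Real.pi)) : ℝ) : ℂ) * z‖ ≤ ‖z‖ := by
  rw [norm_mul, Complex.norm_real, norm_neg, Real.norm_of_nonneg (by positivity)]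
  exact mul_le_of_le_one_left (norm_nonneg _) one_div_two_pi_le_one

/-- Slice bound for the kernel on sets of size `s`, minus a constant. -/
theorem IsDilute.sliceBound_kernel_sub (hD : IsDilute c d R D) (p : KernelTail) (κ : ℂ)
    {i j : Fin N} {s : ℝ} (hs : 0 < s) (hball : ∀ x ∈ D i, D j ⊆ Metric.ball x (3 * s)) {b : ℂ}
    {M : ℝ} (hM0 : 0 ≤ M) (hM : ∀ x ∈ D i, ∀ y ∈ D j,
      ‖((-(1 / (2 * Real.pi)) * Real.log s : ℝ) : ℂ) + p.regular κ (x - y) - b‖ ≤ M) :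
    SliceBound (fun x y => p.kernel κ (x - y) - b) (volume.restrict (D j)) (volume.restrict (D i))
      (s * logConst + √((volume.restrict (D j)).real univ) * M) := by
  have := hD.isFiniteMeasure j
  have h1 : SliceBound (fun x y => ((-(1 / (2 * Real.pi)) * Real.log s : ℝ) : ℂ) +
      p.regular κ (x - y) - b) (volume.restrict (D j)) (volume.restrict (D i))
      (√((volume.restrict (D j)).real univ) * M) :=
    SliceBound.of_bound (fun x => (aestronglyMeasurable_const.add
      (aestronglyMeasurable_regular_sub p κ _ x)).sub aestronglyMeasurable_const)
      (ae_ae_of_forall_mem hD hM)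
  have h2 : SliceBound (fun x y => ((-(1 / (2 * Real.pi)) : ℝ) : ℂ) *
      ((Real.log (‖x - y‖ / s) : ℝ) : ℂ)) (volume.restrict (D j)) (volume.restrict (D i))
      (s * logConst) := by
    filter_upwards [ae_restrict_mem (hD.isOpen i).measurableSet] with x hx
    have hmeas : Measurable fun y : Plane => ((Real.log (‖x - y‖ / s) : ℝ) : ℂ) := by fun_prop
    refine ⟨(hmeas.const_mul _).aestronglyMeasurable,
      (eLpNorm_mono fun y => ?_).trans (eLpNorm_log_dist_le hs (hball x hx))⟩
    exact norm_neg_one_div_two_pi_mul_le _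
  refine (h2.add (mul_nonneg hs.le logConst_nonneg) (by positivity) h1).congr fun x => ?_
  have : ∀ᵐ y ∂(volume.restrict (D j)), y ≠ x := by
    refine ae_restrict_of_ae ?_
    simp [ae_iff]
  filter_upwards [this] with y hy
  rw [KernelTail.kernel, Real.log_div (norm_ne_zero_iff.2 (sub_ne_zero.2 hy.symm)) hs.ne']
  push_cast
  ring

/-- A crude bound at the scale `R` of the whole region, needed only for the operators to exist; the
sharp one uses the scale `ρ`. -/
theorem IsDilute.exists_sliceBound (hD : IsDilute c d R D) (hR : 0 < R) (p : KernelTail) (κ : ℂ)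
    (i j : Fin N) : ∃ m, 0 ≤ m ∧ SliceBound (fun x y => p.kernel κ (x - y))
      (volume.restrict (D j)) (volume.restrict (D i)) m := by
  obtain ⟨M, hM0, hM⟩ := exists_bound_regular p κ (2 * R)
  have h := hD.sliceBound_kernel_sub p κ (i := i) (j := j) hR (b := 0)
    (M := ‖((-(1 / (2 * Real.pi)) * Real.log R : ℝ) : ℂ)‖ + M) (fun x hx y hy => by
      have := hD.norm_sub_le_two_mul hx hy
      rw [mem_ball_iff_norm']
      linarith) (by positivity) (fun x hx y hy => by
      rw [sub_zero]
      refine (norm_add_le _ _).trans ?_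
      gcongr
      exact hM _ (hD.norm_sub_le_two_mul hx hy))
  simp only [sub_zero] at h
  exact ⟨_, add_nonneg (mul_nonneg hR.le logConst_nonneg) (by positivity), h⟩

theorem IsDilute.isKernelOperator (hD : IsDilute c d R D) (hR : 0 < R) (p : KernelTail) (κ : ℂ)
    (i j : Fin N) : IsKernelOperator (fun x y => p.kernel κ (x - y)) (pairOperator p D κ i j) := by
  have := hD.isFiniteMeasure i
  have := hD.isFiniteMeasure j
  obtain ⟨m, hm0, hm⟩ := hD.exists_sliceBound hR p κ i j
  exact Classical.epsilon_spec (exists_kernelOperator (p.stronglyMeasurable_kernel κ) hm0 hm)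

/-- In the difference of two kernels the singularity `log |x-y|` cancels, and the regular parts
converge uniformly for `|x-y| ≤ 2 R`. -/
theorem IsDilute.continuousOn_pairOperator (hD : IsDilute c d R D) (hR : 0 < R) (p : KernelTail)
    (i j : Fin N) : ContinuousOn (fun κ => pairOperator p D κ i j) Complex.slitPlane := by
  have := hD.isFiniteMeasure i
  have := hD.isFiniteMeasure j
  intro κ hκ
  rw [ContinuousWithinAt, Metric.tendsto_nhds]
  intro ε hε
  set A : ℝ := √((volume.restrict (D i)).real univ) * √((volume.restrict (D j)).real univ) with hA
  have hA0 : 0 ≤ A := by positivity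
  have hu : {q : ℂ × ℂ | dist q.1 q.2 < ε / (A + 1)} ∈ uniformity ℂ :=
    Metric.dist_mem_uniformity (by positivity)
  obtain ⟨v, hv, hvq⟩ := (isCompact_closedBall (0 : Plane) (2 * R)).mem_uniformity_of_prod
    (f := fun κ w => p.regular κ w) (s := Complex.slitPlane)
    (p.continuousOn_regular.mono (prod_mono le_rfl (subset_univ _))) hκ hu
  filter_upwards [hv] with κ' hκ'
  obtain ⟨m, -, hm⟩ := hD.exists_sliceBound hR p κ i j
  obtain ⟨m', -, hm'⟩ := hD.exists_sliceBound hR p κ' i j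
  have hop := IsKernelOperator.sub hm' hm (hD.isKernelOperator hR p κ' i j)
    (hD.isKernelOperator hR p κ i j)
  have hb : SliceBound (fun x y => p.kernel κ' (x - y) - p.kernel κ (x - y))
      (volume.restrict (D j)) (volume.restrict (D i))
      (√((volume.restrict (D j)).real univ) * (ε / (A + 1))) := by
    simp only [KernelTail.kernel, add_sub_add_left_eq_sub]
    refine SliceBound.of_bound (fun x => (aestronglyMeasurable_regular_sub p κ' _ x).sub
      (aestronglyMeasurable_regular_sub p κ _ x)) (ae_ae_of_forall_mem hD fun x hx y hy => ?_)
    have := hvq κ' hκ' (x - y) (by simpa using hD.norm_sub_le_two_mul hx hy)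
    rw [Pi.sub_apply, ← dist_eq_norm]
    exact this.le
  rw [dist_eq_norm]
  refine (hop.norm_le (by positivity) hb).trans_lt ?_
  rw [← mul_assoc, ← hA, mul_div_assoc', div_lt_iff₀ (by positivity)]
  nlinarith

/-- The remainders are of relative order `1 / |log ρ|`. -/
theorem IsDilute.norm_remainderOperator_le [∀ i, IsFiniteMeasure (volume.restrict (D i))]
    (hD : IsDilute c d R D) (hc : 0 < c) (hd : 0 < d) (hR : 0 < R)
    (hρ : 0 < sizeParam D) (hρ1 : sizeParam D < 1) (p : KernelTail) {κ : ℂ} {L : ℝ}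
    (hL : ‖logGammaHat κ - Real.log (sizeParam D)‖ ≤ L)
    (ht : ∀ w : Plane, ‖w‖ ≤ 2 * R → ‖p.tail κ w‖ ≤ 1) (i j : Fin N) :
    ‖remainderOperator p D κ i j‖ ≤
      2 * Real.pi * (3 * √discArea) * (logConst + 3 * √discArea *
        (|Real.log d| + |Real.log (2 * R)| + L + 1)) / -Real.log (sizeParam D) := by
  set ρ := sizeParam D with hρdef
  have hlog : 0 < -Real.log ρ := neg_pos.2 (Real.log_neg hρ hρ1)
  have hh : 0 < operatorScale D := by
    rw [operatorScale, ← hρdef]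
    positivity
  set M : ℝ := |Real.log d| + |Real.log (2 * R)| + L + 1 with hM
  have hL0 : 0 ≤ L := (norm_nonneg _).trans hL
  have hM0 : 0 ≤ M := by positivity
  set V : ℝ := 3 * √discArea with hV
  have hV0 : 0 ≤ V := by positivity
  obtain ⟨m, hm0, hm⟩ := hD.exists_sliceBound hR p κ i j
  have hbound : SliceBound (fun x y => p.kernel κ (x - y) - (leadingKernel D i j : ℂ))
      (volume.restrict (D j)) (volume.restrict (D i))
      (ρ * logConst + √((volume.restrict (D j)).real univ) * M) := by
    -- On one particle the leading kernel removes one `log ρ` from `log (κ γ̂)` and one from `log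
    -- |x-y|`, leaving `log (|x-y| / ρ)`, which is bounded in `L²` at scale `ρ`. Between two
    -- particles `log |x-y|` is bounded through `d ≤ |x-y| ≤ 2 R`, so only one `log ρ` is removed.
    by_cases hij : i = j
    · subst hij
      refine hD.sliceBound_kernel_sub p κ hρ (fun x hx => hD.subset_ball hρ hx) hM0
        fun x hx y hy => ?_
      have e1 : ((-(1 / (2 * Real.pi)) * Real.log ρ : ℝ) : ℂ) + p.regular κ (x - y) -
          (leadingKernel D i i : ℂ) = ((-(1 / (2 * Real.pi)) : ℝ) : ℂ) *
            (logGammaHat κ - Real.log ρ) + p.tail κ (x - y) := by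
        simp only [leadingKernel, KernelTail.regular, if_true, ← hρdef]
        push_cast
        field_simp
        ring
      rw [e1]
      refine (norm_add_le _ _).trans ?_
      have h1 := (norm_neg_one_div_two_pi_mul_le _).trans hL
      have h2 := ht _ (hD.norm_sub_le_two_mul hx hy)
      have := abs_nonneg (Real.log d)
      have := abs_nonneg (Real.log (2 * R))
      linarith
    · have h1 : SliceBound (fun x y => p.kernel κ (x - y) - (leadingKernel D i j : ℂ))
          (volume.restrict (D j)) (volume.restrict (D i))
          (√((volume.restrict (D j)).real univ) * M) := by
        refine SliceBound.of_bound (fun x => ?_) (ae_ae_of_forall_mem hD fun x hx y hy => ?_)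
        · exact ((p.stronglyMeasurable_kernel κ).measurable.comp
            (measurable_const.prodMk measurable_id)).aestronglyMeasurable.sub
              aestronglyMeasurable_const
        · have e1 : p.kernel κ (x - y) - (leadingKernel D i j : ℂ) =
              ((-(1 / (2 * Real.pi)) : ℝ) : ℂ) * ((Real.log ‖x - y‖ : ℝ) +
                (logGammaHat κ - Real.log ρ)) + p.tail κ (x - y) := by
            simp only [leadingKernel, KernelTail.kernel, KernelTail.regular, if_neg hij, ← hρdef]
            push_cast
            field_simp
            ring
          rw [e1]
          refine (norm_add_le _ _).trans ?_
          have h2 := ht _ (hD.norm_sub_le_two_mul hx hy)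
          have h3 : ‖((Real.log ‖x - y‖ : ℝ) : ℂ)‖ ≤ |Real.log d| + |Real.log (2 * R)| := by
            have h4 : d ≤ ‖x - y‖ := by
              rw [← dist_eq_norm]
              exact hD.separated i j hij x hx y hy
            have h5 := hD.norm_sub_le_two_mul hx hy
            have h6 := Real.log_le_log hd h4
            have h7 := Real.log_le_log (hd.trans_le h4) h5
            rw [Complex.norm_real, Real.norm_eq_abs, abs_le]
            constructor
            · linarith [neg_abs_le (Real.log d), abs_nonneg (Real.log (2 * R))]
            · linarith [le_abs_self (Real.log (2 * R)), abs_nonneg (Real.log d)]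
          have h8 := (norm_neg_one_div_two_pi_mul_le
            ((Real.log ‖x - y‖ : ℝ) + (logGammaHat κ - Real.log ρ))).trans (norm_add_le _ _)
          linarith
      filter_upwards [h1] with x hx
      refine ⟨hx.1, hx.2.trans (ENNReal.ofReal_le_ofReal ?_)⟩
      have := mul_nonneg hρ.le logConst_nonneg
      linarith
  set T' := pairOperator p D κ i j -
    ((leadingKernel D i j : ℂ) * (√((volume.restrict (D i)).real univ) *
      √((volume.restrict (D j)).real univ))) •
      (innerSL ℂ (constVector (volume.restrict (D j)))).smulRight
        (constVector (volume.restrict (D i))) with hT'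
  have hop : IsKernelOperator (fun x y => p.kernel κ (x - y) - (leadingKernel D i j : ℂ)) T' := by
    refine (hD.isKernelOperator hR p κ i j).sub_const (hD.area_pos hc hρ j) (hD.area_pos hc hρ i)
      hm _ fun u => ?_
    rw [hT']
    simp only [sub_apply, smul_apply, ContinuousLinearMap.smulRight_apply, innerSL_apply_apply,
      smul_smul]
  have hA : ∀ i, √((volume.restrict (D i)).real univ) ≤ ρ * V := sqrt_area_le hD hρ
  have hT'n : ‖T'‖ ≤ ρ * V * (ρ * logConst + ρ * V * M) := by
    refine (hop.norm_le (add_nonneg (mul_nonneg hρ.le logConst_nonneg) (by positivity))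
      hbound).trans ?_
    have := logConst_nonneg
    gcongr
    · exact hA i
    · exact hA j
  rw [remainderOperator, norm_smul, norm_inv, Complex.norm_real, Real.norm_of_nonneg hh.le]
  calc (operatorScale D)⁻¹ * ‖T'‖ ≤ (operatorScale D)⁻¹ * (ρ * V * (ρ * logConst + ρ * V * M)) := by
        gcongr
    _ = _ := by
      rw [operatorScale, ← hρdef]
      have := hρ.ne'
      have := hlog.ne'
      field_simp

theorem IsDilute.continuousOn_remainderOperator [∀ i, IsFiniteMeasure (volume.restrict (D i))]
    (hD : IsDilute c d R D) (hR : 0 < R) (p : KernelTail) (i j : Fin N) :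
    ContinuousOn (fun κ => remainderOperator p D κ i j) Complex.slitPlane :=
  (continuous_const_smul _).comp_continuousOn
    ((hD.continuousOn_pairOperator hR p i j).sub continuousOn_const)

end Operators

theorem finRotate_ne_self {N : ℕ} (hN : 2 ≤ N) (i : Fin N) : finRotate N i ≠ i := by
  obtain ⟨n, rfl⟩ : ∃ n, N = n + 2 := ⟨N - 2, by omega⟩
  rw [finRotate_apply]
  simp

theorem toLp_eq_zero_iff_ae {S : Set Plane} {f : Plane → ℂ} (hf : MemLp f 2 (volume.restrict S)) :
    hf.toLp f = 0 ↔ f =ᵐ[volume.restrict S] 0 := by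
  rw [Lp.eq_zero_iff_ae_eq_zero]
  exact ⟨fun h => hf.coeFn_toLp.symm.trans h, fun h => hf.coeFn_toLp.trans h⟩

theorem pairing_toLp {S : Set Plane} {f g : Plane → ℂ} (hf : MemLp f 2 (volume.restrict S))
    (hg : MemLp g 2 (volume.restrict S)) : pairing S f g = inner ℂ (hg.toLp g) (hf.toLp f) := by
  rw [L2.inner_def, pairing]
  refine integral_congr_ae ?_
  filter_upwards [hf.coeFn_toLp, hg.coeFn_toLp] with x h1 h2
  rw [h1, h2, RCLike.inner_apply]

/-! ### The three resonance conditions in block form -/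

section Translation

variable {N : ℕ} {D : Fin N → Set Plane} {c d R : ℝ} {p : KernelTail}
  {Op : ℂ → Set Plane → (Plane → ℂ) → Plane → ℂ} {κ : ℂ}

theorem pairOperator_toLp_ae_eq (hOp : Realizes p Op) (hκ : κ ∈ Complex.slitPlane)
    (hD : IsDilute c d R D) (hR : 0 < R) (i j : Fin N) {u : Plane → ℂ}
    (hu : MemLp u 2 (volume.restrict (D j))) :
    pairOperator p D κ i j (hu.toLp u) =ᵐ[volume.restrict (D i)] Op κ (D j) u := by
  filter_upwards [hD.isKernelOperator hR p κ i j (hu.toLp u)] with x hx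
  rw [hx, hOp κ hκ (D j) (hD.isBounded j) (hD.isOpen j).measurableSet u hu]
  refine integral_congr_ae ?_
  filter_upwards [hu.coeFn_toLp] with y hy
  rw [hy]

variable [∀ i, IsFiniteMeasure (volume.restrict (D i))]

/-- As `z` is the inverse of `strength * operatorScale`, multiplying the system by `z` replaces the
operators by the scaled blocks. -/
theorem isSystemResonance_iff (hOp : Realizes p Op) (hD : IsDilute c d R D) (hR : 0 < R)
    (hρ : 0 < sizeParam D) (hs : operatorScale D ≠ 0) {m : Material} {k δ : ℝ} {ω z : ℂ}
    (hκ : scaledWavenumber m δ ω ∈ Complex.slitPlane)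
    (hz : z * (strength m k δ ω * operatorScale D) = 1) :
    IsSystemResonance Op Op m k δ D ω ↔ ω ∈ Complex.slitPlane ∧ ω ∉ materialPoles m k ∧
      ∃ u : ∀ i, Lp ℂ 2 (volume.restrict (D i)), u ≠ 0 ∧ ∀ i, z • u i =
        ∑ j, blockMap (constVectors D) (relSize D)
          (remainderOperator p D (scaledWavenumber m δ ω)) i j (u j) := by
  set κ := scaledWavenumber m δ ω with hκdef
  set s := strength m k δ ω with hsdef
  have hz0 : z ≠ 0 := left_ne_zero_of_mul_eq_one hz
  have key : ∀ (u : Fin N → Plane → ℂ) (hu : ∀ i, MemLp (u i) 2 (volume.restrict (D i)))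
      (i : Fin N), (∀ᵐ x ∂(volume.restrict (D i)),
        u i x - s * Op κ (D i) (u i) x - s * ∑ j ∈ Finset.univ.erase i, Op κ (D j) (u j) x = 0) ↔
      z • (hu i).toLp (u i) = ∑ j, blockMap (constVectors D) (relSize D)
          (remainderOperator p D κ) i j ((hu j).toLp (u j)) := by
    intro u hu i
    have h1 : z • (hu i).toLp (u i) = ∑ j, blockMap (constVectors D) (relSize D)
          (remainderOperator p D κ) i j ((hu j).toLp (u j)) ↔
        (hu i).toLp (u i) = s • ∑ j, pairOperator p D κ i j ((hu j).toLp (u j)) := by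
      simp_rw [← scale_smul_blockMap hρ hs p κ i]
      rw [← Finset.smul_sum, smul_smul]
      constructor
      · intro h
        rw [← h, smul_smul, mul_comm, hz, one_smul]
      · intro h
        rw [h, smul_smul, hz, one_smul]
    rw [h1, Lp.ext_iff]
    refine eventually_congr ?_
    have h2 : ∀ᵐ x ∂(volume.restrict (D i)), ∀ j ∈ (Finset.univ : Finset (Fin N)),
        pairOperator p D κ i j ((hu j).toLp (u j)) x = Op κ (D j) (u j) x :=
      (Finset.eventually_all _).2 fun j _ => pairOperator_toLp_ae_eq hOp hκ hD hR i j (hu j)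
    filter_upwards [h2, (hu i).coeFn_toLp,
      Lp.coeFn_smul s (∑ j, pairOperator p D κ i j ((hu j).toLp (u j))),
      Lp.coeFn_fun_finsetSum Finset.univ fun j => pairOperator p D κ i j ((hu j).toLp (u j))]
      with x h2 h3 h4 h5
    rw [h3, h4, Pi.smul_apply, h5, Finset.sum_congr rfl h2, smul_eq_mul,
      ← Finset.add_sum_erase _ _ (Finset.mem_univ i), sub_sub, ← mul_add, sub_eq_zero]
  rw [IsSystemResonance]
  refine and_congr_right fun _ => and_congr_right fun _ => ⟨?_, ?_⟩
  · rintro ⟨u, hu, ⟨i, hi⟩, h⟩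
    refine ⟨fun i => (hu i).toLp (u i), fun h0 => hi ?_, fun i => (key u hu i).1 (h i)⟩
    exact (toLp_eq_zero_iff_ae _).1 (congrFun h0 i)
  · rintro ⟨u, hu0, h⟩
    refine ⟨fun i => u i, fun i => Lp.memLp (u i), ?_, fun i => ?_⟩
    · obtain ⟨i, hi⟩ := Function.ne_iff.1 hu0
      exact ⟨i, fun h0 => hi ((Lp.eq_zero_iff_ae_eq_zero).2 h0)⟩
    · refine (key (fun i => u i) (fun i => Lp.memLp (u i)) i).2 ?_
      simpa only [Lp.toLp_coeFn] using h i

variable (hκ : κ ∈ Complex.slitPlane) (hD : IsDilute c d R D) (hc : 0 < c) (hR : 0 < R)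
  (hρ : 0 < sizeParam D) (hs : 0 < operatorScale D)
  (hrem : ∀ i, ‖scaledRemainder (relSize D) (remainderOperator expandedTail D κ) i‖ ≤ 1 / 16)
include hD hc hρ

omit [∀ i, IsFiniteMeasure (volume.restrict (D i))] in
theorem relSize_pos (i : Fin N) : 0 < relSize D i :=
  (Real.sqrt_pos.2 hc).trans_le (le_relSize hD hρ i)

theorem norm_constVectors (i : Fin N) : ‖constVectors D i‖ = 1 :=
  norm_constVector (hD.area_pos hc hρ i)

omit hc in
include hκ hR hs in
theorem opM_eigen_iff (i : Fin N) {ν : ℂ} {ψ : Plane → ℂ}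
    (hψ : MemLp ψ 2 (volume.restrict (D i))) :
    (∀ᵐ x ∂(volume.restrict (D i)), opM κ (D i) ψ x = ν * ψ x) ↔
      blockMap (constVectors D) (relSize D) (remainderOperator expandedTail D κ) i i (hψ.toLp ψ) =
        ((operatorScale D : ℂ)⁻¹ * ν) • hψ.toLp ψ := by
  have hs' : (operatorScale D : ℂ) ≠ 0 := by exact_mod_cast hs.ne'
  have h1 : blockMap (constVectors D) (relSize D) (remainderOperator expandedTail D κ) i i
      (hψ.toLp ψ) = ((operatorScale D : ℂ)⁻¹ * ν) • hψ.toLp ψ ↔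
      pairOperator expandedTail D κ i i (hψ.toLp ψ) = ν • hψ.toLp ψ := by
    rw [← scale_smul_blockMap hρ hs.ne' expandedTail κ i i]
    constructor
    · intro h
      rw [h, smul_smul, mul_inv_cancel_left₀ hs']
    · intro h
      rw [mul_smul, ← h, smul_smul, inv_mul_cancel₀ hs', one_smul]
  rw [h1, Lp.ext_iff]
  refine eventually_congr ?_
  filter_upwards [pairOperator_toLp_ae_eq realizes_opM hκ hD hR i i hψ, hψ.coeFn_toLp,
    Lp.coeFn_smul ν (hψ.toLp ψ)] with x h2 h3 h4
  rw [h2, h4, Pi.smul_apply, h3, smul_eq_mul]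

include hκ hR hs hrem in
/-- The principal eigenpairs, up to a phase, are the dominant eigenpairs of the blocks. -/
theorem isPrincipalEigenpair_iff (i : Fin N) (ν : ℂ) (φ : Plane → ℂ) :
    IsPrincipalEigenpair κ (D i) ν φ ↔
      ν = operatorScale D * blockValue (constVectors D) (relSize D)
        (remainderOperator expandedTail D κ) i ∧
      ∃ a : ℂ, ‖a‖ = 1 ∧ φ =ᵐ[volume.restrict (D i)] ⇑(a • unitVector (constVectors D) (relSize D)
        (remainderOperator expandedTail D κ) i) := by
  set e := constVectors D with hedef
  set r := relSize D with hrdef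
  set S := remainderOperator expandedTail D κ with hSdef
  have he : ∀ i, ‖e i‖ = 1 := norm_constVectors hD hc hρ
  have ha : ∀ i, 0 < r i := relSize_pos hD hc hρ
  have hs' : (operatorScale D : ℂ) ≠ 0 := by exact_mod_cast hs.ne'
  have hsn : ‖(operatorScale D : ℂ)‖ = operatorScale D := by
    rw [Complex.norm_real, Real.norm_of_nonneg hs.le]
  have hV := norm_unitVector he hrem i
  have hsmul : ∀ (a : ℂ) (u : Lp ℂ 2 (volume.restrict (D i))),
      blockMap e r S i i (a • u) = a • blockMap e r S i i u := by
    intro a u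
    simp only [blockMap, inner_smul_right, map_smul, smul_add, smul_smul]
    ring_nf
  -- the dominant eigenpair bounds all others
  have hdom : ∀ (ν' : ℂ) (ψ : Plane → ℂ) (hψ : MemLp ψ 2 (volume.restrict (D i))),
      ¬ ψ =ᵐ[volume.restrict (D i)] 0 →
      (∀ᵐ x ∂(volume.restrict (D i)), opM κ (D i) ψ x = ν' * ψ x) →
      r i ^ 2 ≤ ‖(operatorScale D : ℂ)⁻¹ * ν'‖ →
        (operatorScale D : ℂ)⁻¹ * ν' = blockValue e r S i ∧
          ∃ a : ℂ, hψ.toLp ψ = a • unitVector e r S i := by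
    intro ν' ψ hψ hψ0 hψe hlow
    exact eq_blockValue_of_eigenvector he ha hrem hlow
      (fun h => hψ0 ((toLp_eq_zero_iff_ae _).1 h))
      ((opM_eigen_iff hκ hD hR hρ hs i hψ).1 hψe)
  constructor
  · rintro ⟨hφ, hφ1, hφe, hmax⟩
    have hΦ1 : ‖hφ.toLp φ‖ = 1 := by
      have h2 := inner_self_eq_norm_sq (𝕜 := ℂ) (hφ.toLp φ)
      rw [← pairing_toLp hφ hφ, hφ1, RCLike.one_re] at h2
      exact (pow_eq_one_iff_of_nonneg (norm_nonneg _) two_ne_zero).1 h2.symm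
    have hφ0 : ¬ φ =ᵐ[volume.restrict (D i)] 0 := by
      intro h0
      rw [(toLp_eq_zero_iff_ae hφ).2 h0, norm_zero] at hΦ1
      exact zero_ne_one hΦ1
    have hUe : ∀ᵐ x ∂(volume.restrict (D i)), opM κ (D i) (unitVector e r S i) x =
        (operatorScale D * blockValue e r S i) * unitVector e r S i x := by
      rw [opM_eigen_iff hκ hD hR hρ hs i (Lp.memLp _), Lp.toLp_coeFn, inv_mul_cancel_left₀ hs']
      exact blockMap_unitVector he ha hrem i
    have hν := hmax _ _ (Lp.memLp (unitVector e r S i)) (fun h0 => by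
      rw [(Lp.eq_zero_iff_ae_eq_zero).2 h0, norm_zero] at hV
      exact zero_ne_one hV) hUe
    -- Maximality against the dominant eigenvector forces `ν` above the threshold, and above it
    -- there is only the dominant eigenvalue.
    obtain ⟨h1, a, h2⟩ := hdom ν φ hφ hφ0 hφe (by
      rw [norm_mul, norm_inv, hsn, ← div_eq_inv_mul, le_div_iff₀ hs]
      rw [norm_mul, hsn] at hν
      have := le_norm_blockValue he ha hrem i
      nlinarith)
    refine ⟨by rw [← h1, mul_inv_cancel_left₀ hs'], a, ?_, ?_⟩
    · rw [h2, norm_smul, hV, mul_one] at hΦ1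
      exact hΦ1
    · rw [← h2]
      exact hφ.coeFn_toLp.symm
  · rintro ⟨rfl, a, ha1, hφ⟩
    have hmem : MemLp φ 2 (volume.restrict (D i)) :=
      (memLp_congr_ae hφ).2 (Lp.memLp _)
    have hΦ : hmem.toLp φ = a • unitVector e r S i := by
      rw [← Lp.toLp_coeFn (a • unitVector e r S i) (Lp.memLp _), MemLp.toLp_eq_toLp_iff]
      exact hφ
    refine ⟨hmem, ?_, ?_, ?_⟩
    · rw [pairing_toLp hmem hmem, hΦ, inner_self_eq_norm_sq_to_K, norm_smul, ha1, hV]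
      simp
    · rw [opM_eigen_iff hκ hD hR hρ hs i hmem, hΦ, inv_mul_cancel_left₀ hs', hsmul,
        blockMap_unitVector he ha hrem, smul_comm]
    · intro ν' ψ hψ hψ0 hψe
      by_contra! hcon
      have hb := le_norm_blockValue he ha hrem i
      rw [norm_mul, hsn] at hcon
      obtain ⟨h1, -⟩ := hdom ν' ψ hψ hψ0 hψe (by
        rw [norm_mul, norm_inv, hsn, ← div_eq_inv_mul, le_div_iff₀ hs]
        nlinarith)
      rw [← h1, norm_mul, norm_inv, hsn, mul_inv_cancel_left₀ hs.ne'] at hcon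
      exact lt_irrefl _ hcon

include hκ hR hs hrem in
theorem exists_isPrincipalEigenpair (i : Fin N) : ∃ ν φ, IsPrincipalEigenpair κ (D i) ν φ :=
  ⟨_, ⇑((1 : ℂ) • unitVector (constVectors D) (relSize D) (remainderOperator expandedTail D κ) i),
    (isPrincipalEigenpair_iff hκ hD hc hR hρ hs hrem i _ _).2
      ⟨rfl, 1, norm_one, EventuallyEq.rfl⟩⟩

include hκ hR hs hrem in
theorem IsPrincipalEigenpair.unique {i : Fin N} {ν ν' : ℂ} {φ φ' : Plane → ℂ}
    (h : IsPrincipalEigenpair κ (D i) ν φ) (h' : IsPrincipalEigenpair κ (D i) ν' φ') :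
    ν' = ν ∧ ∃ a : ℂ, ‖a‖ = 1 ∧ ∀ᵐ x ∂(volume.restrict (D i)), φ' x = a * φ x := by
  rw [isPrincipalEigenpair_iff hκ hD hc hR hρ hs hrem] at h h'
  obtain ⟨rfl, a, ha, hφ⟩ := h
  obtain ⟨rfl, a', ha', hφ'⟩ := h'
  have ha0 : a ≠ 0 := norm_pos_iff.1 (by rw [ha]; exact one_pos)
  refine ⟨rfl, a' * a⁻¹, by rw [norm_mul, norm_inv, ha, ha']; simp, ?_⟩
  filter_upwards [hφ, hφ', Lp.coeFn_smul a (unitVector (constVectors D) (relSize D)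
      (remainderOperator expandedTail D κ) i), Lp.coeFn_smul a' (unitVector (constVectors D)
      (relSize D) (remainderOperator expandedTail D κ) i)] with x h1 h2 h3 h4
  rw [h1, h2, h3, h4, Pi.smul_apply, Pi.smul_apply, smul_eq_mul, smul_eq_mul]
  field_simp

omit hc in
include hκ hR hs in
theorem pairing_opN_eq {i j : Fin N} (hij : i ≠ j) {φi φj : Plane → ℂ} {ai aj : ℂ}
    (hφi : φi =ᵐ[volume.restrict (D i)] ⇑(ai • unitVector (constVectors D) (relSize D)
        (remainderOperator expandedTail D κ) i))
    (hφj : φj =ᵐ[volume.restrict (D j)] ⇑(aj • unitVector (constVectors D) (relSize D)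
        (remainderOperator expandedTail D κ) j)) :
    pairing (D i) (opN κ (D j) φj) φi = starRingEnd ℂ ai * aj * (operatorScale D *
      interactionMatrix (constVectors D) (relSize D) (remainderOperator expandedTail D κ) i j) := by
  have hi : MemLp φi 2 (volume.restrict (D i)) := (memLp_congr_ae hφi).2 (Lp.memLp _)
  have hj : MemLp φj 2 (volume.restrict (D j)) := (memLp_congr_ae hφj).2 (Lp.memLp _)
  have hΦi := (MemLp.toLp_eq_toLp_iff hi (Lp.memLp _)).2 hφi
  have hΦj := (MemLp.toLp_eq_toLp_iff hj (Lp.memLp _)).2 hφj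
  rw [Lp.toLp_coeFn] at hΦi hΦj
  have hop := pairOperator_toLp_ae_eq realizes_opM hκ hD hR i j hj
  have hN : MemLp (opN κ (D j) φj) 2 (volume.restrict (D i)) :=
    (memLp_congr_ae hop).1 (Lp.memLp _)
  have hΨ : hN.toLp _ = pairOperator expandedTail D κ i j (hj.toLp φj) := by
    rw [← Lp.toLp_coeFn (pairOperator expandedTail D κ i j (hj.toLp φj)) (Lp.memLp _),
      MemLp.toLp_eq_toLp_iff]
    exact hop.symm
  rw [pairing_toLp hN hi, hΨ, hΦi, hΦj, interactionMatrix, Matrix.of_apply, if_neg hij,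
    map_smul, ← scale_smul_blockMap hρ hs.ne', inner_smul_left, inner_smul_right,
    inner_smul_right, mul_assoc]

/-- The determinant condition in terms of the interaction matrix. -/
theorem isDetZero_iff (hN : 2 ≤ N) {m : Material} {k δ : ℝ} {ω z : ℂ}
    (hκ : scaledWavenumber m δ ω ∈ Complex.slitPlane) (hR : 0 < R) (hs : 0 < operatorScale D)
    (hrem : ∀ i, ‖scaledRemainder (relSize D) (remainderOperator expandedTail D
      (scaledWavenumber m δ ω)) i‖ ≤ 1 / 16)
    (hne : ∀ i j, i ≠ j → interactionMatrix (constVectors D) (relSize D)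
      (remainderOperator expandedTail D (scaledWavenumber m δ ω)) i j ≠ 0)
    (hz : z * (strength m k δ ω * operatorScale D) = 1) :
    IsDetZero m k δ D ω ↔ ω ∈ Complex.slitPlane ∧ ω ∉ materialPoles m k ∧
      (∀ i, z ≠ blockValue (constVectors D) (relSize D)
        (remainderOperator expandedTail D (scaledWavenumber m δ ω)) i) ∧
      (z • (1 : Matrix (Fin N) (Fin N) ℂ) - interactionMatrix (constVectors D) (relSize D)
        (remainderOperator expandedTail D (scaledWavenumber m δ ω))).det = 0 := by
  set κ := scaledWavenumber m δ ω with hκdef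
  set s := strength m k δ ω with hsdef
  set e := constVectors D with hedef
  set r := relSize D with hrdef
  set S := remainderOperator expandedTail D κ with hSdef
  have hz0 : z ≠ 0 := left_ne_zero_of_mul_eq_one hz
  have hs' : (operatorScale D : ℂ) ≠ 0 := by exact_mod_cast hs.ne'
  have h1s : ∀ i, 1 - s * (operatorScale D * blockValue e r S i) =
      (z - blockValue e r S i) * (s * operatorScale D) := by
    intro i
    rw [sub_mul, hz]
    ring
  have hs0 : s ≠ 0 := by
    intro h
    rw [h, zero_mul, mul_zero] at hz
    exact zero_ne_one hz
  have hcond : ∀ i, 1 - s * (operatorScale D * blockValue e r S i) ≠ 0 ↔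
      z ≠ blockValue e r S i := by
    intro i
    rw [h1s, ne_eq, mul_eq_zero, not_or, sub_eq_zero]
    exact and_iff_left (mul_ne_zero hs0 hs')
  have hdet : ∀ (φ : Fin N → Plane → ℂ) (a : Fin N → ℂ), (∀ i, ‖a i‖ = 1) →
      (∀ i, φ i =ᵐ[volume.restrict (D i)] ⇑(a i • unitVector e r S i)) →
      (∀ i, z ≠ blockValue e r S i) →
      ((matL m k δ D ω (fun i => operatorScale D * blockValue e r S i) φ).det = 0 ↔
        (z • (1 : Matrix (Fin N) (Fin N) ℂ) - interactionMatrix e r S).det = 0) := by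
    intro φ a ha hφ hzb
    have ha0 : ∀ i, a i ≠ 0 := fun i => norm_pos_iff.1 (by rw [ha]; exact one_pos)
    have hconj : ∀ i, starRingEnd ℂ (a i) * a i = 1 := fun i => by
      rw [Complex.conj_mul', ha]; simp
    have hn : ∀ i j, i ≠ j → pairing (D i) (opN κ (D j) (φ j)) (φ i) =
        starRingEnd ℂ (a i) * a j * (operatorScale D * interactionMatrix e r S i j) :=
      fun i j hij => pairing_opN_eq hκ hD hR hρ hs hij (hφ i) (hφ j)
    set g : Fin N → ℂ := fun i =>
      pairing (D (finRotate N i)) (opN κ (D i) (φ i)) (φ (finRotate N i)) with hg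
    -- Each row of `matL` carries the factor `g i`. It is an off-diagonal interaction because
    -- `finRotate N i ≠ i` for `N ≥ 2`, so it can be divided out.
    have hg0 : ∀ i, g i ≠ 0 := by
      intro i
      have hr := finRotate_ne_self hN i
      simp only [hg]
      rw [hn _ _ hr]
      have := hne _ _ hr
      have := left_ne_zero_of_mul_eq_one (hconj (finRotate N i))
      have := ha0 i
      positivity
    -- Row `i` of `matL` is scaled so that its diagonal entry becomes `z - v_i`, with `v_i` the
    -- block value; since `1 - s ν_i = (z - v_i) s h`, this cancels `𝓑_i`. The phases of the
    -- eigenvectors enter as a conjugation by `diag(a_i)`.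
    have hM : z • (1 : Matrix (Fin N) (Fin N) ℂ) - interactionMatrix e r S =
        Matrix.diagonal (fun i => (z - blockValue e r S i) * a i / g i) *
          matL m k δ D ω (fun i => operatorScale D * blockValue e r S i) φ *
          Matrix.diagonal (fun i => (a i)⁻¹) := by
      ext i j
      rw [Matrix.mul_diagonal, Matrix.diagonal_mul, matL, Matrix.of_apply, Matrix.sub_apply,
        Matrix.smul_apply, Matrix.one_apply]
      have hgi := hg0 i
      have hai := ha0 i
      have haj := ha0 j
      by_cases hij : i = j
      · subst hij
        rw [if_pos rfl, if_pos rfl, smul_eq_mul, mul_one]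
        simp only [interactionMatrix, Matrix.of_apply, if_true]
        change _ = (z - blockValue e r S i) * a i / g i * g i * (a i)⁻¹
        field_simp
      · rw [if_neg hij, if_neg hij, ← hκdef, hn i j hij, bFactor, ← hsdef, h1s]
        have h2 : z - blockValue e r S i ≠ 0 := sub_ne_zero.2 (hzb i)
        change _ = (z - blockValue e r S i) * a i / g i * (-_ * _ * g i) * (a j)⁻¹
        have h3 : starRingEnd ℂ (a i) = (a i)⁻¹ := eq_inv_of_mul_eq_one_left (hconj i)
        rw [h3, smul_zero, zero_sub]
        field_simp
    rw [hM, Matrix.det_mul, Matrix.det_mul, Matrix.det_diagonal, Matrix.det_diagonal]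
    have hp1 : ∏ i, (z - blockValue e r S i) * a i / g i ≠ 0 :=
      Finset.prod_ne_zero_iff.2 fun i _ =>
        div_ne_zero (mul_ne_zero (sub_ne_zero.2 (hzb i)) (ha0 i)) (hg0 i)
    have hp2 : ∏ i, (a i)⁻¹ ≠ 0 := Finset.prod_ne_zero_iff.2 fun i _ => inv_ne_zero (ha0 i)
    rw [mul_eq_zero, mul_eq_zero, or_iff_left hp2, or_iff_right hp1]
  rw [IsDetZero]
  refine and_congr_right fun _ => and_congr_right fun _ => ⟨?_, ?_⟩
  · rintro ⟨ν, φ, hpair, hν, hL⟩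
    have h1 := fun i => (isPrincipalEigenpair_iff hκ hD hc hR hρ hs hrem i (ν i) (φ i)).1 (hpair i)
    have h2 : ν = fun i => operatorScale D * blockValue e r S i := funext fun i => (h1 i).1
    choose a ha hφ using fun i => (h1 i).2
    subst h2
    have h3 := fun i => (hcond i).1 (hν i)
    exact ⟨h3, (hdet φ a ha hφ h3).1 hL⟩
  · rintro ⟨hzb, h0⟩
    refine ⟨fun i => operatorScale D * blockValue e r S i,
      fun i => ⇑((1 : ℂ) • unitVector e r S i), fun i => ?_, fun i => (hcond i).2 (hzb i),
      (hdet _ (fun _ => 1) (fun _ => norm_one) (fun _ => EventuallyEq.rfl) hzb).2 h0⟩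
    exact (isPrincipalEigenpair_iff hκ hD hc hR hρ hs hrem i _ _).2
      ⟨rfl, 1, norm_one, EventuallyEq.rfl⟩

end Translation

/-! ### Uniform smallness on compact sets of frequencies -/

section Parameters

/-- Comparability of `ρ` and `δ` gives `|log δ - log ρ| ≤ |log κ₀|`; the other terms do not involve
the scale. -/
theorem norm_logGammaHat_sub_log_le {m : Material} {δ ρ κ₀ L : ℝ} {ω : ℂ} (hδ : 0 < δ)
    (hρ : 0 < ρ) (hκ₀ : 0 < κ₀) (h1 : ρ ≤ κ₀ * δ) (h2 : δ ≤ κ₀ * ρ) (hω : ω ≠ 0)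
    (hL : ‖Complex.log (m.mu0 * m.eps0 * ω)‖ ≤ L) :
    ‖logGammaHat (scaledWavenumber m δ ω) - Real.log ρ‖ ≤
      |Real.log κ₀| + L + ‖Complex.log gammaHat‖ := by
  have hm : (m.mu0 * m.eps0 * ω : ℂ) ≠ 0 := by
    have h3 : (m.mu0 : ℂ) ≠ 0 := by exact_mod_cast m.mu0_pos.ne'
    have h4 : (m.eps0 : ℂ) ≠ 0 := by exact_mod_cast m.eps0_pos.ne'
    positivity
  have e1 : logGammaHat (scaledWavenumber m δ ω) - Real.log ρ =
      ((Real.log δ - Real.log ρ : ℝ) : ℂ) + Complex.log (m.mu0 * m.eps0 * ω) +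
        Complex.log gammaHat := by
    rw [logGammaHat, scaledWavenumber, Complex.log_ofReal_mul hδ hm]
    push_cast
    ring
  have h3 : ‖((Real.log δ - Real.log ρ : ℝ) : ℂ)‖ ≤ |Real.log κ₀| := by
    have h4 := Real.log_le_log hρ h1
    have h5 := Real.log_le_log hδ h2
    rw [Real.log_mul hκ₀.ne' hδ.ne'] at h4
    rw [Real.log_mul hκ₀.ne' hρ.ne'] at h5
    rw [Complex.norm_real, Real.norm_eq_abs]
    refine (abs_le.2 ⟨?_, ?_⟩ : _ ≤ Real.log κ₀).trans (le_abs_self _) <;> linarith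
  rw [e1]
  exact (norm_add_le _ _).trans (add_le_add ((norm_add_le _ _).trans (add_le_add h3 hL)) le_rfl)

theorem scaledWavenumber_mem_slitPlane (m : Material) {δ : ℝ} (hδ : 0 < δ) {ω : ℂ}
    (hω : ω ∈ Complex.slitPlane) : scaledWavenumber m δ ω ∈ Complex.slitPlane := by
  have h1 : scaledWavenumber m δ ω = ((δ * (m.mu0 * m.eps0) : ℝ) : ℂ) * ω := by
    rw [scaledWavenumber]
    push_cast
    ring
  have h2 : 0 < δ * (m.mu0 * m.eps0) := mul_pos hδ (mul_pos m.mu0_pos m.eps0_pos)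
  rw [h1, Complex.mem_slitPlane_iff, Complex.re_ofReal_mul, Complex.im_ofReal_mul]
  rcases Complex.mem_slitPlane_iff.1 hω with h | h
  · exact Or.inl (mul_pos h2 h)
  · exact Or.inr (mul_ne_zero h2.ne' h)

theorem continuous_scaledWavenumber (m : Material) (δ : ℝ) :
    Continuous (scaledWavenumber m δ) := by
  unfold scaledWavenumber
  fun_prop

theorem norm_scaledWavenumber (m : Material) {δ : ℝ} (hδ : 0 < δ) (ω : ℂ) :
    ‖scaledWavenumber m δ ω‖ = δ * (m.mu0 * m.eps0 * ‖ω‖) := by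
  rw [scaledWavenumber, norm_mul, norm_mul, norm_mul, Complex.norm_real, Complex.norm_real,
    Complex.norm_real, Real.norm_of_nonneg hδ.le, Real.norm_of_nonneg m.mu0_pos.le,
    Real.norm_of_nonneg m.eps0_pos.le]

theorem eventually_mul_le (K : ℝ) {y : ℝ} (hy : 0 < y) : ∀ᶠ x in 𝓝[>] (0 : ℝ), K * x ≤ y := by
  have h : Tendsto (fun x : ℝ => K * x) (𝓝[>] 0) (𝓝 (K * 0)) :=
    ((continuous_const.mul continuous_id).tendsto 0).mono_left nhdsWithin_le_nhds
  rw [mul_zero] at h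
  exact h.eventually_le_const hy

theorem eventually_div_neg_log_le (K : ℝ) {y : ℝ} (hy : 0 < y) :
    ∀ᶠ x in 𝓝[>] (0 : ℝ), K / -Real.log x ≤ y := by
  have h1 : Tendsto (fun x : ℝ => -Real.log x) (𝓝[>] 0) atTop :=
    tendsto_neg_atBot_atTop.comp Real.tendsto_log_nhdsGT_zero
  exact (h1.const_div_atTop K).eventually_le_const hy

/-- For small particles, the scaled remainders are uniformly small on compact sets of
frequencies. -/
theorem eventually_norm_remainderOperator_le (p : KernelTail) (m : Material) {c d R κ₀ η : ℝ}
    (hc : 0 < c) (hd : 0 < d) (hR : 0 < R) (hκ₀ : 0 < κ₀) (hη : 0 < η) {K : Set ℂ}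
    (hK : IsCompact K) (hKs : K ⊆ Complex.slitPlane) :
    ∀ᶠ ρ in 𝓝[>] (0 : ℝ), ∀ (N : ℕ) (D : Fin N → Set Plane) (δ : ℝ)
      [∀ i, IsFiniteMeasure (volume.restrict (D i))], sizeParam D = ρ → IsDilute c d R D → 0 < δ →
      ρ ≤ κ₀ * δ → δ ≤ κ₀ * ρ → ∀ ω ∈ K, ∀ i j,
        ‖remainderOperator p D (scaledWavenumber m δ ω) i j‖ ≤ η := by
  obtain ⟨κ₁, hκ₁, htail⟩ := p.exists_norm_tail_le (2 * R)
  have hcont : ContinuousOn (fun ω : ℂ => Complex.log (m.mu0 * m.eps0 * ω)) K := by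
    refine ContinuousOn.clog (by fun_prop) fun ω hω => ?_
    have := scaledWavenumber_mem_slitPlane m one_pos (hKs hω)
    simpa [scaledWavenumber] using this
  obtain ⟨L, hL⟩ := hK.exists_bound_of_continuousOn hcont
  obtain ⟨W, hW⟩ := hK.exists_bound_of_continuousOn (f := fun ω : ℂ => ω) continuousOn_id
  filter_upwards [self_mem_nhdsWithin, eventually_mul_le 1 (y := 1 / 2) (by norm_num),
    eventually_mul_le (κ₀ * (m.mu0 * m.eps0 * W)) hκ₁,
    eventually_div_neg_log_le (2 * Real.pi * (3 * √discArea) * (logConst + 3 * √discArea *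
      (|Real.log d| + |Real.log (2 * R)| + (|Real.log κ₀| + L + ‖Complex.log gammaHat‖) + 1))) hη]
    with ρ hρ hρ1 hρκ hρη
  intro N D δ _ hDρ hD hδ h1 h2 ω hω i j
  subst hDρ
  have hρ0 : 0 < sizeParam D := hρ
  have hωs := hKs hω
  refine (hD.norm_remainderOperator_le hc hd hR hρ0 (by linarith) p
    (norm_logGammaHat_sub_log_le hδ hρ0 hκ₀ h1 h2 (Complex.slitPlane_ne_zero hωs) (hL ω hω))
    (fun w hw => htail _ (scaledWavenumber_mem_slitPlane m hδ hωs) ?_ w hw) i j).trans hρη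
  rw [norm_scaledWavenumber m hδ]
  have hWω := hW ω hω
  have hm := mul_pos m.mu0_pos m.eps0_pos
  calc δ * (m.mu0 * m.eps0 * ‖ω‖) ≤ (κ₀ * sizeParam D) * (m.mu0 * m.eps0 * W) := by gcongr
    _ = κ₀ * (m.mu0 * m.eps0 * W) * sizeParam D := by ring
    _ ≤ κ₁ := hρκ

end Parameters

/-! ### The dispersion relation near its poles -/

section Poles

variable (m : Material) (k : ℝ)

theorem exists_dispersion_eq : ∃ p₁ p₂ : ℂ, ∀ ω, dispersion m k ω = -((ω - p₁) * (ω - p₂)) := by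
  obtain ⟨s, hs⟩ := IsAlgClosed.exists_pow_nat_eq
    (-(m.gamma : ℂ) ^ 2 + 4 * (m.beta + m.eta * (k : ℂ) ^ 2)) (n := 2) two_pos
  refine ⟨(-Complex.I * m.gamma + s) / 2, (-Complex.I * m.gamma - s) / 2, fun ω => ?_⟩
  rw [dispersion]
  linear_combination (-1 / 4 : ℂ) * hs + (m.gamma : ℂ) ^ 2 / 4 * Complex.I_sq

/-- The dispersion relation factors through the nearest pole. -/
theorem exists_nearest_pole : ∃ Δ > 0, ∀ ω : ℂ, ∃ y y' : ℂ,
    (∀ w, dispersion m k w = -((w - y) * (w - y'))) ∧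
    ‖ω - y‖ = Metric.infDist ω (materialPoles m k) ∧ ‖ω - y‖ ≤ ‖ω - y'‖ ∧
    (y = y' ∨ Δ ≤ ‖y - y'‖) := by
  obtain ⟨p₁, p₂, hp⟩ := exists_dispersion_eq m k
  have hP : materialPoles m k = {p₁, p₂} := by
    ext ω
    simp [materialPoles, hp, sub_eq_zero]
  have hfac : ∀ y ∈ materialPoles m k, ∃ y' ∈ materialPoles m k,
      (∀ w, dispersion m k w = -((w - y) * (w - y'))) ∧ ‖y - y'‖ = ‖p₁ - p₂‖ := by
    rw [hP]
    rintro y (rfl | rfl)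
    · exact ⟨p₂, by simp, hp, rfl⟩
    · exact ⟨p₁, by simp, fun w => by rw [hp]; ring, norm_sub_rev _ _⟩
  refine ⟨if p₁ = p₂ then 1 else ‖p₁ - p₂‖, ?_, fun ω => ?_⟩
  · split_ifs with h
    · exact one_pos
    · exact norm_pos_iff.2 (sub_ne_zero.2 h)
  · obtain ⟨y, hy, hyd⟩ := (hP ▸ (Set.toFinite {p₁, p₂}).isCompact :
      IsCompact (materialPoles m k)).exists_infDist_eq_dist (by rw [hP]; simp) ω
    obtain ⟨y', hy', hw, hyy⟩ := hfac y hy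
    refine ⟨y, y', hw, by rw [hyd, dist_eq_norm], ?_, ?_⟩
    · rw [← dist_eq_norm, ← hyd, ← dist_eq_norm]
      exact Metric.infDist_le_dist_of_mem hy'
    · split_ifs with h
      · left
        rw [h, sub_self, norm_zero, norm_eq_zero, sub_eq_zero] at hyy
        exact hyy
      · right
        exact hyy.ge

/-- Here `1 + t` and `1 + r t` are the relative changes of the distances to the two poles and `1 + ξ
t` that of the frequency; as `ξ` is as small as `t`, the denominator enters only at second order. -/
theorem norm_quotient_sub_affine_le {r ξ t : ℂ} {ε : ℝ} (hε : ε ≤ 1 / 4) (hr : ‖r‖ ≤ 1)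
    (hξ : ‖ξ‖ ≤ ε) (ht : ‖t‖ ≤ ε) :
    ‖(1 + t) * (1 + r * t) / (1 + ξ * t) ^ 2 - (1 + (1 + r) * t)‖ ≤ 5 * ε ^ 2 := by
  have hε0 : 0 ≤ ε := (norm_nonneg _).trans ht
  have hξt : ‖ξ * t‖ ≤ ε ^ 2 := by
    rw [norm_mul, sq]
    gcongr
  have hξt' : ‖ξ * t‖ ≤ 1 / 16 := hξt.trans (by nlinarith)
  have hden : 15 / 16 ≤ ‖1 + ξ * t‖ := by
    have := norm_sub_norm_le (1 : ℂ) (-(ξ * t))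
    rw [norm_one, norm_neg, sub_neg_eq_add] at this
    linarith
  have hne : (1 + ξ * t) ^ 2 ≠ 0 := pow_ne_zero _ (norm_pos_iff.1 (by linarith))
  have e1 : (1 + t) * (1 + r * t) / (1 + ξ * t) ^ 2 - (1 + (1 + r) * t) =
      (r * t ^ 2 - (1 + (1 + r) * t) * (2 * (ξ * t) + (ξ * t) ^ 2)) / (1 + ξ * t) ^ 2 := by
    rw [eq_div_iff hne, sub_mul, div_mul_cancel₀ _ hne]
    ring
  have hnum : ‖r * t ^ 2 - (1 + (1 + r) * t) * (2 * (ξ * t) + (ξ * t) ^ 2)‖ ≤ 41 / 10 * ε ^ 2 := by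
    have h1 : ‖r * t ^ 2‖ ≤ 1 * ε ^ 2 := by
      rw [norm_mul, norm_pow]
      gcongr
    have h2 : ‖1 + (1 + r) * t‖ ≤ 1 + (1 + 1) * (1 / 4) := by
      refine (norm_add_le _ _).trans ?_
      rw [norm_one, norm_mul]
      gcongr
      · exact (norm_add_le _ _).trans (by rw [norm_one]; gcongr)
      · exact ht.trans hε
    have h3 : ‖2 * (ξ * t) + (ξ * t) ^ 2‖ ≤ 2 * ε ^ 2 + 1 / 16 * ε ^ 2 := by
      refine (norm_add_le _ _).trans ?_
      rw [norm_mul, norm_pow, sq ‖ξ * t‖, Complex.norm_ofNat]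
      gcongr
    calc _ ≤ 1 * ε ^ 2 + (1 + (1 + 1) * (1 / 4)) * (2 * ε ^ 2 + 1 / 16 * ε ^ 2) := by
          refine (norm_sub_le _ _).trans ?_
          rw [norm_mul (1 + (1 + r) * t)]
          gcongr
      _ ≤ _ := by nlinarith [sq_nonneg ε]
  rw [e1, norm_div, norm_pow, div_le_iff₀ (by positivity)]
  refine hnum.trans ?_
  have : (15 / 16 : ℝ) ^ 2 ≤ ‖1 + ξ * t‖ ^ 2 := by gcongr
  nlinarith [sq_nonneg ε]

/-- Near a frequency close to the poles, the function `dispersion ω / ω ^ 2` is nearly affine at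
the scale of the distance to the poles. -/
theorem exists_local_model {ε M w₀ r₀ : ℝ} (hε : 0 < ε) (hM : 1 ≤ M) (hεM : 10 * M * ε ≤ 1)
    (hw₀ : 0 < w₀) (hr₀ : 0 < r₀) :
    ∃ q₀ > 0, ∀ ω : ℂ, w₀ ≤ ‖ω‖ → ω ∉ materialPoles m k → ‖dispersion m k ω‖ ≤ q₀ →
      ∃ q b : ℂ, ‖q‖ = Metric.infDist ω (materialPoles m k) ∧ ‖q‖ ≤ r₀ ∧ 1 / 2 ≤ ‖b‖ ∧ ‖b‖ ≤ 2 ∧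
        ∀ t ∈ Metric.closedBall (0 : ℂ) ε, ω + q * t ≠ 0 ∧ dispersion m k (ω + q * t) ≠ 0 ∧
          ‖dispersion m k (ω + q * t) / (ω + q * t) ^ 2 - dispersion m k ω / ω ^ 2 * (1 + b * t)‖ ≤
            ‖dispersion m k ω / ω ^ 2‖ * (‖b‖ * ε / M) := by
  obtain ⟨Δ, hΔ, hpole⟩ := exists_nearest_pole m k
  -- `Δ / 3` makes the second pole at least twice as far as the first when they differ, `ε w₀` makes
  -- `q / ω` at most `ε`, and `r₀` bounds the displacement scale.
  set s : ℝ := min (min (Δ / 3) (ε * w₀)) r₀ with hs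
  have hs0 : 0 < s := by positivity
  have hε4 : ε ≤ 1 / 10 := by nlinarith
  refine ⟨s ^ 2, by positivity, fun ω hω hωP hdisp => ?_⟩
  obtain ⟨y, y', hfac, hdist, hle, hyy⟩ := hpole ω
  have hω0 : ω ≠ 0 := norm_pos_iff.1 (hw₀.trans_le hω)
  have hdne : dispersion m k ω ≠ 0 := hωP
  have hy0 : ω - y ≠ 0 := fun h => hdne (by rw [hfac, h]; simp)
  have hy0' : ω - y' ≠ 0 := fun h => hdne (by rw [hfac, h]; simp)
  have hq : ‖ω - y‖ ≤ s := by
    rw [hfac, norm_neg, norm_mul] at hdisp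
    have : ‖ω - y‖ ^ 2 ≤ s ^ 2 := by
      refine le_trans ?_ hdisp
      rw [sq]
      gcongr
    exact (sq_le_sq₀ (norm_nonneg _) hs0.le).1 this
  set q := ω - y with hqdef
  set r := q / (ω - y') with hr
  have hq1 : ‖q‖ ≤ Δ / 3 := hq.trans ((min_le_left _ _).trans (min_le_left _ _))
  have hq2 : ‖q‖ ≤ ε * w₀ := hq.trans ((min_le_left _ _).trans (min_le_right _ _))
  have hr1 : ‖r‖ ≤ 1 := by
    rw [hr, norm_div]
    exact div_le_one_of_le₀ hle (norm_nonneg _)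
  -- The slope `1 + r` could vanish midway between two poles. Near a pole this is excluded: `r = 1`
  -- at a double pole and `‖r‖ ≤ 1/2` otherwise.
  have hb : 1 / 2 ≤ ‖1 + r‖ := by
    rcases hyy with h | h
    · rw [hr, ← h, ← hqdef, div_self hy0]
      norm_num
    · have h1 : 2 * ‖q‖ ≤ ‖ω - y'‖ := by
        have h2 : ‖y - y'‖ ≤ ‖ω - y'‖ + ‖q‖ := by
          have : y - y' = (ω - y') - q := by rw [hqdef]; ring
          rw [this]
          exact norm_sub_le _ _
        linarith
      have h3 : ‖r‖ ≤ 1 / 2 := by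
        rw [hr, norm_div, div_le_iff₀ (norm_pos_iff.2 hy0')]
        linarith
      have := norm_sub_norm_le (1 : ℂ) (-r)
      rw [norm_one, norm_neg, sub_neg_eq_add] at this
      linarith
  refine ⟨q, 1 + r, hdist, hq.trans (min_le_right _ _), hb, ?_, fun t ht => ?_⟩
  · refine (norm_add_le _ _).trans ?_
    rw [norm_one]
    linarith
  · have htε := mem_closedBall_zero_iff.1 ht
    set ξ := q / ω with hξdef
    have hξ : ‖ξ‖ ≤ ε := by
      rw [hξdef, norm_div, div_le_iff₀ (norm_pos_iff.2 hω0)]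
      refine hq2.trans ?_
      gcongr
    have hone : ∀ x : ℂ, ‖x‖ ≤ 1 / 10 → 1 + x ≠ 0 := by
      intro x hx h
      rw [add_eq_zero_iff_neg_eq] at h
      rw [← h, norm_neg, norm_one] at hx
      norm_num at hx
    have e0 : ω + q * t = ω * (1 + ξ * t) := by rw [hξdef]; field_simp
    have e1 : ω + q * t - y = q * (1 + t) := by rw [hqdef]; ring
    have e2 : ω + q * t - y' = (ω - y') * (1 + r * t) := by
      rw [hr]
      field_simp
      ring
    have n0 : 1 + ξ * t ≠ 0 := hone _ (by rw [norm_mul]; nlinarith [norm_nonneg ξ, norm_nonneg t])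
    have n1 : 1 + t ≠ 0 := hone _ (by linarith)
    have n2 : 1 + r * t ≠ 0 := hone _ (by rw [norm_mul]; nlinarith [norm_nonneg r, norm_nonneg t])
    have hdt : dispersion m k (ω + q * t) = dispersion m k ω * ((1 + t) * (1 + r * t)) := by
      rw [hfac, hfac ω, e1, e2]
      ring
    refine ⟨by rw [e0]; exact mul_ne_zero hω0 n0, by
      rw [hdt]; exact mul_ne_zero hdne (mul_ne_zero n1 n2), ?_⟩
    have e3 : dispersion m k (ω + q * t) / (ω + q * t) ^ 2 -
        dispersion m k ω / ω ^ 2 * (1 + (1 + r) * t) = dispersion m k ω / ω ^ 2 *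
          ((1 + t) * (1 + r * t) / (1 + ξ * t) ^ 2 - (1 + (1 + r) * t)) := by
      rw [hdt, e0]
      field_simp
    rw [e3, norm_mul]
    have h1 := norm_quotient_sub_affine_le (by linarith) hr1 hξ htε
    refine mul_le_mul_of_nonneg_left (h1.trans ?_) (norm_nonneg _)
    rw [le_div_iff₀ (by linarith)]
    nlinarith

end Poles

/-! ### Transfer of zeros at the scale of the distance to the poles -/

section SpectralParameter

/-- The spectral parameter of the block system with scale `s`, the inverse of
`strength m k δ ω * s`. -/
noncomputable def spectralParameter (m : Material) (k δ s : ℝ) (ω : ℂ) : ℂ :=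
  dispersion m k ω / ω ^ 2 / ((δ ^ 2 * (m.mu0 * m.alpha) * s : ℝ) : ℂ)

variable {m : Material} {k δ s : ℝ}

theorem spectralParameter_mul_strength (hδ : 0 < δ) (hs : 0 < s) {ω : ℂ} (hω : ω ≠ 0)
    (hP : ω ∉ materialPoles m k) :
    spectralParameter m k δ s ω * (strength m k δ ω * s) = 1 := by
  have hp : dispersion m k ω ≠ 0 := hP
  have h1 : (δ : ℂ) ≠ 0 := by exact_mod_cast hδ.ne'
  have h2 : (s : ℂ) ≠ 0 := by exact_mod_cast hs.ne'
  have h3 : (m.mu0 : ℂ) ≠ 0 := by exact_mod_cast m.mu0_pos.ne'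
  have h4 : (m.alpha : ℂ) ≠ 0 := by exact_mod_cast m.alpha_pos.ne'
  rw [spectralParameter, strength, contrast, permittivity]
  push_cast
  field_simp
  ring

theorem continuousOn_spectralParameter : ContinuousOn (spectralParameter m k δ s) {0}ᶜ := by
  have h : Continuous (dispersion m k) := by
    unfold dispersion
    fun_prop
  exact (h.continuousOn.div (by fun_prop) fun ω hω => pow_ne_zero 2 hω).div_const _

/-- Zeros of a determinant `det (z(ω) - B₀)` persist, at the scale of the distance to the poles,
when `B₀` is replaced by a nearby frequency-dependent matrix. -/
theorem exists_frequency_transfer (N : ℕ) (m : Material) (k : ℝ) {a₁ β ε w₀ W r₀ : ℝ}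
    (hβ : 0 < β) (hε : 0 < ε) (hεN : 160 * (N + 1) * ε ≤ 1) (hw₀ : 0 < w₀) (hr₀ : 0 < r₀) :
    ∃ η > 0, η ≤ 1 ∧ ∃ q₀ > 0, ∀ (a : Fin N → ℝ) (δ s : ℝ) (ω : ℂ)
      (B₀ : Matrix (Fin N) (Fin N) ℂ), (∀ i, 0 ≤ a i) → (∀ i, a i ≤ a₁) → 0 < δ → 0 < s →
      N * (2 * a₁ ^ 2 + 1) * (δ ^ 2 * (m.mu0 * m.alpha) * s * W ^ 2) ≤ q₀ →
      w₀ ≤ ‖ω‖ → ‖ω‖ ≤ W → ω ∉ materialPoles m k → 2 * β ≤ ‖spectralParameter m k δ s ω‖ →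
      (∀ i j, ‖B₀ i j - leadingMatrix a i j‖ ≤ η) →
      (spectralParameter m k δ s ω • (1 : Matrix (Fin N) (Fin N) ℂ) - B₀).det = 0 →
      ∃ q : ℂ, ‖q‖ = Metric.infDist ω (materialPoles m k) ∧ ‖q‖ ≤ r₀ ∧
        (∀ t ∈ Metric.closedBall (0 : ℂ) ε, ω + q * t ∉ materialPoles m k ∧
          ‖spectralParameter m k δ s (ω + q * t) - spectralParameter m k δ s ω‖ ≤
            4 * ε * ‖spectralParameter m k δ s ω‖) ∧
        ∀ B : ℂ → Matrix (Fin N) (Fin N) ℂ, ContinuousOn B (Metric.closedBall 0 ε) →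
          (∀ t ∈ Metric.closedBall (0 : ℂ) ε, ∀ i j, ‖B t i j - leadingMatrix a i j‖ ≤ η) →
          ∃ t ∈ Metric.closedBall (0 : ℂ) ε, (spectralParameter m k δ s (ω + q * t) •
            (1 : Matrix (Fin N) (Fin N) ℂ) - B t).det = 0 := by
  have hN0 : (0 : ℝ) ≤ N := Nat.cast_nonneg N
  have hε1 : ε ≤ 1 := by nlinarith
  obtain ⟨η, hη, hη1, hdet⟩ := exists_det_eq_zero_of_near N (a₁ := a₁) hβ hε hε1
  -- `M = 16 (N + 1)` makes the deviation from the affine model exactly the one tolerated by the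
  -- winding argument.
  obtain ⟨q₀, hq₀, hloc⟩ := exists_local_model m k (M := 16 * (N + 1)) hε (by linarith)
    (by linarith) hw₀ hr₀
  refine ⟨η, hη, hη1, q₀, hq₀, fun a δ s ω B₀ ha0 ha1 hδ hs hq hω hωW hP hz hB₀ hB₀d => ?_⟩
  set z₀ := spectralParameter m k δ s ω with hz₀
  set τ : ℝ := δ ^ 2 * (m.mu0 * m.alpha) * s with hτ
  have hτ0 : 0 < τ := mul_pos (mul_pos (pow_pos hδ 2) (mul_pos m.mu0_pos m.alpha_pos)) hs
  have hτn : ‖(τ : ℂ)‖ = τ := by rw [Complex.norm_real, Real.norm_of_nonneg hτ0.le]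
  have hω0 : 0 < ‖ω‖ := hw₀.trans_le hω
  have hzN : ‖z₀‖ ≤ N * (2 * a₁ ^ 2 + 1) := by
    refine norm_le_of_det_eq_zero (fun i j => ?_) hB₀d
    have h1 := norm_leadingMatrix_le ha0 ha1 i j
    have h2 := norm_add_le (leadingMatrix a i j) (B₀ i j - leadingMatrix a i j)
    rw [add_sub_cancel] at h2
    linarith [hB₀ i j]
  -- The dispersion is `z₀ τ ω²` with `z₀` bounded as an eigenvalue of `B₀`, so a small `τ` forces
  -- the frequency towards the poles.
  have hdisp : ‖dispersion m k ω‖ ≤ q₀ := by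
    have h1 : dispersion m k ω = z₀ * τ * ω ^ 2 := by
      have : (τ : ℂ) ≠ 0 := by exact_mod_cast hτ0.ne'
      have := norm_pos_iff.1 hω0
      rw [hz₀, spectralParameter, ← hτ]
      field_simp
    rw [h1, norm_mul, norm_mul, norm_pow, hτn]
    refine le_trans ?_ hq
    rw [mul_assoc]
    gcongr
  obtain ⟨q, b, hqd, hqr, hb1, hb2, hmod⟩ := hloc ω hω hP hdisp
  have hnear : ∀ t ∈ Metric.closedBall (0 : ℂ) ε,
      ‖spectralParameter m k δ s (ω + q * t) - (z₀ + z₀ * b * t)‖ ≤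
        ‖z₀ * b‖ * ε / (16 * (N + 1)) := by
    intro t ht
    have e1 : spectralParameter m k δ s (ω + q * t) - (z₀ + z₀ * b * t) =
        (dispersion m k (ω + q * t) / (ω + q * t) ^ 2 -
          dispersion m k ω / ω ^ 2 * (1 + b * t)) / (τ : ℂ) := by
      rw [hz₀, spectralParameter, spectralParameter, ← hτ]
      ring
    have e2 : ‖z₀‖ = ‖dispersion m k ω / ω ^ 2‖ / τ := by
      rw [hz₀, spectralParameter, norm_div, ← hτ, hτn]
    rw [e1, norm_div, hτn, norm_mul, e2]
    have := div_le_div_of_nonneg_right (hmod t ht).2.2 hτ0.le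
    refine this.trans (le_of_eq ?_)
    ring
  have hcont : ContinuousOn (fun t => spectralParameter m k δ s (ω + q * t))
      (Metric.closedBall 0 ε) :=
    continuousOn_spectralParameter.comp (by fun_prop) fun t ht => (hmod t ht).1
  refine ⟨q, hqd, hqr, fun t ht => ⟨(hmod t ht).2.1, ?_⟩, fun B hBc hB => ?_⟩
  · have ht' := mem_closedBall_zero_iff.1 ht
    have h1 : ‖z₀ * b‖ ≤ 2 * ‖z₀‖ := by
      rw [norm_mul]
      nlinarith [norm_nonneg z₀]
    have h2 : ‖z₀ * b * t‖ ≤ 2 * ‖z₀‖ * ε := by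
      rw [norm_mul]
      gcongr
    have h3 : ‖z₀ * b‖ * ε / (16 * (N + 1)) ≤ 2 * ‖z₀‖ * ε := by
      rw [div_le_iff₀ (by positivity)]
      have : ‖z₀ * b‖ * ε ≤ 2 * ‖z₀‖ * ε := by gcongr
      have h5 : 0 ≤ 2 * ‖z₀‖ * ε := by positivity
      nlinarith
    have h4 := norm_add_le (spectralParameter m k δ s (ω + q * t) - (z₀ + z₀ * b * t)) (z₀ * b * t)
    have e : spectralParameter m k δ s (ω + q * t) - (z₀ + z₀ * b * t) + z₀ * b * t =
        spectralParameter m k δ s (ω + q * t) - z₀ := by ring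
    rw [e] at h4
    linarith [hnear t ht]
  · refine hdet a ha0 ha1 z₀ (z₀ * b) _ B₀ B ?_ ?_ hcont hBc hnear hB hB₀ hB₀d
    · rw [norm_mul]
      nlinarith [norm_nonneg z₀]
    · rw [norm_mul]
      nlinarith [norm_nonneg z₀]

end SpectralParameter

/-! ### The reduced matrix as a function of the frequency -/

section Matrices

theorem norm_inv_smul_blockOperator_le {N : ℕ} {H : Fin N → Type*}
    [∀ i, NormedAddCommGroup (H i)] [∀ i, InnerProductSpace ℂ (H i)] {S : ∀ i j, H j →L[ℂ] H i}
    {z : ℂ} {η ζ : ℝ} (hη0 : 0 ≤ η) (hS : ∀ i j, ‖S i j‖ ≤ η) (hζ : 0 < ζ) (hz : ζ ≤ ‖z‖)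
    (hη : N * η ≤ ζ / 2) : ‖z⁻¹ • blockOperator S‖ ≤ 1 / 2 := by
  have h : N * η / ζ ≤ 1 / 2 := by
    rw [div_le_iff₀ hζ]
    linarith
  exact (norm_inv_smul_le (x := blockOperator S) (M := N * η) hζ hz
    (norm_blockOperator_le hη0 hS)).trans h

variable {N : ℕ} {D : Fin N → Set Plane} {c d R : ℝ}
  [∀ i, IsFiniteMeasure (volume.restrict (D i))] {p : KernelTail}
  {Op : ℂ → Set Plane → (Plane → ℂ) → Plane → ℂ} {m : Material} {k δ : ℝ} {ω : ℂ} {η ζ : ℝ}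

/-- The reduced matrix of the resonance problem. -/
noncomputable def reducedMatrix (p : KernelTail) (D : Fin N → Set Plane)
    [∀ i, IsFiniteMeasure (volume.restrict (D i))] (m : Material) (k δ : ℝ) (ω : ℂ) :
    Matrix (Fin N) (Fin N) ℂ :=
  feshbachMatrix (constVectors D) (relSize D) (remainderOperator p D (scaledWavenumber m δ ω))
    (spectralParameter m k δ (operatorScale D) ω)

theorem isSystemResonance_iff_det (hOp : Realizes p Op) (hD : IsDilute c d R D) (hc : 0 < c)
    (hR : 0 < R) (hρ : 0 < sizeParam D) (hs : 0 < operatorScale D) (hδ : 0 < δ)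
    (hω : ω ∈ Complex.slitPlane) (hP : ω ∉ materialPoles m k) (hη0 : 0 ≤ η)
    (hS : ∀ i j, ‖remainderOperator p D (scaledWavenumber m δ ω) i j‖ ≤ η) (hζ : 0 < ζ)
    (hz : ζ ≤ ‖spectralParameter m k δ (operatorScale D) ω‖) (hη : N * η ≤ ζ / 2) :
    IsSystemResonance Op Op m k δ D ω ↔
      (spectralParameter m k δ (operatorScale D) ω • (1 : Matrix (Fin N) (Fin N) ℂ) -
        reducedMatrix p D m k δ ω).det = 0 := by
  rw [isSystemResonance_iff hOp hD hR hρ hs.ne' (scaledWavenumber_mem_slitPlane m hδ hω)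
    (spectralParameter_mul_strength hδ hs (Complex.slitPlane_ne_zero hω) hP),
    exists_blockMap_eigenvector_iff (norm_constVectors hD hc hρ) (norm_pos_iff.1 (hζ.trans_le hz))
    (norm_inv_smul_blockOperator_le hη0 hS hζ hz hη)]
  exact ⟨fun h => h.2.2, fun h => ⟨hω, hP, h⟩⟩

theorem continuousOn_remainderOperator_comp (hD : IsDilute c d R D) (hR : 0 < R) (p : KernelTail)
    (hδ : 0 < δ) {U : Set ℂ} {f : ℂ → ℂ} (hf : ContinuousOn f U)
    (hfs : ∀ t ∈ U, f t ∈ Complex.slitPlane) (i j : Fin N) :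
    ContinuousOn (fun t => remainderOperator p D (scaledWavenumber m δ (f t)) i j) U :=
  (hD.continuousOn_remainderOperator hR p i j).comp
    ((continuous_scaledWavenumber m δ).comp_continuousOn hf)
    fun t ht => scaledWavenumber_mem_slitPlane m hδ (hfs t ht)

theorem continuousOn_reducedMatrix (hD : IsDilute c d R D) (hR : 0 < R) (p : KernelTail)
    (hδ : 0 < δ) {U : Set ℂ} {f : ℂ → ℂ} (hf : ContinuousOn f U)
    (hfs : ∀ t ∈ U, f t ∈ Complex.slitPlane) (hη0 : 0 ≤ η)
    (hS : ∀ t ∈ U, ∀ i j, ‖remainderOperator p D (scaledWavenumber m δ (f t)) i j‖ ≤ η)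
    (hζ : 0 < ζ) (hz : ∀ t ∈ U, ζ ≤ ‖spectralParameter m k δ (operatorScale D) (f t)‖)
    (hη : N * η ≤ ζ / 2) :
    ContinuousOn (fun t => reducedMatrix p D m k δ (f t)) U :=
  continuousOn_feshbachMatrix (continuousOn_spectralParameter.comp hf
      fun t ht => Complex.slitPlane_ne_zero (hfs t ht))
    (fun t ht => norm_pos_iff.1 (hζ.trans_le (hz t ht)))
    (continuousOn_remainderOperator_comp hD hR p hδ hf hfs)
    fun t ht => norm_inv_smul_blockOperator_le hη0 (hS t ht) hζ (hz t ht) hη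

end Matrices

/-! ### The principal regime and the spectral parameter -/

section Regime

variable {N : ℕ} {D : Fin N → Set Plane} {c d R : ℝ}
  [∀ i, IsFiniteMeasure (volume.restrict (D i))] {m : Material} {k δ : ℝ} {ω : ℂ} {η : ℝ}

/-- The matrix whose determinant is that of `matL`, up to normalisation. -/
noncomputable def principalMatrix (D : Fin N → Set Plane)
    [∀ i, IsFiniteMeasure (volume.restrict (D i))] (m : Material) (δ : ℝ) (ω : ℂ) :
    Matrix (Fin N) (Fin N) ℂ :=
  interactionMatrix (constVectors D) (relSize D)
    (remainderOperator expandedTail D (scaledWavenumber m δ ω))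

/-- The rescaled principal eigenvalue of the `i`-th particle. -/
noncomputable def principalValue (D : Fin N → Set Plane)
    [∀ i, IsFiniteMeasure (volume.restrict (D i))] (m : Material) (δ : ℝ) (ω : ℂ) (i : Fin N) : ℂ :=
  blockValue (constVectors D) (relSize D)
    (remainderOperator expandedTail D (scaledWavenumber m δ ω)) i

theorem principalMatrix_ne_zero (hD : IsDilute c d R D) (hc : 0 < c) (hρ : 0 < sizeParam D)
    (h : ∀ i j, ‖principalMatrix D m δ ω i j - leadingMatrix (relSize D) i j‖ ≤ η) (hη : η < c)
    {i j : Fin N} (hij : i ≠ j) : principalMatrix D m δ ω i j ≠ 0 := by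
  intro h0
  have h1 := h i j
  rw [h0, zero_sub, norm_neg, leadingMatrix_of_ne _ hij, Complex.norm_real, norm_mul,
    Real.norm_of_nonneg (relSize_pos hD hc hρ i).le,
    Real.norm_of_nonneg (relSize_pos hD hc hρ j).le] at h1
  have h2 : √c * √c ≤ relSize D i * relSize D j :=
    mul_le_mul (le_relSize hD hρ i) (le_relSize hD hρ j) (Real.sqrt_nonneg c)
      (relSize_pos hD hc hρ i).le
  rw [Real.mul_self_sqrt hc.le] at h2
  linarith

/-- In the principal regime the spectral parameter is bounded below and away from the principal
values. -/
theorem norm_spectralParameter_of_regime {C : ℝ} (hD : IsDilute c d R D) (hc : 0 < c) (hR : 0 < R)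
    (hρ : 0 < sizeParam D) (hs : 0 < operatorScale D) (hδ : 0 < δ) (hC : 0 < C)
    (hω : ω ∈ Complex.slitPlane) (hP : ω ∉ materialPoles m k)
    (hrem : ∀ i, ‖scaledRemainder (relSize D) (remainderOperator expandedTail D
      (scaledWavenumber m δ ω)) i‖ ≤ 1 / 16) (h : InPrincipalRegime C m k δ D ω) (i : Fin N) :
    c / C ≤ ‖spectralParameter m k δ (operatorScale D) ω‖ ∧
    ‖spectralParameter m k δ (operatorScale D) ω‖ / C ≤
      ‖spectralParameter m k δ (operatorScale D) ω - principalValue D m δ ω i‖ := by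
  have hκ := scaledWavenumber_mem_slitPlane m hδ hω
  obtain ⟨ν, φ, hνφ⟩ := exists_isPrincipalEigenpair hκ hD hc hR hρ hs hrem i
  have hν := ((isPrincipalEigenpair_iff hκ hD hc hR hρ hs hrem i ν φ).1 hνφ).1
  obtain ⟨h1, h2⟩ := h i ν φ hνφ
  have hz := spectralParameter_mul_strength hδ hs (Complex.slitPlane_ne_zero hω) hP
  set z := spectralParameter m k δ (operatorScale D) ω
  -- Since `z s ν = ν / h` is the block value, of modulus at least `c`, the bound `|s ν| ≤ C` yields
  -- `|z| ≥ c / C`, and `z - ν / h = z (1 - s ν)` yields the separation.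
  have hzν : z * (strength m k δ ω * ν) = principalValue D m δ ω i := by
    rw [hν, ← mul_assoc, ← mul_assoc, mul_assoc z, hz, one_mul, principalValue]
  constructor
  · have hb := le_norm_blockValue (norm_constVectors hD hc hρ) (relSize_pos hD hc hρ) hrem i
    rw [← principalValue, ← hzν, norm_mul] at hb
    have h3 : c ≤ relSize D i ^ 2 := by
      rw [← Real.sqrt_le_left (relSize_pos hD hc hρ i).le]
      exact le_relSize hD hρ i
    rw [div_le_iff₀ hC]
    calc c ≤ ‖z‖ * ‖strength m k δ ω * ν‖ := h3.trans hb
      _ ≤ ‖z‖ * C := by gcongr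
  · rw [← hzν, ← mul_one_sub, norm_mul, div_eq_mul_inv]
    gcongr

end Regime

theorem operatorScale_pos {N : ℕ} {D : Fin N → Set Plane} (hρ : 0 < sizeParam D)
    (h1 : sizeParam D < 1) : 0 < operatorScale D := by
  have := Real.log_neg hρ h1
  exact div_pos (mul_pos (by linarith) (by positivity)) (by positivity)

theorem operatorScale_le {N : ℕ} {D : Fin N → Set Plane} (hρ : 0 < sizeParam D) :
    operatorScale D ≤ sizeParam D := by
  have h1 : -Real.log (sizeParam D) ≤ (sizeParam D)⁻¹ := by
    rw [← Real.log_inv]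
    exact (Real.log_le_sub_one_of_pos (by positivity)).trans (by linarith)
  rw [operatorScale, div_le_iff₀ (by positivity)]
  calc -Real.log (sizeParam D) * sizeParam D ^ 2 ≤ (sizeParam D)⁻¹ * sizeParam D ^ 2 := by gcongr
    _ = sizeParam D * 1 := by field_simp
    _ ≤ _ := by
      gcongr
      linarith [Real.pi_gt_three]

/-! ### The transfer applied to each kind of target -/

section Targets

variable {N : ℕ} {D : Fin N → Set Plane} {c d R : ℝ}
  [∀ i, IsFiniteMeasure (volume.restrict (D i))] {m : Material} {k δ : ℝ} {η η' : ℝ}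
  {U : Set ℂ} {f : ℂ → ℂ}

theorem norm_principalMatrix_sub_le {ω : ℂ} (hD : IsDilute c d R D) (hc : 0 < c)
    (hρ : 0 < sizeParam D)
    (hS : ∀ i j, ‖remainderOperator expandedTail D (scaledWavenumber m δ ω) i j‖ ≤ η)
    (hrem : ∀ i, ‖scaledRemainder (relSize D) (remainderOperator expandedTail D
      (scaledWavenumber m δ ω)) i‖ ≤ 1 / 16)
    (hη : (15 * (3 * √discArea) ^ 2 * (2 * √c ^ 2)⁻¹ + 4) * η ≤ η') (i j : Fin N) :
    ‖principalMatrix D m δ ω i j - leadingMatrix (relSize D) i j‖ ≤ η' :=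
  (norm_interactionMatrix_sub_le (norm_constVectors hD hc hρ) (relSize_pos hD hc hρ) hrem
    (Real.sqrt_pos.2 hc) (le_relSize hD hρ) (relSize_le hD hρ) hS i j).trans hη

theorem norm_reducedMatrix_sub_le {p : KernelTail} {ω : ℂ} {ζ : ℝ} (hD : IsDilute c d R D)
    (hc : 0 < c) (hρ : 0 < sizeParam D)
    (hS : ∀ i j, ‖remainderOperator p D (scaledWavenumber m δ ω) i j‖ ≤ η) (hζ : 0 < ζ)
    (hz : ζ ≤ ‖spectralParameter m k δ (operatorScale D) ω‖) (hNη : N * η ≤ ζ / 2)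
    (hη : 4 * N ^ 2 * (3 * √discArea) ^ 2 / ζ * η ≤ η') (i j : Fin N) :
    ‖reducedMatrix p D m k δ ω i j - leadingMatrix (relSize D) i j‖ ≤ η' :=
  (norm_feshbachMatrix_sub_le (norm_constVectors hD hc hρ) (fun i => (relSize_pos hD hc hρ i).le)
    (relSize_le hD hρ) hS hζ hz hNη i j).trans hη

theorem exists_isSystemResonance_of_transfer {p : KernelTail}
    {Op : ℂ → Set Plane → (Plane → ℂ) → Plane → ℂ} {ζ : ℝ} (hOp : Realizes p Op)
    (hD : IsDilute c d R D) (hc : 0 < c) (hR : 0 < R) (hρ : 0 < sizeParam D)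
    (hs : 0 < operatorScale D) (hδ : 0 < δ) (hf : ContinuousOn f U)
    (hfs : ∀ t ∈ U, f t ∈ Complex.slitPlane) (hfP : ∀ t ∈ U, f t ∉ materialPoles m k) (hη0 : 0 ≤ η)
    (hS : ∀ t ∈ U, ∀ i j, ‖remainderOperator p D (scaledWavenumber m δ (f t)) i j‖ ≤ η)
    (hζ : 0 < ζ) (hz : ∀ t ∈ U, ζ ≤ ‖spectralParameter m k δ (operatorScale D) (f t)‖)
    (hNη : N * η ≤ ζ / 2) (hη : 4 * N ^ 2 * (3 * √discArea) ^ 2 / ζ * η ≤ η')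
    (hT : ∀ B : ℂ → Matrix (Fin N) (Fin N) ℂ, ContinuousOn B U →
      (∀ t ∈ U, ∀ i j, ‖B t i j - leadingMatrix (relSize D) i j‖ ≤ η') →
      ∃ t ∈ U, (spectralParameter m k δ (operatorScale D) (f t) •
        (1 : Matrix (Fin N) (Fin N) ℂ) - B t).det = 0) :
    ∃ t ∈ U, IsSystemResonance Op Op m k δ D (f t) := by
  obtain ⟨t, ht, h⟩ := hT (fun t => reducedMatrix p D m k δ (f t))
    (continuousOn_reducedMatrix hD hR p hδ hf hfs hη0 hS hζ hz hNη)
    fun t ht => norm_reducedMatrix_sub_le hD hc hρ (hS t ht) hζ (hz t ht) hNη hη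
  exact ⟨t, ht, (isSystemResonance_iff_det hOp hD hc hR hρ hs hδ (hfs t ht) (hfP t ht) hη0
    (hS t ht) hζ (hz t ht) hNη).2 h⟩

/-- Besides the determinant, `𝓑_i` must be finite at the new frequency; this is the separation
hypothesis, imposed on the whole disc since the zero is not located within it. -/
theorem exists_isDetZero_of_transfer (hN : 2 ≤ N) (hD : IsDilute c d R D) (hc : 0 < c)
    (hR : 0 < R) (hρ : 0 < sizeParam D) (hs : 0 < operatorScale D) (hδ : 0 < δ)
    (hf : ContinuousOn f U) (hfs : ∀ t ∈ U, f t ∈ Complex.slitPlane)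
    (hfP : ∀ t ∈ U, f t ∉ materialPoles m k)
    (hS : ∀ t ∈ U, ∀ i j, ‖principalMatrix D m δ (f t) i j - leadingMatrix (relSize D) i j‖ ≤ η)
    (hrem : ∀ t ∈ U, ∀ i, ‖scaledRemainder (relSize D) (remainderOperator expandedTail D
      (scaledWavenumber m δ (f t))) i‖ ≤ 1 / 16) (hηc : η < c)
    (hsep : ∀ t ∈ U, ∀ i, spectralParameter m k δ (operatorScale D) (f t) ≠
      principalValue D m δ (f t) i)
    (hT : ∀ B : ℂ → Matrix (Fin N) (Fin N) ℂ, ContinuousOn B U →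
      (∀ t ∈ U, ∀ i j, ‖B t i j - leadingMatrix (relSize D) i j‖ ≤ η) →
      ∃ t ∈ U, (spectralParameter m k δ (operatorScale D) (f t) •
        (1 : Matrix (Fin N) (Fin N) ℂ) - B t).det = 0) :
    ∃ t ∈ U, IsDetZero m k δ D (f t) := by
  obtain ⟨t, ht, h⟩ := hT (fun t => principalMatrix D m δ (f t))
    (continuousOn_interactionMatrix (norm_constVectors hD hc hρ) hrem
      (continuousOn_remainderOperator_comp hD hR expandedTail hδ hf hfs)) hS
  exact ⟨t, ht, (isDetZero_iff hD hc hρ hN (scaledWavenumber_mem_slitPlane m hδ (hfs t ht)) hR hs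
    (hrem t ht) (fun i j hij => principalMatrix_ne_zero hD hc hρ (hS t ht) hηc hij)
    (spectralParameter_mul_strength hδ hs (Complex.slitPlane_ne_zero (hfs t ht)) (hfP t ht))).2
      ⟨hfs t ht, hfP t ht, hsep t ht, h⟩⟩

end Targets

/-! ### Choice of constants and conclusion -/

/-- A compact set of frequencies has a compact neighbourhood off the branch cut and away from
zero and infinity. -/
theorem exists_compact_thickening {Z : Set ℂ} (hZ : IsCompact Z) (hZs : Z ⊆ Complex.slitPlane) :
    ∃ r > 0, ∃ K : Set ℂ, IsCompact K ∧ K ⊆ Complex.slitPlane ∧ Z ⊆ K ∧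
      (∀ ω ∈ Z, ∀ h : ℂ, ‖h‖ ≤ r → ω + h ∈ K) ∧
      ∃ w₀ > 0, ∃ W : ℝ, ∀ ω ∈ K, w₀ ≤ ‖ω‖ ∧ ‖ω‖ ≤ W := by
  obtain ⟨r, hr, hsub⟩ := hZ.exists_cthickening_subset_open Complex.isOpen_slitPlane hZs
  have hK : IsCompact (Metric.cthickening r Z) := hZ.cthickening
  obtain ⟨W, hW⟩ := hK.exists_bound_of_continuousOn (f := fun ω : ℂ => ω) continuousOn_id
  obtain ⟨V, hV⟩ := hK.exists_bound_of_continuousOn (f := fun ω : ℂ => ω⁻¹)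
    (continuousOn_id.inv₀ fun ω hω => Complex.slitPlane_ne_zero (hsub hω))
  refine ⟨r, hr, _, hK, hsub, Metric.self_subset_cthickening Z, fun ω hω h hh => ?_,
    (max V 1)⁻¹, by positivity, W, fun ω hω => ⟨?_, hW ω hω⟩⟩
  · exact Metric.mem_cthickening_of_dist_le _ ω r Z hω (by simpa using hh)
  · have h0 : 0 < ‖ω‖ := norm_pos_iff.2 (Complex.slitPlane_ne_zero (hsub hω))
    have h1 := (hV ω hω).trans (le_max_left V 1)
    rw [norm_inv] at h1
    exact inv_le_of_inv_le₀ h0 h1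

theorem exists_pos_of_eventually {P : ℝ → Prop} (h : ∀ᶠ x in 𝓝[>] (0 : ℝ), P x) :
    ∃ x > 0, P x := by
  obtain ⟨x, hP, hx⟩ := (h.and self_mem_nhdsWithin).exists
  exact ⟨x, hx, hP⟩

/-- The gap `‖z‖ / C` exceeds the sum of the change of `z` and the two errors of `v` and `v'` about
their common approximation `l`, each group being at most a quarter of the gap. -/
theorem ne_of_norm_sub_le {z z' v v' l : ℂ} {β C e η : ℝ} (hC : 0 < C) (hβ : 0 < β)
    (hz : β ≤ ‖z‖) (hsep : ‖z‖ / C ≤ ‖z - v‖) (hz' : ‖z' - z‖ ≤ 4 * e * ‖z‖)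
    (he : 4 * e ≤ 1 / (4 * C)) (hv : ‖v - l‖ ≤ 2 * η) (hv' : ‖v' - l‖ ≤ 2 * η)
    (hη : 4 * η ≤ β / (4 * C)) : z' ≠ v' := by
  rintro rfl
  have h7 : ‖z‖ / C ≤ 4 * e * ‖z‖ + 2 * η + 2 * η := by
    refine hsep.trans ?_
    have e1 : z - v = -(z' - z) + (z' - l) - (v - l) := by ring
    rw [e1]
    refine (norm_sub_le _ _).trans (add_le_add ((norm_add_le _ _).trans ?_) hv)
    rw [norm_neg]
    exact add_le_add hz' hv'
  have h8 : 4 * e * ‖z‖ ≤ 1 / (4 * C) * ‖z‖ := by gcongr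
  have h9 : β / (4 * C) ≤ 1 / (4 * C) * ‖z‖ := by
    rw [div_eq_mul_one_div, mul_comm]
    gcongr
  have h10 : ‖z‖ / C = 4 * (1 / (4 * C) * ‖z‖) := by field_simp
  have h11 : 0 < 1 / (4 * C) * ‖z‖ := by
    have : 0 < ‖z‖ := hβ.trans_le hz
    positivity
  linarith

set_option maxHeartbeats 1000000 in
/-- For small particles the zeros of the determinant and the resonant frequencies approximate
each other. -/
theorem eventually_resonance_correspondence (N : ℕ) (hN : 2 ≤ N) (m : Material) (k : ℝ)
    (c d R κ C : ℝ) (hc : 0 < c) (hd : 0 < d) (hR : 0 < R) (hκ : 0 < κ) (hC : 0 < C)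
    (Z : Set ℂ) (hZ : IsCompact Z) (hZs : Z ⊆ Complex.slitPlane) (ε : ℝ) (hε : 0 < ε) :
    ∀ᶠ ρ in 𝓝[>] (0 : ℝ), ∀ (D : Fin N → Set Plane) (δ : ℝ)
      [∀ i, IsFiniteMeasure (volume.restrict (D i))], IsDilute c d R D →
      0 < δ → sizeParam D = ρ → sizeParam D ≤ κ * δ → δ ≤ κ * sizeParam D →
      (∀ ω ∈ Z, ∀ i,
        (∃ ν φ, IsPrincipalEigenpair (scaledWavenumber m δ ω) (D i) ν φ) ∧
        ∀ ν φ ν' φ', IsPrincipalEigenpair (scaledWavenumber m δ ω) (D i) ν φ →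
          IsPrincipalEigenpair (scaledWavenumber m δ ω) (D i) ν' φ' →
          ν' = ν ∧ ∃ a : ℂ, ‖a‖ = 1 ∧ ∀ᵐ x ∂(volume.restrict (D i)), φ' x = a * φ x) ∧
      (∀ ω ∈ Z, (IsResonance m k δ D ω ∨ IsExpandedResonance m k δ D ω) →
        InPrincipalRegime C m k δ D ω →
        ∃ ω', IsDetZero m k δ D ω' ∧ CloseAtLeadingOrder ε m k ω ω') ∧
      (∀ ω ∈ Z, IsDetZero m k δ D ω →
        (∃ ω', IsResonance m k δ D ω' ∧ CloseAtLeadingOrder ε m k ω ω') ∧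
        (∃ ω', IsExpandedResonance m k δ D ω' ∧ CloseAtLeadingOrder ε m k ω ω')) := by
  obtain ⟨r, hr, K, hK, hKs, hZK, hthick, w₀, hw₀, W, hKW⟩ := exists_compact_thickening hZ hZs
  -- Both lower bounds for `|z|`, namely `c / 2` at zeros of the determinant and `c / C` in the
  -- principal regime, are at least `2 β`; half is given up along the disc.
  obtain ⟨β, hβ⟩ : ∃ β, β = min (c / 2) (c / C) / 2 := ⟨_, rfl⟩
  have hβ0 : 0 < β := by rw [hβ]; positivity
  have hβ1 : 2 * β ≤ c / 2 := by rw [hβ]; linarith [min_le_left (c / 2) (c / C)]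
  have hβ2 : 2 * β ≤ c / C := by rw [hβ]; linarith [min_le_right (c / 2) (c / C)]
  obtain ⟨e, he0, heε, heN, heC⟩ : ∃ e > 0, e ≤ ε ∧ 160 * ((N : ℝ) + 1) * e ≤ 1 ∧
      4 * e ≤ 1 / (4 * C) := by
    obtain ⟨e, he, h1, h2, h3⟩ := exists_pos_of_eventually ((eventually_mul_le 1 hε).and
      ((eventually_mul_le (160 * ((N : ℝ) + 1)) one_pos).and
        (eventually_mul_le 4 (y := 1 / (4 * C)) (by positivity))))
    exact ⟨e, he, by linarith, h2, h3⟩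
  have he1 : 4 * e ≤ 1 / 2 := by nlinarith [(Nat.cast_nonneg N : (0 : ℝ) ≤ N)]
  obtain ⟨η, hη, hη1, q₀, hq₀, htransfer⟩ := exists_frequency_transfer N m k
    (a₁ := 3 * √discArea) (W := W) hβ0 he0 heN hw₀ (r₀ := r) hr
  -- `N η' ≤ c / 2` gives the lower bound for the roots, and `η' < c` keeps the off-diagonal
  -- interactions nonzero.
  obtain ⟨η', hη'0, hη'η, hη'N, hη'c⟩ : ∃ η' > 0, η' ≤ η ∧ N * η' ≤ √c ^ 2 / 2 ∧ η' < c := by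
    obtain ⟨x, hx, h1, h2, h3⟩ := exists_pos_of_eventually ((eventually_mul_le 1 hη).and
      ((eventually_mul_le (N : ℝ) (y := √c ^ 2 / 2) (by positivity)).and (eventually_mul_le 2 hc)))
    exact ⟨x, hx, by linarith, h2, by linarith⟩
  -- The conditions on the remainders are, in order: closeness of the interaction matrix, closeness
  -- of the reduced matrix, convergence of the Neumann series, the contraction threshold, and the
  -- separation from the principal values.
  obtain ⟨η₁, hη₁0, hη₁a, hη₁b, hη₁c, hη₁d, hη₁e⟩ : ∃ η₁ > 0,
      (15 * (3 * √discArea) ^ 2 * (2 * √c ^ 2)⁻¹ + 4) * η₁ ≤ η' ∧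
      4 * N ^ 2 * (3 * √discArea) ^ 2 / β * η₁ ≤ η' ∧ N * η₁ ≤ β / 2 ∧
      (2 * √c ^ 2)⁻¹ * η₁ ≤ 1 / 16 ∧ 4 * η₁ ≤ β / (4 * C) :=
    exists_pos_of_eventually ((eventually_mul_le _ hη'0).and ((eventually_mul_le _ hη'0).and
      ((eventually_mul_le _ (by positivity)).and ((eventually_mul_le _ (by norm_num)).and
      (eventually_mul_le _ (by positivity))))))
  filter_upwards [self_mem_nhdsWithin, eventually_mul_le 2 (one_pos),
    eventually_mul_le (N * (2 * (3 * √discArea) ^ 2 + 1) * (κ ^ 2 * (m.mu0 * m.alpha) * W ^ 2)) hq₀,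
    eventually_norm_remainderOperator_le greenTail m hc hd hR hκ hη₁0 hK hKs,
    eventually_norm_remainderOperator_le expandedTail m hc hd hR hκ hη₁0 hK hKs]
    with ρ hρ0 hρ1 hρq hG hE
  intro D δ _ hD hδ hDρ h1 h2
  subst hDρ
  have hρ : 0 < sizeParam D := hρ0
  have hρ1' : sizeParam D < 1 := by linarith
  replace hG := hG N D δ rfl hD hδ h1 h2
  replace hE := hE N D δ rfl hD hδ h1 h2
  have hs := operatorScale_pos hρ hρ1'
  have hm := mul_pos m.mu0_pos m.alpha_pos
  have hdisc : 0 ≤ discArea := measureReal_nonneg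
  have hq : N * (2 * (3 * √discArea) ^ 2 + 1) *
      (δ ^ 2 * (m.mu0 * m.alpha) * operatorScale D * W ^ 2) ≤ q₀ := by
    refine le_trans ?_ hρq
    have h3 : δ ≤ κ := h2.trans (by nlinarith)
    rw [mul_assoc _ _ (sizeParam D)]
    refine mul_le_mul_of_nonneg_left ?_ (by positivity)
    calc δ ^ 2 * (m.mu0 * m.alpha) * operatorScale D * W ^ 2
        ≤ κ ^ 2 * (m.mu0 * m.alpha) * sizeParam D * W ^ 2 := by
          gcongr
          exact operatorScale_le hρ
      _ = _ := by ring
  have hrem : ∀ ω ∈ K, ∀ i, ‖scaledRemainder (relSize D) (remainderOperator expandedTail D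
      (scaledWavenumber m δ ω)) i‖ ≤ 1 / 16 := fun ω hω i =>
    (norm_scaledRemainder_le (Real.sqrt_pos.2 hc) (le_relSize hD hρ) (hE ω hω) i).trans hη₁d
  have hprin : ∀ ω ∈ K, ∀ i j,
      ‖principalMatrix D m δ ω i j - leadingMatrix (relSize D) i j‖ ≤ η' := fun ω hω =>
    norm_principalMatrix_sub_le hD hc hρ (hE ω hω) (hrem ω hω) hη₁a
  have hval : ∀ ω ∈ K, ∀ i, ‖principalValue D m δ ω i - leadingMatrix (relSize D) i i‖ ≤ 2 * η₁ :=
    fun ω hω i => norm_blockValue_sub_le (norm_constVectors hD hc hρ) (relSize_pos hD hc hρ)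
      (hrem ω hω) i (hE ω hω)
  set z := spectralParameter m k δ (operatorScale D) with hz
  -- the transfer between the three notions, from a frequency `ω` of `Z`
  have key : ∀ ω ∈ Z, ω ∉ materialPoles m k → 2 * β ≤ ‖z ω‖ → ∀ B₀ : Matrix (Fin N) (Fin N) ℂ,
      (∀ i j, ‖B₀ i j - leadingMatrix (relSize D) i j‖ ≤ η') →
      (z ω • (1 : Matrix (Fin N) (Fin N) ℂ) - B₀).det = 0 →
      ((∃ ω', IsResonance m k δ D ω' ∧ CloseAtLeadingOrder ε m k ω ω') ∧
        (∃ ω', IsExpandedResonance m k δ D ω' ∧ CloseAtLeadingOrder ε m k ω ω')) ∧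
      ((∀ i, ‖z ω‖ / C ≤ ‖z ω - principalValue D m δ ω i‖) →
        ∃ ω', IsDetZero m k δ D ω' ∧ CloseAtLeadingOrder ε m k ω ω') := by
    intro ω hω hP hzω B₀ hB₀ hdet
    obtain ⟨q, hqd, hqr, hball, hT⟩ := htransfer (relSize D) δ (operatorScale D) ω B₀
      (fun i => (relSize_pos hD hc hρ i).le) (relSize_le hD hρ) hδ hs hq (hKW ω (hZK hω)).1
      (hKW ω (hZK hω)).2 hP hzω (fun i j => (hB₀ i j).trans hη'η) hdet
    replace hT := fun (B : ℂ → Matrix (Fin N) (Fin N) ℂ)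
        (hB : ContinuousOn B (Metric.closedBall 0 e))
        (hB' : ∀ t ∈ Metric.closedBall (0 : ℂ) e, ∀ i j,
          ‖B t i j - leadingMatrix (relSize D) i j‖ ≤ η') => hT B hB fun t ht i j => (hB' t ht i j).trans hη'η
    have hfK : ∀ t ∈ Metric.closedBall (0 : ℂ) e, ω + q * t ∈ K := by
      intro t ht
      refine hthick ω hω _ ?_
      rw [norm_mul]
      have := mem_closedBall_zero_iff.1 ht
      nlinarith [norm_nonneg q, norm_nonneg t]
    have hf : ContinuousOn (fun t => ω + q * t) (Metric.closedBall 0 e) := by fun_prop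
    have hzt : ∀ t ∈ Metric.closedBall (0 : ℂ) e, β ≤ ‖z (ω + q * t)‖ := by
      intro t ht
      have h3 := (hball t ht).2
      have h4 := norm_sub_norm_le (z ω) (z (ω + q * t))
      rw [norm_sub_rev] at h4
      have h5 : 4 * e * ‖z ω‖ ≤ 1 / 2 * ‖z ω‖ := by gcongr
      linarith
    have hclose : ∀ t ∈ Metric.closedBall (0 : ℂ) e, CloseAtLeadingOrder ε m k ω (ω + q * t) := by
      intro t ht
      have := mem_closedBall_zero_iff.1 ht
      rw [CloseAtLeadingOrder, add_sub_cancel_left, norm_mul, ← hqd, mul_comm]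
      gcongr
      exact this.trans heε
    refine ⟨⟨?_, ?_⟩, fun hsep => ?_⟩
    · obtain ⟨t, ht, h⟩ := exists_isSystemResonance_of_transfer realizes_opK hD hc hR hρ hs hδ hf
        (fun t ht => hKs (hfK t ht)) (fun t ht => (hball t ht).1) hη₁0.le
        (fun t ht => hG _ (hfK t ht)) hβ0 hzt hη₁c hη₁b hT
      exact ⟨_, h, hclose t ht⟩
    · obtain ⟨t, ht, h⟩ := exists_isSystemResonance_of_transfer realizes_opM hD hc hR hρ hs hδ hf
        (fun t ht => hKs (hfK t ht)) (fun t ht => (hball t ht).1) hη₁0.le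
        (fun t ht => hE _ (hfK t ht)) hβ0 hzt hη₁c hη₁b hT
      exact ⟨_, h, hclose t ht⟩
    · have hne : ∀ t ∈ Metric.closedBall (0 : ℂ) e, ∀ i,
          z (ω + q * t) ≠ principalValue D m δ (ω + q * t) i := by
        intro t ht i
        exact ne_of_norm_sub_le hC hβ0 (by linarith) (hsep i) (hball t ht).2 heC
          (hval _ (hZK hω) i) (hval _ (hfK t ht) i) hη₁e
      obtain ⟨t, ht, h⟩ := exists_isDetZero_of_transfer hN hD hc hR hρ hs hδ hf
        (fun t ht => hKs (hfK t ht)) (fun t ht => (hball t ht).1) (fun t ht => hprin _ (hfK t ht))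
        (fun t ht => hrem _ (hfK t ht)) hη'c hne hT
      exact ⟨_, h, hclose t ht⟩
  refine ⟨fun ω hω i => ?_, fun ω hω hres hreg => ?_, fun ω hω hdz => ?_⟩
  · have hκs := scaledWavenumber_mem_slitPlane m hδ (hZs hω)
    exact ⟨exists_isPrincipalEigenpair hκs hD hc hR hρ hs (hrem ω (hZK hω)) i,
      fun ν φ ν' φ' h h' => h.unique hκs hD hc hR hρ hs (hrem ω (hZK hω)) h'⟩
  · have hP : ω ∉ materialPoles m k := hres.elim (fun h => h.2.1) fun h => h.2.1
    have hreg' := norm_spectralParameter_of_regime hD hc hR hρ hs hδ hC (hZs hω) hP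
      (hrem ω (hZK hω)) hreg
    have hzω : 2 * β ≤ ‖z ω‖ := hβ2.trans (hreg' ⟨0, by omega⟩).1
    have hzω' : β ≤ ‖z ω‖ := by linarith
    rcases hres with h | h
    · exact (key ω hω hP hzω _ (norm_reducedMatrix_sub_le hD hc hρ (hG ω (hZK hω)) hβ0 hzω' hη₁c
        hη₁b) ((isSystemResonance_iff_det realizes_opK hD hc hR hρ hs hδ (hZs hω) hP hη₁0.le
          (hG ω (hZK hω)) hβ0 hzω' hη₁c).1 h)).2 fun i => (hreg' i).2
    · exact (key ω hω hP hzω _ (norm_reducedMatrix_sub_le hD hc hρ (hE ω (hZK hω)) hβ0 hzω' hη₁c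
        hη₁b) ((isSystemResonance_iff_det realizes_opM hD hc hR hρ hs hδ (hZs hω) hP hη₁0.le
          (hE ω (hZK hω)) hβ0 hzω' hη₁c).1 h)).2 fun i => (hreg' i).2
  · have hP : ω ∉ materialPoles m k := hdz.2.1
    have hdet := ((isDetZero_iff hD hc hρ hN (scaledWavenumber_mem_slitPlane m hδ (hZs hω)) hR hs
      (hrem ω (hZK hω)) (fun i j hij => principalMatrix_ne_zero hD hc hρ (hprin ω (hZK hω)) hη'c hij)
      (spectralParameter_mul_strength hδ hs (Complex.slitPlane_ne_zero (hZs hω)) hP)).1 hdz).2.2.2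
    have hlow := norm_ge_of_det_eq_zero (Real.sqrt_nonneg c) (le_relSize hD hρ)
      (hprin ω (hZK hω)) hη'N hdet
    rw [Real.sq_sqrt hc.le] at hlow
    exact (key ω hω hP (hβ1.trans hlow) _ (hprin ω (hZK hω)) hdet).1

end HalideResonators

open HalideResonators

theorem theorem2p6 (N : ℕ) (hN : 2 ≤ N) (m : Material) (k : ℝ)
    (c d R κ C : ℝ) (hc : 0 < c) (hd : 0 < d) (hR : 0 < R) (hκ : 0 < κ) (hC : 0 < C)
    (Z : Set ℂ) (hZ : IsCompact Z) (hZs : Z ⊆ Complex.slitPlane)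
    (ε : ℝ) (hε : 0 < ε) :
    ∃ ρ₀ : ℝ, 0 < ρ₀ ∧ ∀ (D : Fin N → Set Plane) (δ : ℝ), IsDilute c d R D →
      0 < δ → sizeParam D < ρ₀ → sizeParam D ≤ κ * δ → δ ≤ κ * sizeParam D →
      -- the principal eigenpairs are well defined, up to a phase of the eigenvector
      (∀ ω ∈ Z, ∀ i,
        (∃ ν φ, IsPrincipalEigenpair (scaledWavenumber m δ ω) (D i) ν φ) ∧
        ∀ ν φ ν' φ', IsPrincipalEigenpair (scaledWavenumber m δ ω) (D i) ν φ →
          IsPrincipalEigenpair (scaledWavenumber m δ ω) (D i) ν' φ' →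
          ν' = ν ∧ ∃ a : ℂ, ‖a‖ = 1 ∧
            ∀ᵐ x ∂(MeasureTheory.volume.restrict (D i)), φ' x = a * φ x) ∧
      -- resonant frequencies are zeros of the determinant, at leading order
      (∀ ω ∈ Z, (IsResonance m k δ D ω ∨ IsExpandedResonance m k δ D ω) →
        InPrincipalRegime C m k δ D ω →
        ∃ ω', IsDetZero m k δ D ω' ∧ CloseAtLeadingOrder ε m k ω ω') ∧
      -- zeros of the determinant are resonant frequencies, at leading order
      (∀ ω ∈ Z, IsDetZero m k δ D ω →
        (∃ ω', IsResonance m k δ D ω' ∧ CloseAtLeadingOrder ε m k ω ω') ∧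
        (∃ ω', IsExpandedResonance m k δ D ω' ∧ CloseAtLeadingOrder ε m k ω ω')) := by
  -- The size parameter is positive because `0 < δ ≤ κ * sizeParam D`, so the one-sided
  -- neighbourhood of `0` suffices.
  obtain ⟨ρ₀, hρ₀, h⟩ := (mem_nhdsGT_iff_exists_Ioo_subset (a := (0 : ℝ))).1
    (eventually_resonance_correspondence N hN m k c d R κ C hc hd hR hκ hC Z hZ hZs ε hε)
  refine ⟨ρ₀, hρ₀, fun D δ hD hδ hρ h1 h2 => ?_⟩
  have := hD.isFiniteMeasure
  exact h ⟨pos_of_mul_pos_right (hδ.trans_le h2) hκ.le, hρ⟩ D δ hD hδ rfl h1 h2
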